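/- **Setting.** An instance $I$ of the (non-preemptive) multi-vehicle dial-a-ride problem consists of a vertex set $V$ with $|V|=n$ and a metric $w$ on $V$ (distance $0$ between distinct vertices is allowed), $h\ge 1$ vehicles with initial locations in $V$, a common capacity $\lambda\in\mathbb N^+$, and a multiset $\mathcal R$ of requests $(s,t)\in V\times V$, each an item of unit size. A solution assigns to each vehicle a walk from its initial location (it need not return) such that every item is picked up once at its source and dropped once at its destination, by the same vehicle with no intermediate drop, and no vehicle ever carries total size more than its capacity. Its weight is the total length of the walks, and $\mathrm{OPT}(I)$ is the minimum weight. In a weighted instance the items have given real sizes (each item is unsplittable) and the capacity is a positive real number. Let $\alpha,\beta:\mathbb N\to(0,\infty)$ with $\alpha(n)=\Theta(n/\log n)$ and $\beta(n)=\Theta(\sqrt{n\log n})$. For a pair $p\in V\times V$ let $N_p$ be its multiplicity in $\mathcal R$; $p$ is *normal* if $\lambda/\alpha(n)\le N_p\le\lambda/\beta(n)$. Let $I_u$ be the instance with the same graph, vehicles and capacity whose requests are exactly the requests of $\mathcal R$ of normal type. Put $\gamma=\lambda/\alpha(n)$, and let $\widehat I_w$ be the weighted instance with capacity $\lfloor\alpha(n)\rfloor\gamma$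 that has one item of size $\lceil N_p/\gamma\rceil\gamma$ for each normal $p$ that occurs in $\mathcal R$. **Lemma.** 1. There are a constant $C>0$ and a polynomial-time algorithm (both depending only on the functions $\alpha,\beta$) such that, for every instance $I$ as above, the algorithm on input $I_u$ computes a feasible solution of $I_u$ of weight at most $C\sqrt{n\log n}\cdot\mathrm{OPT}(I_u)$; moreover $\mathrm{OPT}(I_u)\le\mathrm{OPT}(I)$, so the weight is at most $C\sqrt{n\log n}\cdot\mathrm{OPT}(I)$. Here polynomial time means: a number of steps bounded by a polynomial in $n+h+(\text{number of requests of } I_u)$ on a random access machine whose unit-cost operations are indirect addressing, addition, subtraction and comparison of natural numbers and of real numbers. 2. For all sufficiently large $n$ (depending only on $\alpha,\beta$) and every such instance $I$ on $n$ vertices, $\mathrm{OPT}(\widehat I_w)\le 27\cdot\mathrm{OPT}(I_u)$. -/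

import Mathlib

/-! # The multi-vehicle dial-a-ride problem, and a random access machine with a step count -/

noncomputable section

namespace DialARide

/-! ## Metric graph with vehicles, routes, feasibility, optimum -/

/-- A metric `dist` on the vertex set `Fin n` (distinct vertices may be at distance `0`), and the
initial locations of `h` vehicles. -/
structure Network (n h : ℕ) where
  dist : Fin n → Fin n → ℝ
  dist_self : ∀ a, dist a a = 0
  dist_comm : ∀ a b, dist a b = dist b a
  dist_triangle : ∀ a b c, dist a c ≤ dist a b + dist b c
  depot : Fin h → Fin n

/-- A (weighted, non-preemptive) instance with requests indexed by `ι`: request `i` is an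
unsplittable item of size `size i` to be moved from `src i` to `tgt i`; every vehicle has
capacity `cap`. -/
structure WInstance (n h : ℕ) (ι : Type) extends Network n h where
  src : ι → Fin n
  tgt : ι → Fin n
  size : ι → ℝ
  cap : ℝ

/-- One stop of a vehicle: pick up item `i` at its source, drop item `i` at its destination, or
just pass through the vertex `v`. -/
inductive Stop (n : ℕ) (ι : Type) where
  | pick (i : ι)
  | drop (i : ι)
  | pass (v : Fin n)

namespace WInstance

variable {n h : ℕ} {ι : Type}

/-- The vertex at which a stop takes place. -/
def loc (I : WInstance n h ι) : Stop n ι → Fin n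
  | .pick i => I.src i
  | .drop i => I.tgt i
  | .pass v => v

/-- The change of the vehicle's load at a stop. -/
def change (I : WInstance n h ι) : Stop n ι → ℝ
  | .pick i => I.size i
  | .drop i => -I.size i
  | .pass _ => 0

/-- The load of a vehicle that has made exactly the stops in the list. -/
def load (I : WInstance n h ι) (l : List (Stop n ι)) : ℝ :=
  (l.map I.change).sum

/-- The length of the walk that starts at `u` and visits the listed stops in order; the vehicle
need not return. -/
def walkWeight (I : WInstance n h ι) : Fin n → List (Stop n ι) → ℝ
  | _, [] => 0
  | u, x :: l => I.dist u (I.loc x) + I.walkWeight (I.loc x) l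

/-- The total weight of a family of routes, one for each vehicle. -/
def weight (I : WInstance n h ι) (S : Fin h → List (Stop n ι)) : ℝ :=
  ∑ k, I.walkWeight (I.depot k) (S k)

open Classical in
/-- Feasibility: every request is picked up exactly once and dropped exactly once, both by the
same vehicle and in this order, and no vehicle ever carries more than its capacity. -/
structure Feasible (I : WInstance n h ι) (S : Fin h → List (Stop n ι)) : Prop where
  served : ∀ i, ∃ k, [Stop.pick i, Stop.drop i].Sublist (S k) ∧
    ∀ k', (S k').count (Stop.pick i) = (if k' = k then 1 else 0) ∧
      (S k').count (Stop.drop i) = (if k' = k then 1 else 0)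
  capacity : ∀ k l, l <+: S k → I.load l ≤ I.cap

/-- The optimum: the infimum of the weights of all feasible solutions (`⊤` if there is none). -/
def opt (I : WInstance n h ι) : ENNReal :=
  ⨅ (S : Fin h → List (Stop n ι)) (_ : I.Feasible S), ENNReal.ofReal (I.weight S)

end WInstance

/-! ## Unweighted instances, normal requests, and the rescaled weighted instance -/

/-- An (unweighted) instance of the multi-vehicle dial-a-ride problem: a network, a multiset of
requests given as a list of pairs (source, destination), and a positive integral capacity. -/
structure Instance (n h : ℕ) extends Network n h where
  requests : List (Fin n × Fin n)
  cap : ℕ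
  cap_pos : 0 < cap

namespace Instance

variable {n h : ℕ}

/-- The instance with each of the listed requests being a separate item of unit size. -/
def unit (I : Instance n h) : WInstance n h (Fin I.requests.length) where
  toNetwork := I.toNetwork
  src i := (I.requests.get i).1
  tgt i := (I.requests.get i).2
  size _ := 1
  cap := I.cap

/-- The request type `p` is normal if its multiplicity lies between `cap / α` and `cap / β`. -/
def IsNormal (α β : ℝ) (I : Instance n h) (p : Fin n × Fin n) : Prop :=
  (I.cap : ℝ) / α ≤ (I.requests.count p : ℝ) ∧ (I.requests.count p : ℝ) ≤ (I.cap : ℝ) / β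

open Classical in
/-- The instance `I_u` that consists of all the normal requests of `I`. -/
def normal (α β : ℝ) (I : Instance n h) : Instance n h where
  toNetwork := I.toNetwork
  requests := I.requests.filter fun p => decide (I.IsNormal α β p)
  cap := I.cap
  cap_pos := I.cap_pos

/-- The weighted instance obtained from `I_u` by merging all copies of a request type `p` into one
item, rounding the size of that item up to a multiple of `γ = cap / α`, and
rounding the capacity down to `⌊α⌋ * γ`. -/
def rescaled (α β : ℝ) (I : Instance n h) :
    WInstance n h {p : Fin n × Fin n // p ∈ (I.normal α β).requests} where
  toNetwork := I.toNetwork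
  src p := p.1.1
  tgt p := p.1.2
  size p := (⌈(I.requests.count p.1 : ℝ) / ((I.cap : ℝ) / α)⌉ : ℝ) * ((I.cap : ℝ) / α)
  cap := (⌊α⌋ : ℝ) * ((I.cap : ℝ) / α)

end Instance

/-! ## The machine

A random access machine with structured programs. It has natural-number arrays and real arrays,
both with indirect addressing. Arrays have constant names, all cells that are not part of the input
hold `0`, and every operation has unit cost. Naturals can be added, subtracted (truncated at `0`)
and compared, and so can reals (real subtraction is the usual one); there is no multiplication,
division or rounding, and a real number acts on naturals only through comparisons. Numbers
therefore grow by at most one bit per step, and on rational weights a polynomial number of steps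
means polynomial time on a Turing machine. -/

/-- The contents of the memory: cell `i` of the array named `a` is `nat a i`, resp. `real a i`. -/
structure Memory where
  nat : ℕ → ℕ → ℕ
  real : ℕ → ℕ → ℝ

/-- Natural-number expressions. -/
inductive NExp where
  | lit (c : ℕ)
  | cell (a : ℕ) (i : NExp)
  | add (e f : NExp)
  | sub (e f : NExp)

namespace NExp

def eval (σ : Memory) : NExp → ℕ
  | lit c => c
  | cell a i => σ.nat a (i.eval σ)
  | add e f => e.eval σ + f.eval σ
  | sub e f => e.eval σ - f.eval σ

/-- The number of operations in an expression. -/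
def cost : NExp → ℕ
  | lit _ => 1
  | cell _ i => i.cost + 1
  | add e f => e.cost + f.cost + 1
  | sub e f => e.cost + f.cost + 1

end NExp

/-- Real expressions. -/
inductive RExp where
  | cell (a : ℕ) (i : NExp)
  | add (e f : RExp)
  | sub (e f : RExp)

namespace RExp

def eval (σ : Memory) : RExp → ℝ
  | cell a i => σ.real a (i.eval σ)
  | add e f => e.eval σ + f.eval σ
  | sub e f => e.eval σ - f.eval σ

/-- The number of operations in an expression. -/
def cost : RExp → ℕ
  | cell _ i => i.cost + 1
  | add e f => e.cost + f.cost + 1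
  | sub e f => e.cost + f.cost + 1

end RExp

/-- Tests: comparison of two naturals or of two reals. -/
inductive Test where
  | natLE (e f : NExp)
  | realLE (e f : RExp)

namespace Test

def Holds (σ : Memory) : Test → Prop
  | natLE e f => e.eval σ ≤ f.eval σ
  | realLE e f => e.eval σ ≤ f.eval σ

def cost : Test → ℕ
  | natLE e f => e.cost + f.cost + 1
  | realLE e f => e.cost + f.cost + 1

end Test

/-- Programs; `setNat a i e` stores the value of `e` in cell `i` of the array `a`. -/
inductive Program where
  | skip
  | setNat (a : ℕ) (i e : NExp)
  | setReal (a : ℕ) (i : NExp) (e : RExp)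
  | seq (P Q : Program)
  | ite (b : Test) (P Q : Program)
  | loop (b : Test) (P : Program)

def Memory.setNat (σ : Memory) (a i v : ℕ) : Memory where
  nat := Function.update σ.nat a (Function.update (σ.nat a) i v)
  real := σ.real

def Memory.setReal (σ : Memory) (a i : ℕ) (v : ℝ) : Memory where
  nat := σ.nat
  real := Function.update σ.real a (Function.update (σ.real a) i v)

/-- `Run P σ t τ`: the program `P`, started on the memory `σ`, halts after `t` steps with the
memory `τ`. -/
inductive Run : Program → Memory → ℕ → Memory → Prop where
  | skip (σ) : Run .skip σ 1 σ
  | setNat (a i e σ) :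
      Run (.setNat a i e) σ (i.cost + e.cost + 1) (σ.setNat a (i.eval σ) (e.eval σ))
  | setReal (a i e σ) :
      Run (.setReal a i e) σ (i.cost + e.cost + 1) (σ.setReal a (i.eval σ) (e.eval σ))
  | seq {P Q σ τ ρ s t} : Run P σ s τ → Run Q τ t ρ → Run (.seq P Q) σ (s + t) ρ
  | ite_true {b P Q σ τ t} : b.Holds σ → Run P σ t τ → Run (.ite b P Q) σ (b.cost + t) τ
  | ite_false {b P Q σ τ t} : ¬ b.Holds σ → Run Q σ t τ → Run (.ite b P Q) σ (b.cost + t) τ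
  | loop_done {b P σ} : ¬ b.Holds σ → Run (.loop b P) σ b.cost σ
  | loop_step {b P σ τ ρ s t} : b.Holds σ → Run P σ s τ → Run (.loop b P) τ t ρ →
      Run (.loop b P) σ (b.cost + s + t) ρ

/-! ## Input and output -/

/-- A finite sequence as the contents of an array. -/
def toArray {k : ℕ} (f : Fin k → ℕ) (i : ℕ) : ℕ :=
  if hi : i < k then f ⟨i, hi⟩ else 0

/-- The memory that holds the instance: the natural array `0` starts with `n`, `h`, the number of
requests and the capacity, the arrays `1`, `2`, `3` hold the vehicle locations, the sources and the
destinations, and the real array `0` holds the matrix of distances, row by row. -/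
def Instance.input {n h : ℕ} (I : Instance n h) : Memory where
  nat a := match a with
    | 0 => toArray ![n, h, I.requests.length, I.cap]
    | 1 => toArray fun k => (I.depot k : ℕ)
    | 2 => toArray fun i => ((I.requests.get i).1 : ℕ)
    | 3 => toArray fun i => ((I.requests.get i).2 : ℕ)
    | _ => fun _ => 0
  real a x :=
    if hx : a = 0 ∧ x < n * n then
      I.dist ⟨x / n, Nat.div_lt_of_lt_mul hx.2⟩
        ⟨x % n, Nat.mod_lt _ (Nat.pos_of_ne_zero fun h0 => by simp [h0] at hx)⟩
    else 0

/-- The routes read off the final memory: cell `0` of the natural array `4` holds the total number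
of stops, and for the `j`-th stop the arrays `5`, `6`, `7` hold the vehicle that makes it, its kind
(`0` for a pick-up, everything else for a delivery) and its request. Stops with an
invalid vehicle or request index are void. -/
def output {h m : ℕ} (n : ℕ) (τ : Memory) (k : Fin h) : List (Stop n (Fin m)) :=
  (List.range (τ.nat 4 0)).filterMap fun j =>
    if hi : τ.nat 7 j < m then
      if τ.nat 5 j = (k : ℕ) then
        some (if τ.nat 6 j = 0 then Stop.pick ⟨τ.nat 7 j, hi⟩ else Stop.drop ⟨τ.nat 7 j, hi⟩)
      else none
    else none

end DialARide

end

/-! # Dial-a-ride: an approximation algorithm, and the rescaled weighted instance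

**The algorithm.** A solution of weight `W` gives the lower bounds of `LowerBound`: the lengths of
the requests sum to at most `cap * W` (`WInstance.Feasible.sum_dist_le`, by a potential argument);
no request is longer than `W`; all requests of length at least `D` lie on one path whose length is
at most `3 * W` if every step is charged at most `2 * D`, since a vehicle that serves one of them
walks at least `D`; and walks of total length `W` connect the sources to the vehicles. The algorithm
deals with the requests scale by scale, a scale consisting of the requests with lengths between `D`
and `2 * D`, where `D` is the length of the shortest request not dealt with yet.

For one scale, Prim's algorithm with distances capped at `2 * D` finds walks through the sources and
targets of capped length `O(W)`; here a vertex is inserted into a walk right behind its nearest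
neighbour. An exchange argument (`Prim.weight_le`) compares them with the path of the lower bound. A
request never connects two different walks (`Prim.lt_dist`). The walks are cut into segments of
length at most `r * D`, with `r` about `√(n * log n)`, and on the walk of a request there are
`O(n / r)` segments. Requests with the same pair of segments are collected in loads of `cap`
requests; a load is served by one sweep along the segment of the sources and one along that of the
targets. A full load costs `O(r * D)`, which is `O(r)` times the length of its requests divided by
`cap`, so the first lower bound pays for all of them. There is at most one load that is not full per
pair of segments, and a segment occurs in `O(n / r)` pairs; the total length of the segments is
`O(W)` per scale, and since a scale also costs at most `O(n * D)` and the scales grow geometrically,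
`O(log n * W)` altogether (`sum_min_le`). Hence the loads cost `O((r + (n / r) * log n) * W)`, which
is `O(√(n * log n) * W)`. One more run of Prim's algorithm, starting from the vehicles, gives walks
that visit all sources, on which the tours of the loads are strung as detours (`sum_routes_le`). The
machine computes all this with additions and comparisons only: the coordinate of a vertex on its
segment is accumulated, and `r` is found by counting up squares.

**The rescaled instance.** Given a solution of `I_u`, choose for every request type a random copy as
its representative and one of `13` colours. For each colour the vehicles repeat their walks and
carry the merged items along the routes of the representatives of that colour; walking back and
forth `13` times costs `26` times the weight. The capacity can only be exceeded when some item `p`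
is picked up. At that moment at most `cap` copies are on board, so that the expected load of the
colour of `p` is at most `2 * cap / 13`, and since no item is larger than `2 * cap / β` an
exponential moment bound shows that it exceeds the capacity with probability `exp (-Ω(β))`. As `β`
dominates `log n`, a union bound over the `n ^ 2` request types yields a choice for which no
capacity is exceeded (`exists_representatives`).
-/

noncomputable section

namespace DialARide

/-! ### Bounded execution of programs -/

/-- An upper bound for the number of steps of a program each of whose loops makes at most `s`
iterations whenever it is entered. -/
def Program.time (s : ℕ) : Program → ℕ
  | .skip => 1
  | .setNat _ i e => i.cost + e.cost + 1
  | .setReal _ i e => i.cost + e.cost + 1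
  | .seq P Q => P.time s + Q.time s
  | .ite b P Q => b.cost + P.time s + Q.time s
  | .loop b P => s * (b.cost + P.time s) + b.cost

/-- The bound `Program.time` is a polynomial in the number of iterations, whose degree is the depth of
the nesting of the loops. -/
theorem Program.exists_polynomial_time (P : Program) :
    ∃ p : Polynomial ℕ, ∀ s, p.eval s = P.time s := by
  induction P with
  | skip => exact ⟨1, by simp [Program.time]⟩
  | setNat a i e => exact ⟨Polynomial.C (i.cost + e.cost + 1), by simp [Program.time]⟩
  | setReal a i e => exact ⟨Polynomial.C (i.cost + e.cost + 1), by simp [Program.time]⟩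
  | seq P Q hP hQ =>
    obtain ⟨p, hp⟩ := hP
    obtain ⟨q, hq⟩ := hQ
    exact ⟨p + q, by simp [Program.time, hp, hq]⟩
  | ite b P Q hP hQ =>
    obtain ⟨p, hp⟩ := hP
    obtain ⟨q, hq⟩ := hQ
    exact ⟨Polynomial.C b.cost + p + q, by simp [Program.time, hp, hq]⟩
  | loop b P hP =>
    obtain ⟨p, hp⟩ := hP
    exact ⟨Polynomial.X * (Polynomial.C b.cost + p) + Polynomial.C b.cost,
      by simp [Program.time, hp]⟩

/-- Whether the program contains an assignment to the natural array `a`. -/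
def Program.writesNat (a : ℕ) : Program → Bool
  | .skip => false
  | .setNat b _ _ => a == b
  | .setReal _ _ _ => false
  | .seq P Q => P.writesNat a || Q.writesNat a
  | .ite _ P Q => P.writesNat a || Q.writesNat a
  | .loop _ P => P.writesNat a

/-- Whether the program contains an assignment to the real array `a`. -/
def Program.writesReal (a : ℕ) : Program → Bool
  | .skip => false
  | .setNat _ _ _ => false
  | .setReal b _ _ => a == b
  | .seq P Q => P.writesReal a || Q.writesReal a
  | .ite _ P Q => P.writesReal a || Q.writesReal a
  | .loop _ P => P.writesReal a

/-- The arrays to which `P` makes no assignment are the same in `σ` and in `τ`. -/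
structure Unchanged (P : Program) (σ τ : Memory) : Prop where
  nat : ∀ a, P.writesNat a = false → τ.nat a = σ.nat a
  real : ∀ a, P.writesReal a = false → τ.real a = σ.real a

theorem Unchanged.refl (P : Program) (σ : Memory) : Unchanged P σ σ :=
  ⟨fun _ _ => rfl, fun _ _ => rfl⟩

theorem Unchanged.trans {P : Program} {σ τ ρ : Memory} (h : Unchanged P σ τ)
    (h' : Unchanged P τ ρ) : Unchanged P σ ρ :=
  ⟨fun a ha => (h'.nat a ha).trans (h.nat a ha), fun a ha => (h'.real a ha).trans (h.real a ha)⟩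

/-- A program changes only the arrays to which it contains an assignment, which is decidable by
evaluation. This is how facts about the memory are carried past a program that does not touch
them. -/
theorem Run.unchanged {P : Program} {σ τ : Memory} {t : ℕ} (h : Run P σ t τ) :
    Unchanged P σ τ := by
  induction h with
  | skip σ => exact Unchanged.refl _ _
  | setNat a i e σ =>
    refine ⟨fun b hb => ?_, fun b _ => rfl⟩
    have hb : b ≠ a := by simpa [Program.writesNat] using hb
    simp [Memory.setNat, Function.update_of_ne hb]
  | setReal a i e σ =>
    refine ⟨fun b _ => rfl, fun b hb => ?_⟩
    have hb : b ≠ a := by simpa [Program.writesReal] using hb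
    simp [Memory.setReal, Function.update_of_ne hb]
  | seq _ _ h1 h2 =>
    refine ⟨fun b hb => ?_, fun b hb => ?_⟩
    · simp only [Program.writesNat, Bool.or_eq_false_iff] at hb
      rw [h2.nat b hb.2, h1.nat b hb.1]
    · simp only [Program.writesReal, Bool.or_eq_false_iff] at hb
      rw [h2.real b hb.2, h1.real b hb.1]
  | ite_true _ _ h1 =>
    refine ⟨fun b hb => ?_, fun b hb => ?_⟩
    · simp only [Program.writesNat, Bool.or_eq_false_iff] at hb
      rw [h1.nat b hb.1]
    · simp only [Program.writesReal, Bool.or_eq_false_iff] at hb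
      rw [h1.real b hb.1]
  | ite_false _ _ h1 =>
    refine ⟨fun b hb => ?_, fun b hb => ?_⟩
    · simp only [Program.writesNat, Bool.or_eq_false_iff] at hb
      rw [h1.nat b hb.2]
    · simp only [Program.writesReal, Bool.or_eq_false_iff] at hb
      rw [h1.real b hb.2]
  | loop_done _ => exact Unchanged.refl _ _
  | loop_step _ _ _ h1 h2 =>
    exact ⟨fun b hb => (h2.nat b hb).trans (h1.nat b hb),
      fun b hb => (h2.real b hb).trans (h1.real b hb)⟩

/-- `P`, started on `σ`, halts with the memory `τ` within the time that is due to loops of at most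
`s` iterations. -/
def Exec (s : ℕ) (P : Program) (σ τ : Memory) : Prop :=
  ∃ t, Run P σ t τ ∧ t ≤ P.time s

namespace Exec

variable {s : ℕ} {P Q : Program} {σ τ ρ : Memory} {b : Test}

theorem unchanged (h : Exec s P σ τ) : Unchanged P σ τ :=
  let ⟨_, h, _⟩ := h
  h.unchanged

theorem skip : Exec s .skip σ σ := ⟨_, .skip σ, le_rfl⟩

theorem setNat {a : ℕ} {i e : NExp} :
    Exec s (.setNat a i e) σ (σ.setNat a (i.eval σ) (e.eval σ)) := ⟨_, .setNat a i e σ, le_rfl⟩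

theorem setReal {a : ℕ} {i : NExp} {e : RExp} :
    Exec s (.setReal a i e) σ (σ.setReal a (i.eval σ) (e.eval σ)) := ⟨_, .setReal a i e σ, le_rfl⟩

theorem seq (hP : Exec s P σ τ) (hQ : Exec s Q τ ρ) : Exec s (.seq P Q) σ ρ := by
  obtain ⟨t, hP, ht⟩ := hP
  obtain ⟨u, hQ, hu⟩ := hQ
  exact ⟨_, .seq hP hQ, by simp only [Program.time]; omega⟩

theorem ite_true (hb : b.Holds σ) (hP : Exec s P σ τ) : Exec s (.ite b P Q) σ τ := by
  obtain ⟨t, hP, ht⟩ := hP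
  exact ⟨_, .ite_true hb hP, by simp only [Program.time]; omega⟩

theorem ite_false (hb : ¬ b.Holds σ) (hQ : Exec s Q σ τ) : Exec s (.ite b P Q) σ τ := by
  obtain ⟨t, hQ, ht⟩ := hQ
  exact ⟨_, .ite_false hb hQ, by simp only [Program.time]; omega⟩

/-- The rule for loops: `inv f τ` is an invariant of which the number `f` bounds the number of
remaining iterations. -/
theorem loop (f : ℕ) (hf : f ≤ s) (inv : ℕ → Memory → Prop) (h0 : inv f σ)
    (step : ∀ f τ, Unchanged P σ τ → inv f τ → b.Holds τ →
      ∃ g ρ, g < f ∧ Exec s P τ ρ ∧ inv g ρ) :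
    ∃ τ g, Exec s (.loop b P) σ τ ∧ ¬ b.Holds τ ∧ inv g τ := by
  suffices H : ∀ f τ, Unchanged P σ τ → inv f τ → ∃ t ρ g, Run (.loop b P) τ t ρ ∧
      t ≤ f * (b.cost + P.time s) + b.cost ∧ ¬ b.Holds ρ ∧ inv g ρ by
    obtain ⟨t, ρ, g, hr, ht, hb, hi⟩ := H f σ (.refl _ _) h0
    refine ⟨ρ, g, ⟨t, hr, ht.trans ?_⟩, hb, hi⟩
    simp only [Program.time]
    gcongr
  intro f
  induction f using Nat.strong_induction_on with
  | _ f ih =>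
    intro τ hτ hi
    by_cases hb : b.Holds τ
    · obtain ⟨g, ρ, hg, ⟨u, hu, hu'⟩, hρ⟩ := step f τ hτ hi hb
      obtain ⟨t, κ, e, hr, ht, hb', hi'⟩ := ih g hg ρ (hτ.trans hu.unchanged) hρ
      refine ⟨_, κ, e, .loop_step hb hu hr, ?_, hb', hi'⟩
      obtain ⟨f, rfl⟩ : ∃ f', f = f' + 1 := ⟨f - 1, by omega⟩
      have : g * (b.cost + P.time s) ≤ f * (b.cost + P.time s) := by gcongr; omega
      rw [Nat.succ_mul]
      omega
    · exact ⟨_, τ, f, .loop_done hb, by omega, hb, hi⟩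

end Exec

/-- Cell `0` of a natural array, used as a scalar variable. -/
abbrev NExp.var (a : ℕ) : NExp := .cell a (.lit 0)

/-- Cell `0` of a real array, used as a scalar variable. -/
abbrev RExp.var (a : ℕ) : RExp := .cell a (.lit 0)

/-- `for i = 0, …, N - 1 do P`; the bound is evaluated anew before each iteration. -/
def Program.forLoop (i : ℕ) (N : NExp) (P : Program) : Program :=
  .seq (.setNat i (.lit 0) (.lit 0))
    (.loop (.natLE (.add (.var i) (.lit 1)) N)
      (.seq P (.setNat i (.lit 0) (.add (.var i) (.lit 1)))))

namespace Memory

variable (σ : Memory) (a b i j v : ℕ) (x : ℝ)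

@[simp] theorem setNat_nat_ne (h : b ≠ a) : (σ.setNat a i v).nat b = σ.nat b := by
  simp [setNat, Function.update_of_ne h]

@[simp] theorem setNat_nat_self : (σ.setNat a i v).nat a = Function.update (σ.nat a) i v := by
  simp [setNat]

@[simp] theorem setNat_real : (σ.setNat a i v).real = σ.real := rfl

@[simp] theorem setReal_nat : (σ.setReal a i x).nat = σ.nat := rfl

@[simp] theorem setReal_real_ne (h : b ≠ a) : (σ.setReal a i x).real b = σ.real b := by
  simp [setReal, Function.update_of_ne h]

@[simp] theorem setReal_real_self :
    (σ.setReal a i x).real a = Function.update (σ.real a) i x := by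
  simp [setReal]

end Memory

namespace Exec

variable {s : ℕ} {P Q : Program} {σ τ ρ : Memory} {b : Test}

/-- The rule for counting loops. -/
theorem forLoop {i : ℕ} {N : NExp} (k : ℕ) (hk : k ≤ s) (inv : ℕ → Memory → Prop)
    (hi : P.writesNat i = false)
    (h0 : inv 0 (σ.setNat i 0 0))
    (hN : ∀ τ, Unchanged (.forLoop i N P) σ τ → N.eval τ = k)
    (step : ∀ j < k, ∀ τ, Unchanged (.forLoop i N P) σ τ → τ.nat i 0 = j → inv j τ →
      ∃ ρ, Exec s P τ ρ ∧ inv (j + 1) (ρ.setNat i 0 (j + 1))) :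
    ∃ τ, Exec s (.forLoop i N P) σ τ ∧ inv k τ ∧ Unchanged (.forLoop i N P) σ τ := by
  have hset : Exec s (.setNat i (.lit 0) (.lit 0)) σ (σ.setNat i 0 0) := setNat
  have hU : ∀ τ, Unchanged (.seq P (.setNat i (.lit 0) (.add (.var i) (.lit 1))))
      (σ.setNat i 0 0) τ → Unchanged (.forLoop i N P) σ τ := fun τ h => by
    refine ⟨fun a ha => ?_, fun a ha => ?_⟩
    · simp only [Program.forLoop, Program.writesNat, Bool.or_eq_false_iff] at ha
      rw [h.nat a (by simp [Program.writesNat, ha]), hset.unchanged.nat a ha.1]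
    · simp only [Program.forLoop, Program.writesReal, Bool.or_eq_false_iff] at ha
      rw [h.real a (by simp [Program.writesReal, ha])]
      rfl
  obtain ⟨τ, g, hτ, hb, hg⟩ := Exec.loop (s := s) (σ := σ.setNat i 0 0)
    (b := .natLE (.add (.var i) (.lit 1)) N)
    (P := .seq P (.setNat i (.lit 0) (.add (.var i) (.lit 1)))) k hk
    (fun f τ => ∃ j, j + f = k ∧ τ.nat i 0 = j ∧ inv j τ) ⟨0, by simp, by simp, h0⟩ (by
      rintro f τ hτ ⟨j, hjf, hj, hij⟩ hb
      have hNτ := hN τ (hU τ hτ)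
      simp only [Test.Holds, NExp.eval, hNτ, hj] at hb
      obtain ⟨ρ, hρ, hρ'⟩ := step j (by omega) τ (hU τ hτ) hj hij
      have hρi : ρ.nat i 0 = j := by rw [hρ.unchanged.nat i hi, hj]
      refine ⟨f - 1, ρ.setNat i 0 (j + 1), by omega, ?_, j + 1, by omega, by simp, hρ'⟩
      have := hρ.seq (Exec.setNat (a := i) (i := .lit 0) (e := .add (.var i) (.lit 1)))
      simpa [NExp.eval, hρi] using this)
  obtain ⟨j, hjf, hj, hij⟩ := hg
  have hτ' := hU τ ⟨fun a ha => hτ.unchanged.nat a ha, fun a ha => hτ.unchanged.real a ha⟩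
  have hNτ := hN τ hτ'
  simp only [Test.Holds, NExp.eval, hNτ, hj] at hb
  obtain rfl : j = k := by omega
  exact ⟨τ, hset.seq hτ, hij, hτ'⟩

end Exec

/-! ### Lengths of walks -/

/-- A symmetric distance function with zero diagonal that satisfies the triangle inequality. -/
structure IsPseudoMetric {V : Type*} (d : V → V → ℝ) : Prop where
  self : ∀ a, d a a = 0
  symm : ∀ a b, d a b = d b a
  tri : ∀ a b c, d a c ≤ d a b + d b c

theorem IsPseudoMetric.nonneg {V : Type*} {d : V → V → ℝ} (hd : IsPseudoMetric d) (a b : V) :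
    0 ≤ d a b := by
  have := hd.tri a b a
  rw [hd.self, hd.symm b a] at this
  linarith

theorem IsPseudoMetric.min {V : Type*} {d : V → V → ℝ} (hd : IsPseudoMetric d) {c : ℝ}
    (hc : 0 ≤ c) : IsPseudoMetric fun a b => min (d a b) c where
  self a := by simp [hd.self, hc]
  symm a b := by rw [hd.symm]
  tri x y z := by
    have h1 := hd.tri x y z
    have h2 := hd.nonneg x y
    have h3 := hd.nonneg y z
    rcases min_cases (d x y) c with h | h <;> rcases min_cases (d y z) c with h' | h' <;>
      rw [h.1, h'.1] <;> first
      | exact (min_le_left _ _).trans h1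
      | exact (min_le_right _ _).trans (by linarith)

section Walk

variable {V : Type*} (d : V → V → ℝ)

/-- The length of the walk from `u` through the vertices of the list. -/
def walkLen : V → List V → ℝ
  | _, [] => 0
  | u, x :: l => d u x + walkLen x l

/-- The length of the walk through the vertices of the list. -/
def pathLen : List V → ℝ
  | [] => 0
  | x :: l => walkLen d x l

@[simp] theorem walkLen_nil (u : V) : walkLen d u [] = 0 := rfl

@[simp] theorem walkLen_cons (u x : V) (l : List V) :
    walkLen d u (x :: l) = d u x + walkLen d x l := rfl

@[simp] theorem pathLen_nil : pathLen d [] = 0 := rfl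

theorem pathLen_cons (x : V) (l : List V) : pathLen d (x :: l) = walkLen d x l := rfl

theorem walkLen_append_cons (u x : V) (A B : List V) :
    walkLen d u (A ++ x :: B) = walkLen d u (A ++ [x]) + walkLen d x B := by
  induction A generalizing u with
  | nil => simp
  | cons a A ih => simp [ih a, add_assoc]

theorem pathLen_append_cons (x : V) (A B : List V) :
    pathLen d (A ++ x :: B) = pathLen d (A ++ [x]) + pathLen d (x :: B) := by
  cases A with
  | nil => simp [pathLen]
  | cons a A => simpa [pathLen] using walkLen_append_cons d a x A B

theorem pathLen_append_cons_cons (x y : V) (A B : List V) :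
    pathLen d (A ++ x :: y :: B) = pathLen d (A ++ [x]) + d x y + pathLen d (y :: B) := by
  rw [pathLen_append_cons]
  simp [pathLen, add_assoc]

variable {d}
variable (hd : IsPseudoMetric d)
include hd

theorem walkLen_nonneg (u : V) (l : List V) : 0 ≤ walkLen d u l := by
  induction l generalizing u with
  | nil => simp
  | cons x l ih => exact add_nonneg (hd.nonneg _ _) (ih x)

theorem pathLen_nonneg (l : List V) : 0 ≤ pathLen d l := by
  cases l with
  | nil => simp
  | cons x l => exact walkLen_nonneg hd x l

theorem walkLen_le_add (u v : V) (l : List V) : walkLen d u l ≤ d u v + walkLen d v l := by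
  cases l with
  | nil => simpa using hd.nonneg u v
  | cons x l => have := hd.tri u v x; simp; linarith

theorem walkLen_sublist {l l' : List V} (h : l'.Sublist l) (u : V) :
    walkLen d u l' ≤ walkLen d u l := by
  induction h generalizing u with
  | slnil => simp
  | cons x _ ih =>
    refine (walkLen_le_add hd u x _).trans ?_
    simpa using ih x
  | cons_cons x _ ih => simpa using ih x

theorem pathLen_sublist {l l' : List V} (h : l'.Sublist l) : pathLen d l' ≤ pathLen d l := by
  induction h with
  | slnil => simp
  | @cons l₁ l₂ x _ ih =>
    refine ih.trans ?_
    cases l₂ with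
    | nil => simp [pathLen]
    | cons y l => simpa [pathLen] using hd.nonneg x y
  | cons_cons x h _ => exact walkLen_sublist hd h x

theorem pathLen_le_walkLen (u : V) (l : List V) : pathLen d l ≤ walkLen d u l :=
  pathLen_sublist hd (List.sublist_cons_self u l)

theorem dist_le_walkLen {u v : V} {l : List V} (h : v ∈ l) : d u v ≤ walkLen d u l := by
  have := walkLen_sublist hd (List.singleton_sublist.2 h) u
  simpa using this

theorem dist_le_pathLen {u v : V} {l : List V} (hu : u ∈ l) (hv : v ∈ l) :
    d u v ≤ pathLen d l := by
  induction l with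
  | nil => simp at hu
  | cons x l ih =>
    rcases List.mem_cons.1 hu with rfl | hu'
    · rcases List.mem_cons.1 hv with rfl | hv'
      · rw [hd.self]; exact pathLen_nonneg hd _
      · exact dist_le_walkLen hd hv'
    · rcases List.mem_cons.1 hv with rfl | hv'
      · rw [hd.symm]; exact dist_le_walkLen hd hu'
      · exact (ih hu' hv').trans (pathLen_le_walkLen hd x l)

end Walk

/-! ### Prim's algorithm with capped distances -/

/-- The states reached by Prim's algorithm from the list `L₀` of visited vertices, with their tags,
and the set `K₀` of vertices still to be visited: the list of visited vertices, the set of the other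
ones and the weight spent. The unvisited vertex `v` that is closest to the visited ones is put
right behind its nearest neighbour and gets the same tag; if all unvisited vertices are farther than
`lim` from the visited ones, then one of them is appended at the cost `lim`, with a new tag. -/
inductive Prim (d : ℕ → ℕ → ℝ) (lim : ℝ) (L₀ : List (ℕ × ℕ)) (K₀ : Finset ℕ) :
    List (ℕ × ℕ) → Finset ℕ → ℝ → Prop
  | start : Prim d lim L₀ K₀ L₀ K₀ 0
  | insert {A B x c K W v} : Prim d lim L₀ K₀ (A ++ (x, c) :: B) K W → v ∈ K → d x v ≤ lim →
      (∀ p ∈ A ++ (x, c) :: B, ∀ u ∈ K, d x v ≤ d p.1 u) →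
      Prim d lim L₀ K₀ (A ++ (x, c) :: (v, c) :: B) (K.erase v) (W + d x v)
  | append {L K W v} : Prim d lim L₀ K₀ L K W → v ∈ K → (∀ p ∈ L, ∀ u ∈ K, lim < d p.1 u) →
      Prim d lim L₀ K₀ (L ++ [(v, L.length)]) (K.erase v) (W + lim)

theorem exists_split_of_head {V : Type*} {p : V → Prop} {v : V} {l : List V} (hv : ¬ p v)
    (hl : ∃ a ∈ l, p a) : ∃ A x y B, v :: l = A ++ x :: y :: B ∧ ¬ p x ∧ p y ∧ v ∈ A ++ [x] := by
  induction l generalizing v with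
  | nil => simp at hl
  | cons w l ih =>
    by_cases hw : p w
    · exact ⟨[], v, w, l, rfl, hv, hw, by simp⟩
    · obtain ⟨a, ha, hpa⟩ := hl
      obtain rfl | ha := List.mem_cons.1 ha
      · exact absurd hpa hw
      obtain ⟨A, x, y, B, h, hx, hy, -⟩ := ih hw ⟨a, ha, hpa⟩
      exact ⟨v :: A, x, y, B, by simp [h], hx, hy, by simp⟩

/-- A list with a visited element and the unvisited element `v` can be split at a boundary between
visited and unvisited elements, in such a way that `v` is on the unvisited side. -/
theorem exists_split {V : Type*} {p : V → Prop} {v : V} {l : List V} (hv : ¬ p v) (hvl : v ∈ l)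
    (hl : ∃ a ∈ l, p a) : ∃ A x y B, l = A ++ x :: y :: B ∧
      ((p x ∧ ¬ p y ∧ v ∈ y :: B) ∨ (¬ p x ∧ p y ∧ v ∈ A ++ [x])) := by
  induction l with
  | nil => simp at hvl
  | cons z l ih =>
    by_cases hvl' : v ∈ l
    · by_cases hl' : ∃ a ∈ l, p a
      · obtain ⟨A, x, y, B, rfl, h⟩ := ih hvl' hl'
        refine ⟨z :: A, x, y, B, rfl, ?_⟩
        rcases h with h | h
        · exact .inl h
        · exact .inr ⟨h.1, h.2.1, List.mem_cons_of_mem _ h.2.2⟩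
      · obtain ⟨a, ha, hpa⟩ := hl
        push Not at hl'
        obtain rfl | ha := List.mem_cons.1 ha
        · cases l with
          | nil => simp at hvl'
          | cons y B => exact ⟨[], a, y, B, rfl, .inl ⟨hpa, hl' y (by simp), hvl'⟩⟩
        · exact absurd hpa (hl' a ha)
    · obtain rfl | h := List.mem_cons.1 hvl
      · obtain ⟨a, ha, hpa⟩ := hl
        obtain rfl | ha := List.mem_cons.1 ha
        · exact absurd hpa hv
        obtain ⟨A, x, y, B, h, hx, hy, hvA⟩ := exists_split_of_head hv ⟨a, ha, hpa⟩
        exact ⟨A, x, y, B, h, .inr ⟨hx, hy, hvA⟩⟩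
      · exact absurd h hvl'

/-- A family of walks that together connect all vertices of `K` to the set `X`. -/
structure Connects (X K : Finset ℕ) (F : List (List ℕ)) : Prop where
  mem : ∀ l ∈ F, ∀ v ∈ l, v ∈ X ∪ K
  meets : ∀ l ∈ F, ∃ a ∈ l, a ∈ X
  covers : ∀ v ∈ K, ∃ l ∈ F, v ∈ l

/-- The exchange step: when the vertex `v` is visited, a step of one of the walks, no shorter than
any lower bound `w` for the distance between visited and unvisited vertices, can be given up. -/
theorem Connects.step {d : ℕ → ℕ → ℝ} (hd : IsPseudoMetric d) {X K : Finset ℕ} (hXK : Disjoint X K)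
    {F : List (List ℕ)} (hF : Connects X K F) {v : ℕ} (hv : v ∈ K) {w : ℝ}
    (hw : ∀ a ∈ X, ∀ b ∈ K, w ≤ d a b) :
    ∃ F', Connects (insert v X) (K.erase v) F' ∧
      (F'.map (pathLen d)).sum + w ≤ (F.map (pathLen d)).sum := by
  obtain ⟨l, hl, hvl⟩ := hF.covers v hv
  obtain ⟨F₁, F₂, rfl⟩ := List.append_of_mem hl
  have hunion : ∀ u, u ∈ insert v X ∪ K.erase v ↔ u ∈ X ∪ K := fun u => by
    by_cases h : u = v <;> simp [h, hv]
  have hvX : v ∉ X := fun h => Finset.disjoint_left.1 hXK h hv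
  have hKX : ∀ u ∈ X ∪ K, u ∉ X → u ∈ K := fun u hu hu' => by
    simpa [hu'] using hu
  obtain ⟨A, x, y, B, rfl, h⟩ := exists_split (p := (· ∈ X)) hvX hvl (hF.meets l hl)
  have hmem := hF.mem _ hl
  have hwxy : w ≤ d x y := by
    rcases h with h | h
    · exact hw x h.1 y (hKX y (hmem y (by simp)) h.2.1)
    · rw [hd.symm]
      exact hw y h.2.1 x (hKX x (hmem x (by simp)) h.1)
  refine ⟨F₁ ++ (A ++ [x]) :: (y :: B) :: F₂, ⟨?_, ?_, ?_⟩, ?_⟩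
  · intro l' hl' u hu
    rw [hunion]
    simp only [List.mem_append, List.mem_cons] at hl'
    rcases hl' with h' | rfl | rfl | h'
    · exact hF.mem l' (by simp [h']) u hu
    · refine hmem u ?_
      simp at hu ⊢
      tauto
    · refine hmem u ?_
      simp at hu ⊢
      tauto
    · exact hF.mem l' (by simp [h']) u hu
  · intro l' hl'
    simp only [List.mem_append, List.mem_cons] at hl'
    rcases hl' with h' | rfl | rfl | h'
    · obtain ⟨a, ha, haX⟩ := hF.meets l' (by simp [h'])
      exact ⟨a, ha, by simp [haX]⟩
    · rcases h with h | h
      · exact ⟨x, by simp, by simp [h.1]⟩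
      · exact ⟨v, h.2.2, by simp⟩
    · rcases h with h | h
      · exact ⟨v, h.2.2, by simp⟩
      · exact ⟨y, by simp, by simp [h.2.1]⟩
    · obtain ⟨a, ha, haX⟩ := hF.meets l' (by simp [h'])
      exact ⟨a, ha, by simp [haX]⟩
  · intro u hu
    obtain ⟨l', hl', hul'⟩ := hF.covers u (Finset.mem_of_mem_erase hu)
    simp only [List.mem_append, List.mem_cons] at hl'
    rcases hl' with h' | rfl | h'
    · exact ⟨l', by simp [h'], hul'⟩
    · by_cases huA : u ∈ A ++ [x]
      · exact ⟨A ++ [x], by simp, huA⟩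
      · refine ⟨y :: B, by simp, ?_⟩
        simp at hul' huA ⊢
        tauto
    · exact ⟨l', by simp [h'], hul'⟩
  · simp only [List.map_append, List.map_cons, List.sum_append, List.sum_cons,
      pathLen_append_cons_cons]
    linarith

/-- The weight of Prim's algorithm is a lower bound for every family of walks that connects the
vertices to be visited with the initial ones. -/
theorem Prim.weight_le {d : ℕ → ℕ → ℝ} (hd : IsPseudoMetric d) {lim : ℝ} (hlim : 0 ≤ lim)
    {L₀ L : List (ℕ × ℕ)} {K₀ K : Finset ℕ} {W : ℝ} (h : Prim d lim L₀ K₀ L K W)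
    (h₀ : Disjoint (L₀.map Prod.fst).toFinset K₀)
    {F : List (List ℕ)} (hF : Connects (L₀.map Prod.fst).toFinset K₀ F) :
    W ≤ (F.map (pathLen fun a b => min (d a b) lim)).sum := by
  have hd' := hd.min hlim
  suffices H : Disjoint (L.map Prod.fst).toFinset K ∧
      ∃ F', Connects (L.map Prod.fst).toFinset K F' ∧
      (F'.map (pathLen fun a b => min (d a b) lim)).sum + W ≤
        (F.map (pathLen fun a b => min (d a b) lim)).sum by
    obtain ⟨-, F', -, h⟩ := H
    have : 0 ≤ (F'.map (pathLen fun a b => min (d a b) lim)).sum :=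
      List.sum_nonneg (by simpa using fun a _ => pathLen_nonneg hd' a)
    linarith
  induction h with
  | start => exact ⟨h₀, F, hF, by simp⟩
  | @insert A B x c K W v h hv hlim' hmin ih =>
    obtain ⟨hdis, F', hF', hW⟩ := ih
    have heq : ((A ++ (x, c) :: (v, c) :: B).map Prod.fst).toFinset =
        Insert.insert v ((A ++ (x, c) :: B).map Prod.fst).toFinset := by
      ext u; simp; tauto
    obtain ⟨F'', hF'', hW'⟩ := hF'.step hd' hdis hv (w := d x v) (by
      intro a ha b hb
      simp only [List.mem_toFinset, List.mem_map] at ha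
      obtain ⟨p, hp, rfl⟩ := ha
      exact le_min (hmin p hp b hb) hlim')
    rw [heq]
    refine ⟨?_, F'', hF'', by linarith⟩
    rw [Finset.disjoint_left] at hdis ⊢
    intro a ha hb
    rcases Finset.mem_insert.1 ha with rfl | ha
    · simp at hb
    · exact hdis ha (Finset.mem_of_mem_erase hb)
  | @append L K W v h hv hmin ih =>
    obtain ⟨hdis, F', hF', hW⟩ := ih
    have heq : ((L ++ [(v, L.length)]).map Prod.fst).toFinset =
        Insert.insert v (L.map Prod.fst).toFinset := by
      ext u; simp
    obtain ⟨F'', hF'', hW'⟩ := hF'.step hd' hdis hv (w := lim) (by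
      intro a ha b hb
      simp only [List.mem_toFinset, List.mem_map] at ha
      obtain ⟨p, hp, rfl⟩ := ha
      exact le_min (hmin p hp b hb).le le_rfl)
    rw [heq]
    refine ⟨?_, F'', hF'', by linarith⟩
    rw [Finset.disjoint_left] at hdis ⊢
    intro a ha hb
    rcases Finset.mem_insert.1 ha with rfl | ha
    · simp at hb
    · exact hdis ha (Finset.mem_of_mem_erase hb)

/-- The vertices of the list with the tag `c`, in their order. -/
def block (L : List (ℕ × ℕ)) (c : ℕ) : List ℕ :=
  (L.filter fun p => p.2 = c).map Prod.fst

theorem block_append (L L' : List (ℕ × ℕ)) (c : ℕ) :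
    block (L ++ L') c = block L c ++ block L' c := by
  simp [block]

theorem block_cons (p : ℕ × ℕ) (L : List (ℕ × ℕ)) (c : ℕ) :
    block (p :: L) c = if p.2 = c then p.1 :: block L c else block L c := by
  by_cases h : p.2 = c <;> simp [block, h]

namespace Prim

variable {d : ℕ → ℕ → ℝ} {lim : ℝ} {L₀ L : List (ℕ × ℕ)} {K₀ K : Finset ℕ} {W : ℝ}

theorem subset (h : Prim d lim L₀ K₀ L K W) : K ⊆ K₀ := by
  induction h with
  | start => exact subset_rfl
  | insert _ _ _ _ ih => exact (Finset.erase_subset _ _).trans ih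
  | append _ _ _ ih => exact (Finset.erase_subset _ _).trans ih

theorem length_add_card (h : Prim d lim L₀ K₀ L K W) :
    L.length + K.card = L₀.length + K₀.card := by
  induction h with
  | start => rfl
  | @insert A B x c K W v _ hv _ _ ih =>
    rw [← ih, ← Finset.card_erase_add_one hv]
    simp; omega
  | @append L K W v _ hv _ ih =>
    rw [← ih, ← Finset.card_erase_add_one hv]
    simp; omega

theorem mem_or (h : Prim d lim L₀ K₀ L K W) {v : ℕ} (hv : v ∈ K₀) :
    v ∈ K ∨ v ∈ L.map Prod.fst := by
  induction h with
  | start => exact .inl hv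
  | @insert A B x c K W u _ hu _ _ ih =>
    by_cases huv : v = u
    · simp [huv]
    · simp [huv] at ih ⊢
      tauto
  | @append L K W u _ hu _ ih =>
    by_cases huv : v = u
    · simp [huv]
    · simp [huv] at ih ⊢
      tauto

theorem mem_start (h : Prim d lim L₀ K₀ L K W) {v : ℕ} (hv : v ∈ L.map Prod.fst) :
    v ∈ L₀.map Prod.fst ∨ v ∈ K₀ := by
  induction h with
  | start => exact .inl hv
  | @insert A B x c K W u h hu _ _ ih =>
    by_cases huv : v = u
    · exact .inr (huv ▸ h.subset hu)
    · refine ih ?_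
      simp [huv] at hv ⊢
      tauto
  | @append L K W u h hu _ ih =>
    by_cases huv : v = u
    · exact .inr (huv ▸ h.subset hu)
    · refine ih ?_
      simp [huv] at hv ⊢
      tauto

theorem start_subset (h : Prim d lim L₀ K₀ L K W) {p : ℕ × ℕ} (hp : p ∈ L₀) : p ∈ L := by
  induction h with
  | start => exact hp
  | insert _ _ _ _ ih => simp at ih ⊢; tauto
  | append _ _ _ ih => simp at ih ⊢; tauto

theorem tag_lt (h : Prim d lim L₀ K₀ L K W) (h₀ : ∀ p ∈ L₀, p.2 < L₀.length) :
    ∀ p ∈ L, p.2 < L.length := by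
  induction h with
  | start => exact h₀
  | @insert A B x c K W u h hu _ _ ih =>
    have hc := ih (x, c) (by simp)
    intro p hp
    have : p = (u, c) ∨ p ∈ A ++ (x, c) :: B := by
      simp at hp ⊢; tauto
    rcases this with rfl | hp
    · simp at hc ⊢; omega
    · have := ih p hp
      simp at this ⊢; omega
  | @append L K W u h hu _ ih =>
    intro p hp
    rcases List.mem_append.1 hp with hp | hp
    · have := ih p hp
      simp; omega
    · simp at hp
      simp [hp]

theorem sum_le (h : Prim d lim L₀ K₀ L K W) : W + K.card * lim ≤ K₀.card * lim := by
  induction h with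
  | start => simp
  | @insert A B x c K W v _ hv hle _ ih =>
    rw [← Finset.card_erase_add_one hv] at ih
    push_cast at ih
    linarith
  | @append L K W v _ hv _ ih =>
    rw [← Finset.card_erase_add_one hv] at ih
    push_cast at ih
    linarith

theorem weight_nonneg (hd : IsPseudoMetric d) (hlim : 0 ≤ lim) (h : Prim d lim L₀ K₀ L K W) :
    0 ≤ W := by
  induction h with
  | start => exact le_rfl
  | insert _ _ _ _ ih => exact add_nonneg ih (hd.nonneg _ _)
  | append _ _ _ ih => exact add_nonneg ih hlim

/-- Inserting a vertex behind its nearest neighbour lengthens a walk by at most twice their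
distance, hence the walks through the vertices of equal tag are short. -/
theorem sum_pathLen_block_le (hd : IsPseudoMetric d) (hlim : 0 ≤ lim)
    (h : Prim d lim L₀ K₀ L K W) (h₀ : ∀ p ∈ L₀, p.2 < L₀.length) (N : ℕ) :
    ∑ c ∈ Finset.range N, pathLen d (block L c) ≤
      ∑ c ∈ Finset.range N, pathLen d (block L₀ c) + 2 * W := by
  induction h with
  | start => simp
  | @insert A B x c K W v h hv hle _ ih =>
    have key : ∀ a, pathLen d (block (A ++ (x, c) :: (v, c) :: B) a) ≤
        pathLen d (block (A ++ (x, c) :: B) a) + if a = c then 2 * d x v else 0 := by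
      intro a
      by_cases hac : a = c
      · subst hac
        simp only [block_append, block_cons, if_true]
        rw [pathLen_append_cons, pathLen_append_cons d x _ (block B a)]
        simp only [pathLen, walkLen_cons]
        have := walkLen_le_add hd v x (block B a)
        rw [hd.symm v x] at this
        linarith
      · simp [block_append, block_cons, hac, Ne.symm hac]
    have h1 := Finset.sum_le_sum fun a (_ : a ∈ Finset.range N) => key a
    rw [Finset.sum_add_distrib, Finset.sum_ite_eq'] at h1
    have h2 : (if c ∈ Finset.range N then 2 * d x v else 0) ≤ 2 * d x v := by
      have := hd.nonneg x v
      split_ifs <;> linarith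
    linarith
  | @append L K W v h hv _ ih =>
    have htag := h.tag_lt h₀
    have key : ∀ a, pathLen d (block (L ++ [(v, L.length)]) a) = pathLen d (block L a) := by
      intro a
      by_cases ha : L.length = a
      · subst ha
        have : block L L.length = [] := by
          simp only [block, List.map_eq_nil_iff, List.filter_eq_nil_iff]
          intro p hp
          have := htag p hp
          simp; omega
        rw [block_append, this]
        simp [block, pathLen]
      · simp [block, ha]
    simp only [key]
    linarith

/-- The walk with a new tag is paid for by the charge `lim`, hence there are few walks. -/
theorem card_tags_le (hd : IsPseudoMetric d) (hlim : 0 ≤ lim) (h : Prim d lim L₀ K₀ L K W) :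
    ((L.map Prod.snd).toFinset.card : ℝ) * lim ≤ (L₀.map Prod.snd).toFinset.card * lim + W := by
  induction h with
  | start => simp
  | @insert A B x c K W v h hv hle _ ih =>
    have : ((A ++ (x, c) :: (v, c) :: B).map Prod.snd).toFinset =
        ((A ++ (x, c) :: B).map Prod.snd).toFinset := by
      ext u; simp
    rw [this]
    linarith [hd.nonneg x v]
  | @append L K W v h hv _ ih =>
    have : ((L ++ [(v, L.length)]).map Prod.snd).toFinset =
        Insert.insert L.length (L.map Prod.snd).toFinset := by
      ext u; simp
    have h2 : (((L ++ [(v, L.length)]).map Prod.snd).toFinset.card : ℝ) ≤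
        (L.map Prod.snd).toFinset.card + 1 := by
      rw [this]
      exact_mod_cast Finset.card_insert_le _ _
    nlinarith

/-- Visited vertices with different tags are farther apart than `lim`: when a new tag is
introduced, all vertices that are not visited yet are that far from all visited ones. -/
theorem lt_dist (hd : IsPseudoMetric d) {v₀ : ℕ} (h : Prim d lim [(v₀, 0)] K₀ L K W) :
    ∀ p ∈ L, ∀ q ∈ L, p.2 ≠ q.2 → lim < d p.1 q.1 := by
  suffices H : (∃ c, ∀ p ∈ L, p.2 ≠ c → ∀ u ∈ K, lim < d p.1 u) ∧
      ∀ p ∈ L, ∀ q ∈ L, p.2 ≠ q.2 → lim < d p.1 q.1 from H.2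
  induction h with
  | start =>
    refine ⟨⟨0, ?_⟩, ?_⟩
    · rintro p hp hp'
      simp at hp
      simp [hp] at hp'
    · intro p hp q hq hpq
      simp at hp hq
      simp [hp, hq] at hpq
  | @insert A B x c K W v h hv hle _ ih =>
    obtain ⟨⟨c', hc'⟩, ih⟩ := ih
    obtain rfl : c = c' := by
      by_contra hcc
      have := hc' (x, c) (by simp) hcc v hv
      simp at this
      linarith
    have hmem : ∀ p ∈ A ++ (x, c) :: (v, c) :: B, p = (v, c) ∨ p ∈ A ++ (x, c) :: B := by
      intro p hp
      simp at hp ⊢; tauto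
    refine ⟨⟨c, ?_⟩, ?_⟩
    · intro p hp hpc u hu
      rcases hmem p hp with rfl | hp
      · simp at hpc
      · exact hc' p hp hpc u (Finset.mem_of_mem_erase hu)
    · intro p hp q hq hpq
      rcases hmem p hp with rfl | hp <;> rcases hmem q hq with rfl | hq
      · simp at hpq
      · rw [hd.symm]
        exact hc' q hq hpq.symm v hv
      · exact hc' p hp hpq v hv
      · exact ih p hp q hq hpq
  | @append L K W v h hv hlt ih =>
    obtain ⟨-, ih⟩ := ih
    refine ⟨⟨L.length, ?_⟩, ?_⟩
    · intro p hp hpc u hu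
      rcases List.mem_append.1 hp with hp | hp
      · exact hlt p hp u (Finset.mem_of_mem_erase hu)
      · simp at hp
        simp [hp] at hpc
    · intro p hp q hq hpq
      rcases List.mem_append.1 hp with hp | hp <;> rcases List.mem_append.1 hq with hq | hq
      · exact ih p hp q hq hpq
      · simp at hq
        subst hq
        exact hlt p hp v hv
      · simp at hp
        subst hp
        rw [hd.symm]
        exact hlt q hq v hv
      · simp at hp hq
        simp [hp, hq] at hpq

end Prim

/-! ### Cutting walks into segments -/

/-- The result of cutting a walk greedily into segments of length at most `ℓ`. The list holds, in
reverse order, the vertices of the walk, each with the number of its segment, where the numbers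
start with `a₀ + 1`, and with its coordinate, that is its distance from the start of the segment
along the walk. -/
inductive Cut (d : ℕ → ℕ → ℝ) (ℓ : ℝ) (a₀ : ℕ) : List (ℕ × ℕ × ℝ) → Prop
  | start (x : ℕ) : Cut d ℓ a₀ [(x, a₀ + 1, 0)]
  | same {x y a c T} : Cut d ℓ a₀ ((x, a, c) :: T) → c + d x y ≤ ℓ →
      Cut d ℓ a₀ ((y, a, c + d x y) :: (x, a, c) :: T)
  | next {x y a c T} : Cut d ℓ a₀ ((x, a, c) :: T) → ℓ < c + d x y →
      Cut d ℓ a₀ ((y, a + 1, 0) :: (x, a, c) :: T)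

namespace Cut

variable {d : ℕ → ℕ → ℝ} {ℓ : ℝ} {a₀ : ℕ} {T : List (ℕ × ℕ × ℝ)}

theorem headD_mem (h : Cut d ℓ a₀ T) : T.headD (0, 0, 0) ∈ T := by
  cases h <;> simp

theorem bounds (hd : IsPseudoMetric d) (hℓ : 0 ≤ ℓ) (h : Cut d ℓ a₀ T) :
    (∀ p ∈ T, a₀ < p.2.1 ∧ 0 ≤ p.2.2 ∧ p.2.2 ≤ ℓ) ∧
      ∀ p ∈ T, p.2.1 ≤ (T.headD (0, 0, 0)).2.1 := by
  induction h with
  | start x => simp [hℓ]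
  | @same x y a c T h hle ih =>
    obtain ⟨h1, h2⟩ := ih
    have := h1 (x, a, c) (by simp)
    have := hd.nonneg x y
    refine ⟨?_, ?_⟩
    · intro p hp
      rcases List.mem_cons.1 hp with rfl | hp
      · exact ⟨by tauto, by simp; linarith, hle⟩
      · exact h1 p hp
    · intro p hp
      rcases List.mem_cons.1 hp with rfl | hp
      · simp
      · simpa using h2 p hp
  | @next x y a c T h hlt ih =>
    obtain ⟨h1, h2⟩ := ih
    have := h1 (x, a, c) (by simp)
    refine ⟨?_, ?_⟩
    · intro p hp
      rcases List.mem_cons.1 hp with rfl | hp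
      · exact ⟨by simp at this ⊢; omega, le_rfl, hℓ⟩
      · exact h1 p hp
    · intro p hp
      rcases List.mem_cons.1 hp with rfl | hp
      · simp
      · have := h2 p hp
        simp at this ⊢
        omega

/-- The difference of the coordinates of two vertices of a segment is the length of the walk between
them. -/
theorem dist_le (hd : IsPseudoMetric d) (h : Cut d ℓ a₀ T) :
    T.Pairwise fun p q => p.2.1 = q.2.1 → d q.1 p.1 ≤ p.2.2 - q.2.2 := by
  suffices H : (∀ p ∈ T, p.2.1 ≤ (T.headD (0, 0, 0)).2.1 ∧
      (p.2.1 = (T.headD (0, 0, 0)).2.1 →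
        d p.1 (T.headD (0, 0, 0)).1 ≤ (T.headD (0, 0, 0)).2.2 - p.2.2)) ∧
      T.Pairwise fun p q => p.2.1 = q.2.1 → d q.1 p.1 ≤ p.2.2 - q.2.2 from H.2
  induction h with
  | start x => simp [hd.self]
  | @same x y a c T h hle ih =>
    have hlast : ∀ p ∈ (x, a, c) :: T, p.2.1 ≤ a ∧
        (p.2.1 = a → d p.1 y ≤ c + d x y - p.2.2) := by
      intro p hp
      have := ih.1 p hp
      refine ⟨by simpa using this.1, fun hpa => ?_⟩
      have h1 := this.2 (by simpa using hpa)
      have h2 := hd.tri p.1 x y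
      simp at h1
      linarith
    refine ⟨?_, List.pairwise_cons.2 ⟨fun q hq hpq => (hlast q hq).2 hpq.symm, ih.2⟩⟩
    intro p hp
    rcases List.mem_cons.1 hp with rfl | hp
    · simp [hd.self]
    · simpa using hlast p hp
  | @next x y a c T h hle ih =>
    have hlast : ∀ p ∈ (x, a, c) :: T, p.2.1 ≤ a := fun p hp => by simpa using (ih.1 p hp).1
    refine ⟨?_, List.pairwise_cons.2 ⟨fun q hq hpq => ?_, ih.2⟩⟩
    · intro p hp
      rcases List.mem_cons.1 hp with rfl | hp
      · simp [hd.self]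
      · have := hlast p hp
        exact ⟨by simp; omega, fun hpa => by simp at hpa; omega⟩
    · have := hlast q hq
      simp at hpq
      omega

/-- The segments have lengths at most `ℓ`, bound the coordinates on them, and add up to at most the
length of the walk. -/
theorem lens (hd : IsPseudoMetric d) (hℓ : 0 ≤ ℓ) (h : Cut d ℓ a₀ T) :
    ∃ len : ℕ → ℝ, (∀ b, 0 ≤ len b ∧ len b ≤ ℓ) ∧ (∀ p ∈ T, p.2.2 ≤ len p.2.1) ∧
      ∑ b ∈ Finset.Ioc a₀ (T.headD (0, 0, 0)).2.1, len b ≤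
        pathLen d (T.map Prod.fst).reverse := by
  suffices H : ∃ len : ℕ → ℝ, (∀ b, 0 ≤ len b ∧ len b ≤ ℓ) ∧ (∀ p ∈ T, p.2.2 ≤ len p.2.1) ∧
      len (T.headD (0, 0, 0)).2.1 = (T.headD (0, 0, 0)).2.2 ∧
      ∑ b ∈ Finset.Ioc a₀ (T.headD (0, 0, 0)).2.1, len b ≤
        pathLen d (T.map Prod.fst).reverse by
    obtain ⟨len, h1, h2, -, h3⟩ := H
    exact ⟨len, h1, h2, h3⟩
  induction h with
  | start x => exact ⟨fun _ => 0, by simp [hℓ], by simp, by simp, by simp [pathLen]⟩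
  | @same x y a c T h hle ih =>
    obtain ⟨len, h1, h2, h3, h4⟩ := ih
    have hb := h.bounds hd hℓ
    have hxac := hb.1 (x, a, c) (by simp)
    simp only [List.headD_cons] at h3 h4 hb hxac ⊢
    have hxy := hd.nonneg x y
    refine ⟨Function.update len a (c + d x y), fun b => ?_, fun p hp => ?_, by simp, ?_⟩
    · by_cases hba : b = a
      · subst hba
        simp
        exact ⟨by linarith, hle⟩
      · simpa [Function.update_of_ne hba] using h1 b
    · rcases List.mem_cons.1 hp with rfl | hp
      · simp
      · by_cases hpa : p.2.1 = a
        · have := h2 p hp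
          rw [hpa, h3] at this
          rw [hpa, Function.update_self]
          linarith
        · rw [Function.update_of_ne hpa]
          exact h2 p hp
    · obtain ⟨a, rfl⟩ : ∃ a', a = a' + 1 := ⟨a - 1, by omega⟩
      have ha : a₀ ≤ a := by omega
      rw [Finset.sum_Ioc_succ_top ha] at h4 ⊢
      have : ∑ k ∈ Finset.Ioc a₀ a, Function.update len (a + 1) (c + d x y) k =
          ∑ k ∈ Finset.Ioc a₀ a, len k := by
        refine Finset.sum_congr rfl fun k hk => Function.update_of_ne ?_ _ _
        have := (Finset.mem_Ioc.1 hk).2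
        omega
      rw [this, Function.update_self]
      simp only [List.map_cons, List.reverse_cons, List.append_assoc, List.singleton_append] at h4 ⊢
      rw [pathLen_append_cons_cons]
      simp [pathLen] at h4 ⊢
      linarith
  | @next x y a c T h hlt ih =>
    obtain ⟨len, h1, h2, h3, h4⟩ := ih
    have hb := h.bounds hd hℓ
    have hxac := hb.1 (x, a, c) (by simp)
    simp only [List.headD_cons] at h3 h4 hb hxac ⊢
    have hxy := hd.nonneg x y
    refine ⟨Function.update len (a + 1) 0, fun b => ?_, fun p hp => ?_, by simp, ?_⟩
    · by_cases hba : b = a + 1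
      · subst hba
        simp [hℓ]
      · simpa [Function.update_of_ne hba] using h1 b
    · rcases List.mem_cons.1 hp with rfl | hp
      · simp
      · have := hb.2 p hp
        rw [Function.update_of_ne (by omega)]
        exact h2 p hp
    · rw [Finset.sum_Ioc_succ_top hxac.1.le, Function.update_self]
      have : ∑ k ∈ Finset.Ioc a₀ a, Function.update len (a + 1) 0 k =
          ∑ k ∈ Finset.Ioc a₀ a, len k := by
        refine Finset.sum_congr rfl fun k hk => Function.update_of_ne ?_ _ _
        have := (Finset.mem_Ioc.1 hk).2
        omega
      rw [this]
      simp only [List.map_cons, List.reverse_cons, List.append_assoc, List.singleton_append] at h4 ⊢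
      rw [pathLen_append_cons_cons]
      simp [pathLen] at h4 ⊢
      linarith

/-- Every segment but the last one, together with the step behind it, is longer than `ℓ`. -/
theorem count_le (hd : IsPseudoMetric d) (hℓ : 0 ≤ ℓ) (h : Cut d ℓ a₀ T) :
    (T.headD (0, 0, 0)).2.1 = a₀ + 1 ∨
      (((T.headD (0, 0, 0)).2.1 : ℝ) - a₀ - 1) * ℓ < pathLen d (T.map Prod.fst).reverse := by
  suffices H : ((T.headD (0, 0, 0)).2.1 = a₀ + 1 ∧
        (T.headD (0, 0, 0)).2.2 ≤ pathLen d (T.map Prod.fst).reverse) ∨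
      (((T.headD (0, 0, 0)).2.1 : ℝ) - a₀ - 1) * ℓ + (T.headD (0, 0, 0)).2.2 <
        pathLen d (T.map Prod.fst).reverse by
    rcases H with H | H
    · exact .inl H.1
    · right
      have : 0 ≤ (T.headD (0, 0, 0)).2.2 := by
        cases T with
        | nil => simp
        | cons p T => exact ((h.bounds hd hℓ).1 p (by simp)).2.1
      linarith
  induction h with
  | start x => simp [pathLen]
  | @same x y a c T h hle ih =>
    simp only [List.map_cons, List.reverse_cons, List.append_assoc, List.singleton_append,
      List.headD_cons, pathLen_append_cons_cons] at ih ⊢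
    rcases ih with ih | ih
    · exact .inl ⟨ih.1, by simp [pathLen] at ih ⊢; linarith⟩
    · right
      simp [pathLen] at ih ⊢
      linarith
  | @next x y a c T h hlt ih =>
    right
    simp only [List.map_cons, List.reverse_cons, List.append_assoc, List.singleton_append,
      List.headD_cons, pathLen_append_cons_cons] at ih ⊢
    rcases ih with ih | ih
    · simp [pathLen, ih.1] at ih ⊢
      linarith
    · push_cast
      simp [pathLen] at ih ⊢
      linarith

end Cut

/-! ### Names of variables and the encoding of the input -/

notation "aRow" => 10
notation "vU" => 11
notation "vJ" => 12
notation "vFound" => 13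
notation "vBu" => 14
notation "vBj" => 15
notation "vCnt" => 16
notation "aLoc" => 17
notation "aTag" => 18
notation "aNeed" => 19
notation "rBest" => 1

/-- An instance with vertices, vehicles and requests named by natural numbers. -/
structure Data where
  n : ℕ
  h : ℕ
  m : ℕ
  cap : ℕ
  d : ℕ → ℕ → ℝ
  depot : ℕ → ℕ
  src : ℕ → ℕ
  tgt : ℕ → ℕ
  metric : IsPseudoMetric d
  h_pos : 0 < h
  cap_pos : 0 < cap
  depot_lt : ∀ k, depot k < n
  src_lt : ∀ q, src q < n
  tgt_lt : ∀ q, tgt q < n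

/-- The length of a request. -/
def Data.len (X : Data) (q : ℕ) : ℝ := X.d (X.src q) (X.tgt q)

/-- A bound for the number of iterations of each loop. -/
def Data.size (X : Data) : ℕ := X.n + X.h + X.m

/-- The memory holds the instance, and the array `aRow` the indices of the rows of the matrix. -/
structure Base (X : Data) (σ : Memory) : Prop where
  n : σ.nat 0 0 = X.n
  h : σ.nat 0 1 = X.h
  m : σ.nat 0 2 = X.m
  cap : σ.nat 0 3 = X.cap
  depot : ∀ k < X.h, σ.nat 1 k = X.depot k
  src : ∀ q < X.m, σ.nat 2 q = X.src q
  tgt : ∀ q < X.m, σ.nat 3 q = X.tgt q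
  dist : ∀ u < X.n, ∀ v < X.n, σ.real 0 (σ.nat aRow u + v) = X.d u v

theorem Base.congr {X : Data} {σ τ : Memory} (hB : Base X σ) (h0 : τ.nat 0 = σ.nat 0)
    (h1 : τ.nat 1 = σ.nat 1) (h2 : τ.nat 2 = σ.nat 2) (h3 : τ.nat 3 = σ.nat 3)
    (h4 : τ.nat aRow = σ.nat aRow) (h5 : τ.real 0 = σ.real 0) : Base X τ := by
  constructor
  · rw [h0, hB.n]
  · rw [h0, hB.h]
  · rw [h0, hB.m]
  · rw [h0, hB.cap]
  · rw [h1]; exact hB.depot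
  · rw [h2]; exact hB.src
  · rw [h3]; exact hB.tgt
  · rw [h4, h5]; exact hB.dist

/-- Whether a program leaves the encoding of the input unchanged. -/
def Program.keepsBase (P : Program) : Bool :=
  !(P.writesNat 0 || P.writesNat 1 || P.writesNat 2 || P.writesNat 3 || P.writesNat aRow ||
    P.writesReal 0)

theorem Base.unchanged {X : Data} {P : Program} {σ τ : Memory} (hB : Base X σ)
    (h : Unchanged P σ τ) (hP : P.keepsBase = true) : Base X τ := by
  simp only [Program.keepsBase, Bool.not_eq_true', Bool.or_eq_false_iff] at hP
  obtain ⟨⟨⟨⟨⟨h0, h1⟩, h2⟩, h3⟩, h4⟩, h5⟩ := hP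
  exact hB.congr (h.nat _ h0) (h.nat _ h1) (h.nat _ h2) (h.nat _ h3) (h.nat _ h4) (h.real _ h5)

theorem Base.setNat {X : Data} {σ : Memory} (hB : Base X σ) {a : ℕ} (i v : ℕ)
    (ha : 3 < a ∧ a ≠ aRow := by decide) : Base X (σ.setNat a i v) :=
  hB.congr (Memory.setNat_nat_ne _ _ _ _ _ (by omega)) (Memory.setNat_nat_ne _ _ _ _ _ (by omega))
    (Memory.setNat_nat_ne _ _ _ _ _ (by omega)) (Memory.setNat_nat_ne _ _ _ _ _ (by omega))
    (Memory.setNat_nat_ne _ _ _ _ _ ha.2.symm) rfl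

/-- The distance between two vertices. -/
def distExp (u v : NExp) : RExp := .cell 0 (.add (.cell aRow u) v)

theorem Base.eval_distExp {X : Data} {σ : Memory} (hB : Base X σ) {e f : NExp} {u v : ℕ}
    (he : e.eval σ = u) (hf : f.eval σ = v) (hu : u < X.n) (hv : v < X.n) :
    (distExp e f).eval σ = X.d u v := by
  simp [distExp, RExp.eval, NExp.eval, he, hf, hB.dist u hu v hv]

/-! ### Prim's algorithm on the machine -/

/-- Look at the unvisited vertex `vU` and the visited vertex number `vJ`. -/
def compareBest : Program :=
  .ite (.natLE (.var vFound) (.lit 0)) keep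
    (.ite (.realLE (distExp (.cell aLoc (.var vJ)) (.var vU)) (.var rBest)) keep .skip)
where
  keep : Program := .seq (.setNat vFound (.lit 0) (.lit 1)) (.seq (.setNat vBu (.lit 0) (.var vU))
    (.seq (.setNat vBj (.lit 0) (.var vJ))
      (.setReal rBest (.lit 0) (distExp (.cell aLoc (.var vJ)) (.var vU)))))

/-- Find a pair of an unvisited vertex and a visited vertex at the smallest distance. -/
def search : Program :=
  .seq (.setNat vFound (.lit 0) (.lit 0)) (.forLoop vU (.cell 0 (.lit 0))
    (.ite (.natLE (.lit 1) (.cell aNeed (.var vU))) (.forLoop vJ (.var vCnt) compareBest) .skip))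

/-- Among the pairs in `S`, the pair stored in `vBu`, `vBj` is the closest; `vFound` tells whether
`S` is nonempty. -/
def IsBest (X : Data) (loc : ℕ → ℕ) (S : ℕ → ℕ → Prop) (τ : Memory) : Prop :=
  (τ.nat vFound 0 = 0 ∧ ∀ u j, ¬ S u j) ∨
    (τ.nat vFound 0 = 1 ∧ S (τ.nat vBu 0) (τ.nat vBj 0) ∧
      τ.real rBest 0 = X.d (loc (τ.nat vBj 0)) (τ.nat vBu 0) ∧
      ∀ u j, S u j → τ.real rBest 0 ≤ X.d (loc j) u)

theorem IsBest.congr {X : Data} {loc : ℕ → ℕ} {S S' : ℕ → ℕ → Prop} {τ : Memory}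
    (h : IsBest X loc S τ) (hS : ∀ u j, S u j ↔ S' u j) : IsBest X loc S' τ := by
  have : S = S' := by ext u j; exact hS u j
  exact this ▸ h

theorem compareBest_spec {X : Data} {s : ℕ} {τ : Memory} (hB : Base X τ) {S : ℕ → ℕ → Prop}
    {u j : ℕ} (hu : u < X.n) (hj : τ.nat aLoc j < X.n) (hvu : τ.nat vU 0 = u) (hvj : τ.nat vJ 0 = j)
    (hS : IsBest X (τ.nat aLoc) S τ) :
    ∃ ρ, Exec s compareBest τ ρ ∧
      IsBest X (τ.nat aLoc) (fun a b => S a b ∨ (a = u ∧ b = j)) ρ := by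
  have hd : (distExp (.cell aLoc (.var vJ)) (.var vU)).eval τ = X.d (τ.nat aLoc j) u :=
    hB.eval_distExp (by simp [NExp.eval, hvj]) (by simp [NExp.eval, hvu]) hj hu
  have hkeep : (∀ a b, S a b → X.d (τ.nat aLoc j) u ≤ X.d (τ.nat aLoc b) a) →
      ∃ ρ, Exec s compareBest.keep τ ρ ∧
      IsBest X (τ.nat aLoc) (fun a b => S a b ∨ (a = u ∧ b = j)) ρ := fun hle => by
    refine ⟨_, Exec.setNat.seq (Exec.setNat.seq (Exec.setNat.seq Exec.setReal)), .inr ?_⟩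
    have hd' : (distExp (.cell aLoc (.var vJ)) (.var vU)).eval
        (((τ.setNat vFound 0 1).setNat vBu 0 u).setNat vBj 0 j) = X.d (τ.nat aLoc j) u := by
      rw [← hd]
      simp [distExp, RExp.eval, NExp.eval]
    simp only [NExp.eval, Memory.setReal_nat, Memory.setReal_real_self, Memory.setNat_nat_self,
      Function.update_self, ne_eq, Nat.reduceEqDiff, not_false_eq_true,
      Memory.setNat_nat_ne, hvu, hvj, hd']
    refine ⟨trivial, .inr ⟨trivial, trivial⟩, trivial, ?_⟩
    rintro a b (hab | ⟨rfl, rfl⟩)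
    · exact hle a b hab
    · exact le_rfl
  rcases hS with ⟨h0, hS⟩ | ⟨h0, hS, hbest, hle⟩
  · obtain ⟨ρ, hρ, h⟩ := hkeep fun a b hab => absurd hab (hS a b)
    exact ⟨ρ, .ite_true (by simp [Test.Holds, NExp.eval, h0]) hρ, h⟩
  · by_cases hlt : X.d (τ.nat aLoc j) u ≤ τ.real rBest 0
    · obtain ⟨ρ, hρ, h⟩ := hkeep fun a b hab => hlt.trans (hle a b hab)
      refine ⟨ρ, .ite_false (by simp [Test.Holds, NExp.eval, h0]) (.ite_true ?_ hρ), h⟩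
      simpa [Test.Holds, RExp.eval, NExp.eval, hd] using hlt
    · refine ⟨τ, .ite_false (by simp [Test.Holds, NExp.eval, h0]) (.ite_false ?_ .skip), .inr ?_⟩
      · simpa [Test.Holds, RExp.eval, NExp.eval, hd] using hlt
      · refine ⟨h0, .inl hS, hbest, ?_⟩
        rintro a b (hab | ⟨rfl, rfl⟩)
        · exact hle a b hab
        · exact (not_le.1 hlt).le

theorem search_spec {X : Data} {s : ℕ} {σ : Memory} (hB : Base X σ) (hn : X.n ≤ s)
    (hc : σ.nat vCnt 0 ≤ s) (hloc : ∀ j < σ.nat vCnt 0, σ.nat aLoc j < X.n) :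
    ∃ τ, Exec s search σ τ ∧ IsBest X (σ.nat aLoc)
      (fun u j => u < X.n ∧ 1 ≤ σ.nat aNeed u ∧ j < σ.nat vCnt 0) τ := by
  obtain ⟨τ, hτ, hi, -⟩ := Exec.forLoop (s := s) (σ := σ.setNat vFound 0 0) (i := vU)
    (N := .cell 0 (.lit 0))
    (P := .ite (.natLE (.lit 1) (.cell aNeed (.var vU)))
      (.forLoop vJ (.var vCnt) compareBest) .skip)
    X.n hn
    (fun i τ => IsBest X (σ.nat aLoc)
      (fun u j => u < i ∧ 1 ≤ σ.nat aNeed u ∧ j < σ.nat vCnt 0) τ) rfl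
    (.inl ⟨by simp, by simp⟩)
    (fun τ hτ => by simpa [NExp.eval, hτ.nat 0 rfl] using hB.n)
    (by
      intro u hu τ hτ hvu hi
      have hB' : Base X τ := (hB.setNat 0 0).unchanged hτ rfl
      have hneed : τ.nat aNeed = σ.nat aNeed := by simpa using hτ.nat aNeed rfl
      have hcnt : τ.nat vCnt = σ.nat vCnt := by simpa using hτ.nat vCnt rfl
      have hl : τ.nat aLoc = σ.nat aLoc := by simpa using hτ.nat aLoc rfl
      by_cases hnu : 1 ≤ σ.nat aNeed u
      · obtain ⟨ρ, hρ, hi', -⟩ := Exec.forLoop (s := s) (σ := τ) (i := vJ)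
          (N := .var vCnt) (P := compareBest) (σ.nat vCnt 0) hc
          (fun k τ => IsBest X (σ.nat aLoc) (fun a j => (a < u ∧ 1 ≤ σ.nat aNeed a ∧
            j < σ.nat vCnt 0) ∨ (a = u ∧ j < k)) τ) rfl
          (by simpa [IsBest] using hi)
          (fun ρ hρ => by simp [NExp.eval, hρ.nat vCnt rfl, hcnt])
          (by
            intro j hj ρ hρ hvj hi'
            have hl' : ρ.nat aLoc = σ.nat aLoc := by rw [hρ.nat aLoc rfl, hl]
            have hu' : ρ.nat vU 0 = u := by rw [hρ.nat vU rfl, hvu]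
            obtain ⟨κ, hκ, hi''⟩ := compareBest_spec (s := s) (hB'.unchanged hρ rfl) hu
              (by rw [hl']; exact hloc j hj) hu' hvj (hl' ▸ hi')
            refine ⟨κ, hκ, ?_⟩
            have := hi''.congr (S' := fun a b => (a < u ∧ 1 ≤ σ.nat aNeed a ∧
              b < σ.nat vCnt 0) ∨ (a = u ∧ b < j + 1)) (fun a b => by
                constructor
                · rintro ((h | h) | h) <;> omega
                · intro h; omega)
            rw [hl'] at this
            simpa [IsBest] using this)
        refine ⟨ρ, .ite_true (by simpa [Test.Holds, NExp.eval, hneed, hvu] using hnu) hρ, ?_⟩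
        have := hi'.congr (S' := fun a j => a < u + 1 ∧ 1 ≤ σ.nat aNeed a ∧ j < σ.nat vCnt 0)
          (fun a b => by
            constructor
            · rintro (h | ⟨rfl, h⟩)
              · omega
              · exact ⟨by omega, hnu, h⟩
            · rintro ⟨h1, h2, h3⟩
              omega)
        simpa [IsBest] using this
      · refine ⟨τ, .ite_false (by simpa [Test.Holds, NExp.eval, hneed, hvu] using hnu) .skip, ?_⟩
        have := hi.congr (S' := fun a j => a < u + 1 ∧ 1 ≤ σ.nat aNeed a ∧ j < σ.nat vCnt 0)
          (fun a b => by
            constructor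
            · rintro ⟨h1, h2, h3⟩
              exact ⟨by omega, h2, h3⟩
            · rintro ⟨h1, h2, h3⟩
              refine ⟨?_, h2, h3⟩
              rcases (show a < u ∨ a = u by omega) with h | rfl
              · exact h
              · exact absurd h2 hnu)
        simpa [IsBest] using this)
  exact ⟨τ, Exec.setNat.seq hτ, hi⟩

notation "vIx" => 20
notation "vTg" => 21
notation "vSh" => 22

/-- The list of visited vertices and their tags is stored in `aLoc`, `aTag` and `vCnt`. -/
structure HoldsList (L : List (ℕ × ℕ)) (σ : Memory) : Prop where
  count : σ.nat vCnt 0 = L.length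
  get : ∀ j p, L[j]? = some p → σ.nat aLoc j = p.1 ∧ σ.nat aTag j = p.2

theorem HoldsList.congr {L : List (ℕ × ℕ)} {σ τ : Memory} (h : HoldsList L σ)
    (h1 : τ.nat vCnt = σ.nat vCnt) (h2 : τ.nat aLoc = σ.nat aLoc) (h3 : τ.nat aTag = σ.nat aTag) :
    HoldsList L τ :=
  ⟨by rw [h1, h.count], by rw [h2, h3]; exact h.get⟩

theorem HoldsList.get_lt {L : List (ℕ × ℕ)} {σ : Memory} (h : HoldsList L σ) {j : ℕ}
    (hj : j < L.length) : (σ.nat aLoc j, σ.nat aTag j) ∈ L := by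
  have := h.get j L[j] (List.getElem?_eq_getElem hj)
  rw [this.1, this.2]
  exact List.getElem_mem hj

/-- The set of unvisited vertices is stored in `aNeed`. -/
def HoldsSet (n : ℕ) (K : Finset ℕ) (σ : Memory) : Prop :=
  K ⊆ Finset.range n ∧ ∀ u < n, 1 ≤ σ.nat aNeed u ↔ u ∈ K

/-- Move the entries from number `vIx` on by one place. -/
def shift : Program :=
  .forLoop vSh (.sub (.var vCnt) (.var vIx))
    (.seq
      (.setNat aLoc (.sub (.var vCnt) (.var vSh))
        (.cell aLoc (.sub (.sub (.var vCnt) (.var vSh)) (.lit 1))))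
      (.setNat aTag (.sub (.var vCnt) (.var vSh))
        (.cell aTag (.sub (.sub (.var vCnt) (.var vSh)) (.lit 1)))))

/-- Visit the vertex `vBu`, with the tag `vTg`, and put it at the place `vIx`. -/
def insertAt : Program :=
  .seq shift (.seq (.setNat aLoc (.var vIx) (.var vBu)) (.seq (.setNat aTag (.var vIx) (.var vTg))
    (.seq (.setNat vCnt (.lit 0) (.add (.var vCnt) (.lit 1)))
      (.setNat aNeed (.var vBu) (.lit 0)))))

/-- Prim's algorithm; the test `b` decides whether the closest unvisited vertex is close enough for
an insertion behind its nearest neighbour. -/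
def prim (b : Test) : Program :=
  .seq search (.loop (.natLE (.lit 1) (.var vFound))
    (.seq (.ite b
        (.seq (.setNat vIx (.lit 0) (.add (.var vBj) (.lit 1)))
          (.setNat vTg (.lit 0) (.cell aTag (.var vBj))))
        (.seq (.setNat vIx (.lit 0) (.var vCnt)) (.setNat vTg (.lit 0) (.var vCnt))))
      (.seq insertAt search)))

theorem shift_spec {s : ℕ} {σ : Memory} {c i₀ : ℕ} (hcnt : σ.nat vCnt 0 = c)
    (hix : σ.nat vIx 0 = i₀) (hi₀ : i₀ ≤ c) (hc : c ≤ s) :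
    ∃ τ, Exec s shift σ τ ∧
      (∀ i, τ.nat aLoc i = if i₀ < i ∧ i ≤ c then σ.nat aLoc (i - 1) else σ.nat aLoc i) ∧
      ∀ i, τ.nat aTag i = if i₀ < i ∧ i ≤ c then σ.nat aTag (i - 1) else σ.nat aTag i := by
  obtain ⟨τ, hτ, hi, -⟩ := Exec.forLoop (s := s) (σ := σ) (i := vSh)
    (N := .sub (.var vCnt) (.var vIx))
    (P := .seq
      (.setNat aLoc (.sub (.var vCnt) (.var vSh))
        (.cell aLoc (.sub (.sub (.var vCnt) (.var vSh)) (.lit 1))))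
      (.setNat aTag (.sub (.var vCnt) (.var vSh))
        (.cell aTag (.sub (.sub (.var vCnt) (.var vSh)) (.lit 1)))))
    (c - i₀) (by omega)
    (fun k τ =>
      (∀ i, τ.nat aLoc i = if c - k < i ∧ i ≤ c then σ.nat aLoc (i - 1) else σ.nat aLoc i) ∧
      ∀ i, τ.nat aTag i = if c - k < i ∧ i ≤ c then σ.nat aTag (i - 1) else σ.nat aTag i) rfl
    ⟨fun i => by rw [if_neg (by omega)]; simp, fun i => by rw [if_neg (by omega)]; simp⟩
    (fun τ hτ => by simp [NExp.eval, hτ.nat vCnt rfl, hτ.nat vIx rfl, hcnt, hix])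
    (by
      rintro k hk τ hτ hsh ⟨hl, ht⟩
      refine ⟨_, Exec.setNat.seq Exec.setNat, ?_⟩
      have hcnt' : τ.nat vCnt 0 = c := by rw [hτ.nat vCnt rfl, hcnt]
      simp only [NExp.eval, ne_eq, Nat.reduceEqDiff, not_false_eq_true, Memory.setNat_nat_ne,
        Memory.setNat_nat_self, hcnt', hsh]
      refine ⟨fun i => ?_, fun i => ?_⟩
      · by_cases h : i = c - k
        · subst h
          rw [Function.update_self, hl, if_neg (by omega), if_pos (by omega)]
        · rw [Function.update_of_ne h, hl]
          congr 1
          simp; omega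
      · by_cases h : i = c - k
        · subst h
          rw [Function.update_self, ht, if_neg (by omega), if_pos (by omega)]
        · rw [Function.update_of_ne h, ht]
          congr 1
          simp; omega)
  have : c - (c - i₀) = i₀ := by omega
  rw [this] at hi
  exact ⟨τ, hτ, hi⟩

theorem insertAt_spec {n s : ℕ} {σ : Memory} {A B : List (ℕ × ℕ)} {K : Finset ℕ} {u t : ℕ}
    (hL : HoldsList (A ++ B) σ) (hK : HoldsSet n K σ) (hix : σ.nat vIx 0 = A.length)
    (htg : σ.nat vTg 0 = t) (hbu : σ.nat vBu 0 = u) (hc : (A ++ B).length ≤ s) :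
    ∃ τ, Exec s insertAt σ τ ∧ HoldsList (A ++ (u, t) :: B) τ ∧ HoldsSet n (K.erase u) τ := by
  obtain ⟨τ, hτ, hl, ht⟩ := shift_spec (s := s) hL.count hix (by simp) hc
  have hU := hτ.unchanged
  refine ⟨_, hτ.seq (Exec.setNat.seq (Exec.setNat.seq (Exec.setNat.seq Exec.setNat))), ?_, ?_⟩
  · have h1 : τ.nat vIx 0 = A.length := by rw [hU.nat vIx rfl, hix]
    have h2 : τ.nat vBu 0 = u := by rw [hU.nat vBu rfl, hbu]
    have h3 : τ.nat vTg 0 = t := by rw [hU.nat vTg rfl, htg]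
    have h4 : τ.nat vCnt 0 = (A ++ B).length := by rw [hU.nat vCnt rfl, hL.count]
    constructor
    · simp [NExp.eval, h4]; omega
    · intro j p hp
      simp only [NExp.eval, ne_eq, Nat.reduceEqDiff, not_false_eq_true, Memory.setNat_nat_ne,
        Memory.setNat_nat_self, h1, h2, h3]
      rcases lt_trichotomy j A.length with hj | rfl | hj
      · rw [Function.update_of_ne hj.ne, Function.update_of_ne hj.ne, hl, ht, if_neg (by omega),
          if_neg (by omega)]
        apply hL.get j p
        rw [List.getElem?_append_left hj] at hp ⊢
        exact hp
      · simp at hp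
        simp [← hp]
      · obtain ⟨k, rfl⟩ : ∃ k, j = A.length + 1 + k := ⟨j - A.length - 1, by omega⟩
        have hp' : B[k]? = some p := by
          rw [List.getElem?_append_right (by omega)] at hp
          rwa [show A.length + 1 + k - A.length = k + 1 by omega, List.getElem?_cons_succ] at hp
        have hk : k < B.length := (List.getElem?_eq_some_iff.1 hp').1
        rw [Function.update_of_ne hj.ne', Function.update_of_ne hj.ne', hl, ht,
          if_pos (by simp; omega), if_pos (by simp; omega)]
        apply hL.get
        rw [List.getElem?_append_right (by omega), ← hp']
        congr 1
        omega
  · refine ⟨(Finset.erase_subset _ _).trans hK.1, fun v hv => ?_⟩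
    have h2 : τ.nat vBu 0 = u := by rw [hU.nat vBu rfl, hbu]
    have h5 : τ.nat aNeed = σ.nat aNeed := hU.nat aNeed rfl
    simp only [NExp.eval, ne_eq, Nat.reduceEqDiff, not_false_eq_true, Memory.setNat_nat_ne,
        Memory.setNat_nat_self, h2, h5]
    by_cases h : v = u
    · simp [h]
    · rw [Function.update_of_ne h, hK.2 v hv]
      simp [h]

/-- The program `prim` realizes the abstract runs of Prim's algorithm; its memory follows `Prim`. -/
theorem prim_spec {X : Data} {s : ℕ} {σ : Memory} {b : Test} {lim : ℝ} {L₀ : List (ℕ × ℕ)}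
    {K₀ : Finset ℕ} (hB : Base X σ) (hL : HoldsList L₀ σ) (hK : HoldsSet X.n K₀ σ)
    (hL₀ : L₀ ≠ []) (hL₀n : ∀ p ∈ L₀, p.1 < X.n) (hs : L₀.length + K₀.card ≤ s) (hn : X.n ≤ s)
    (hb : ∀ τ, Unchanged (prim b) σ τ → (∃ u < X.n, ∃ v < X.n, τ.real rBest 0 = X.d u v) →
      (b.Holds τ ↔ τ.real rBest 0 ≤ lim)) :
    ∃ τ L W, Exec s (prim b) σ τ ∧ Prim X.d lim L₀ K₀ L ∅ W ∧ HoldsList L τ ∧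
      ∀ u < X.n, τ.nat aNeed u = 0 := by
  have hloc : ∀ {L : List (ℕ × ℕ)} {K : Finset ℕ} {W : ℝ} {τ : Memory},
      Prim X.d lim L₀ K₀ L K W → HoldsList L τ → ∀ j < τ.nat vCnt 0, τ.nat aLoc j < X.n := by
    intro L K W τ hP hL j hj
    have hmem := hL.get_lt (hL.count ▸ hj)
    rcases hP.mem_start (v := τ.nat aLoc j) (List.mem_map_of_mem (f := Prod.fst) hmem) with h | h
    · obtain ⟨p, hp, hp'⟩ := List.mem_map.1 h
      exact hp' ▸ hL₀n p hp
    · exact Finset.mem_range.1 (hK.1 h)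
  -- the invariant at the start of an iteration, after the search
  let inv : ℕ → Memory → Prop := fun f τ => ∃ L K W, Prim X.d lim L₀ K₀ L K W ∧ K.card = f ∧
    HoldsList L τ ∧ HoldsSet X.n K τ ∧ Base X τ ∧
    IsBest X (τ.nat aLoc) (fun u j => u ∈ K ∧ j < L.length) τ
  have hsearch : ∀ {L : List (ℕ × ℕ)} {K : Finset ℕ} {W : ℝ} {τ : Memory},
      Prim X.d lim L₀ K₀ L K W → HoldsList L τ → HoldsSet X.n K τ → Base X τ →
      ∃ ρ, Exec s search τ ρ ∧ inv K.card ρ := by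
    intro L K W τ hP hL hK hB
    obtain ⟨ρ, hρ, hbest⟩ := search_spec (s := s) hB hn
      (by rw [hL.count]; have := hP.length_add_card; omega) (hloc hP hL)
    have hU := hρ.unchanged
    refine ⟨ρ, hρ, L, K, W, hP, rfl, hL.congr (hU.nat _ rfl) (hU.nat _ rfl) (hU.nat _ rfl),
      ⟨hK.1, by rw [hU.nat aNeed rfl]; exact hK.2⟩, hB.unchanged hU rfl, ?_⟩
    rw [hU.nat aLoc rfl]
    refine hbest.congr fun u j => ?_
    rw [hL.count]
    constructor
    · rintro ⟨h1, h2, h3⟩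
      exact ⟨(hK.2 u h1).1 h2, h3⟩
    · rintro ⟨h1, h2⟩
      have := Finset.mem_range.1 (hK.1 h1)
      exact ⟨this, (hK.2 u this).2 h1, h2⟩
  obtain ⟨σ', hσ', hinv⟩ := hsearch .start hL hK hB
  obtain ⟨τ, g, hτ, hnot, L, K, W, hP, -, hL', hK', -, hbest⟩ := Exec.loop (s := s)
    (b := .natLE (.lit 1) (.var vFound)) (σ := σ')
    (P := .seq (.ite b
        (.seq (.setNat vIx (.lit 0) (.add (.var vBj) (.lit 1)))
          (.setNat vTg (.lit 0) (.cell aTag (.var vBj))))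
        (.seq (.setNat vIx (.lit 0) (.var vCnt)) (.setNat vTg (.lit 0) (.var vCnt))))
      (.seq insertAt search)) K₀.card (by omega) inv hinv (by
    rintro f τ hτ ⟨L, K, W, hP, rfl, hL, hK, hB, hbest⟩ hfound
    have hbU : Unchanged (prim b) σ τ := by
      refine Unchanged.trans (τ := σ') ⟨fun a ha => ?_, fun a ha => ?_⟩
        ⟨fun a ha => ?_, fun a ha => ?_⟩
      · simp only [prim, Program.writesNat, Bool.or_eq_false_iff] at ha
        exact hσ'.unchanged.nat a ha.1
      · simp only [prim, Program.writesReal, Bool.or_eq_false_iff] at ha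
        exact hσ'.unchanged.real a ha.1
      · simp only [prim, Program.writesNat, Bool.or_eq_false_iff] at ha
        exact hτ.nat a (by simp [Program.writesNat, ha])
      · simp only [prim, Program.writesReal, Bool.or_eq_false_iff] at ha
        exact hτ.real a (by simp [Program.writesReal, ha])
    have hfound : 1 ≤ τ.nat vFound 0 := hfound
    obtain ⟨-, ⟨huK, hjL⟩, hr, hle⟩ := hbest.resolve_left (by omega)
    set u := τ.nat vBu 0 with hu
    set j := τ.nat vBj 0 with hj
    have hlen := hP.length_add_card
    have hbτ := hb τ hbU ⟨_, hloc hP hL j (by rw [hL.count]; exact hjL), u,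
      Finset.mem_range.1 (hK.1 huK), hr⟩
    by_cases hlim : τ.real rBest 0 ≤ lim
    · -- insertion behind the nearest visited vertex
      set x := L[j] with hx
      have hxl := hL.get j x (List.getElem?_eq_getElem hjL)
      have hsplit : L = L.take j ++ x :: L.drop (j + 1) := by
        rw [hx, ← List.drop_eq_getElem_cons, List.take_append_drop]
      have hsplit' : L = (L.take j ++ [x]) ++ L.drop (j + 1) := by
        simpa using hsplit
      have hmin : ∀ p ∈ L, ∀ v ∈ K, X.d x.1 u ≤ X.d p.1 v := by
        intro p hp v hv
        obtain ⟨i, hi, rfl⟩ := List.getElem_of_mem hp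
        have := hle v i ⟨hv, hi⟩
        rwa [hr, hxl.1, (hL.get i _ (List.getElem?_eq_getElem hi)).1] at this
      have hP' : Prim X.d lim L₀ K₀ (L.take j ++ (x.1, x.2) :: (u, x.2) :: L.drop (j + 1))
          (K.erase u) (W + X.d x.1 u) :=
        .insert (hsplit ▸ hP) huK (by rw [← hxl.1, ← hr]; exact hlim)
          (by rw [← hsplit]; exact hmin)
      have hc : Exec s (.ite b
          (.seq (.setNat vIx (.lit 0) (.add (.var vBj) (.lit 1)))
            (.setNat vTg (.lit 0) (.cell aTag (.var vBj))))
          (.seq (.setNat vIx (.lit 0) (.var vCnt)) (.setNat vTg (.lit 0) (.var vCnt)))) τ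
          ((τ.setNat vIx 0 (j + 1)).setNat vTg 0 x.2) := by
        refine .ite_true (hbτ.2 hlim) ?_
        have := Exec.setNat (s := s) (σ := τ) (a := vIx) (i := .lit 0)
          (e := .add (.var vBj) (.lit 1))
        have h2 := this.seq (Exec.setNat (a := vTg) (i := .lit 0) (e := .cell aTag (.var vBj)))
        simpa [NExp.eval, ← hj, hxl.2] using h2
      obtain ⟨ρ, hρ, hLρ, hKρ⟩ := insertAt_spec (s := s) (n := X.n) (K := K) (u := u) (t := x.2)
        (σ := (τ.setNat vIx 0 (j + 1)).setNat vTg 0 x.2)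
        (A := L.take j ++ [x]) (B := L.drop (j + 1))
        (hsplit' ▸ hL.congr (by simp) (by simp) (by simp))
        ⟨hK.1, by simpa using hK.2⟩ (by simp; omega) (by simp) (by simp [hu])
        (by rw [← hsplit']; omega)
      have hBρ : Base X ρ := ((hB.setNat 0 (j + 1)).setNat 0 x.2).unchanged hρ.unchanged rfl
      obtain ⟨κ, hκ, hinv⟩ := hsearch hP' (by simpa using hLρ) hKρ hBρ
      exact ⟨(K.erase u).card, κ, Finset.card_erase_lt_of_mem huK, hc.seq (hρ.seq hκ), hinv⟩
    · have hP' : Prim X.d lim L₀ K₀ (L ++ [(u, L.length)]) (K.erase u) (W + lim) := by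
        refine .append hP huK fun p hp v hv => ?_
        obtain ⟨i, hi, rfl⟩ := List.getElem_of_mem hp
        have := hle v i ⟨hv, hi⟩
        rw [(hL.get i _ (List.getElem?_eq_getElem hi)).1] at this
        exact (not_le.1 hlim).trans_le this
      have hc : Exec s (.ite b
          (.seq (.setNat vIx (.lit 0) (.add (.var vBj) (.lit 1)))
            (.setNat vTg (.lit 0) (.cell aTag (.var vBj))))
          (.seq (.setNat vIx (.lit 0) (.var vCnt)) (.setNat vTg (.lit 0) (.var vCnt)))) τ
          ((τ.setNat vIx 0 L.length).setNat vTg 0 L.length) := by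
        refine .ite_false (fun h => hlim (hbτ.1 h)) ?_
        have := Exec.setNat (s := s) (σ := τ) (a := vIx) (i := .lit 0) (e := .var vCnt)
        have h2 := this.seq (Exec.setNat (a := vTg) (i := .lit 0) (e := .var vCnt))
        simpa [NExp.eval, hL.count] using h2
      obtain ⟨ρ, hρ, hLρ, hKρ⟩ := insertAt_spec (s := s) (n := X.n) (K := K) (u := u)
        (t := L.length) (σ := (τ.setNat vIx 0 L.length).setNat vTg 0 L.length)
        (A := L) (B := []) (by simpa using hL.congr (by simp) (by simp) (by simp))
        ⟨hK.1, by simpa using hK.2⟩ (by simp) (by simp) (by simp [hu]) (by simp; omega)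
      have hBρ : Base X ρ := ((hB.setNat 0 _).setNat 0 _).unchanged hρ.unchanged rfl
      obtain ⟨κ, hκ, hinv⟩ := hsearch hP' hLρ hKρ hBρ
      exact ⟨(K.erase u).card, κ, Finset.card_erase_lt_of_mem huK, hc.seq (hρ.seq hκ), hinv⟩)
  have hKe : K = ∅ := by
    rcases hbest with ⟨-, h⟩ | ⟨h, -⟩
    · refine Finset.eq_empty_of_forall_notMem fun u hu => h u 0 ⟨hu, ?_⟩
      have := hP.length_add_card
      obtain ⟨p, hp⟩ := List.exists_mem_of_ne_nil _ hL₀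
      exact List.length_pos_of_mem (hP.start_subset hp)
    · simp [Test.Holds, NExp.eval, h] at hnot
  subst hKe
  refine ⟨τ, L, W, hσ'.seq hτ, hP, hL', fun u hu => ?_⟩
  have := (hK'.2 u hu)
  simp at this
  exact this

/-! ### Cutting walks on the machine -/

notation "vC" => 23
notation "vNew" => 24
notation "vSg" => 25
notation "vPrev" => 26
notation "aSeg" => 27
notation "aPos" => 28
notation "aSt" => 29
notation "rLim" => 2
notation "rD" => 3
notation "rMax" => 4
notation "rAcc" => 5
notation "aCo" => 6

/-- Start a new segment. -/
def newSegment : Program :=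
  .seq (.setReal rAcc (.lit 0) (.sub (.var rAcc) (.var rAcc)))
    (.setNat vSg (.lit 0) (.add (.var vSg) (.lit 1)))

/-- Compute the segment and the coordinate of the next vertex of a walk. -/
def labelNext : Program :=
  .ite (.natLE (.lit 1) (.var vNew)) (.seq (.setNat vNew (.lit 0) (.lit 0)) newSegment)
    (.seq (.setReal rAcc (.lit 0)
        (.add (.var rAcc) (distExp (.var vPrev) (.cell aLoc (.var vJ)))))
      (.ite (.realLE (.var rAcc) (.var rMax)) .skip newSegment))

/-- Label the vertex number `vJ` with its segment, its coordinate and its position. -/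
def labelOne : Program :=
  .seq labelNext (.seq (.setNat aSeg (.var vJ) (.var vSg))
    (.seq (.setReal aCo (.var vJ) (.var rAcc)) (.seq (.setNat aPos (.cell aLoc (.var vJ)) (.var vJ))
      (.setNat vPrev (.lit 0) (.cell aLoc (.var vJ))))))

/-- Label the vertices with the tag `vC`. -/
def labelTag : Program :=
  .forLoop vJ (.var vCnt) (.ite (.natLE (.cell aTag (.var vJ)) (.var vC))
    (.ite (.natLE (.var vC) (.cell aTag (.var vJ))) labelOne .skip) .skip)

/-- Cut the walk through the vertices of each tag into segments of length at most `rMax`. The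
segments of the tag `c` get the numbers from `aSt c + 1` to `aSt (c + 1)`. -/
def label : Program :=
  .seq (.forLoop vC (.var vCnt) (.seq (.setNat vNew (.lit 0) (.lit 1))
    (.seq (.setNat aSt (.var vC) (.var vSg)) labelTag)))
    (.setNat aSt (.var vCnt) (.var vSg))

/-- The part `T` of a walk has been cut; `vNew` tells whether it is empty. -/
def CutState (X : Data) (ℓ : ℝ) (a₀ : ℕ) (T : List (ℕ × ℕ × ℝ)) (τ : Memory) : Prop :=
  (T = [] ∧ τ.nat vNew 0 = 1 ∧ τ.nat vSg 0 = a₀) ∨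
    (τ.nat vNew 0 = 0 ∧ Cut X.d ℓ a₀ T ∧ τ.nat vPrev 0 < X.n ∧
      ∃ T', T = (τ.nat vPrev 0, τ.nat vSg 0, τ.real rAcc 0) :: T')

theorem newSegment_exec {s : ℕ} {τ : Memory} :
    Exec s newSegment τ ((τ.setReal rAcc 0 0).setNat vSg 0 (τ.nat vSg 0 + 1)) := by
  have := (Exec.setReal (s := s) (σ := τ) (a := rAcc) (i := .lit 0)
    (e := .sub (.var rAcc) (.var rAcc))).seq
    (Exec.setNat (a := vSg) (i := .lit 0) (e := .add (.var vSg) (.lit 1)))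
  unfold newSegment
  simpa [NExp.eval, RExp.eval] using this

theorem labelNext_spec {X : Data} {s : ℕ} {ℓ : ℝ} {a₀ j : ℕ} {T : List (ℕ × ℕ × ℝ)} {τ : Memory}
    (hB : Base X τ) (hvj : τ.nat vJ 0 = j) (hj : τ.nat aLoc j < X.n) (hℓ : τ.real rMax 0 = ℓ)
    (hT : CutState X ℓ a₀ T τ) :
    ∃ ρ, Exec s labelNext τ ρ ∧ ρ.nat vNew 0 = 0 ∧
      Cut X.d ℓ a₀ ((τ.nat aLoc j, ρ.nat vSg 0, ρ.real rAcc 0) :: T) := by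
  rcases hT with ⟨rfl, hnew, hsg⟩ | ⟨hnew, hcut, hprev, T', rfl⟩
  · refine ⟨_, .ite_true ?_ (Exec.setNat.seq newSegment_exec), ?_, ?_⟩
    · simp [Test.Holds, NExp.eval, hnew]
    · simp [NExp.eval]
    · simpa [hsg] using Cut.start _
  · have hd : (distExp (.var vPrev) (.cell aLoc (.var vJ))).eval τ =
        X.d (τ.nat vPrev 0) (τ.nat aLoc j) :=
      hB.eval_distExp (by simp [NExp.eval]) (by simp [NExp.eval, hvj]) hprev hj
    have hf : ¬ Test.Holds τ (.natLE (.lit 1) (.var vNew)) := by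
      simp [Test.Holds, NExp.eval, hnew]
    by_cases hle : τ.real rAcc 0 + X.d (τ.nat vPrev 0) (τ.nat aLoc j) ≤ ℓ
    · refine ⟨_, .ite_false hf (Exec.setReal.seq (.ite_true ?_ .skip)), ?_, ?_⟩
      · simpa [Test.Holds, NExp.eval, RExp.eval, hd, hℓ] using hle
      · simpa [NExp.eval] using hnew
      · simpa [NExp.eval, RExp.eval, hd] using hcut.same hle
    · refine ⟨_, .ite_false hf (Exec.setReal.seq (.ite_false ?_ newSegment_exec)), ?_, ?_⟩
      · simpa [Test.Holds, NExp.eval, RExp.eval, hd, hℓ] using hle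
      · simpa [NExp.eval] using hnew
      · simpa [NExp.eval, RExp.eval, hd] using hcut.next (not_le.1 hle)

theorem labelOne_spec {X : Data} {s : ℕ} {ℓ : ℝ} {a₀ j : ℕ} {T : List (ℕ × ℕ × ℝ)} {τ : Memory}
    (hB : Base X τ) (hvj : τ.nat vJ 0 = j) (hj : τ.nat aLoc j < X.n) (hℓ : τ.real rMax 0 = ℓ)
    (hT : CutState X ℓ a₀ T τ) :
    ∃ ρ, Exec s labelOne τ ρ ∧
      CutState X ℓ a₀ ((τ.nat aLoc j, ρ.nat aSeg j, ρ.real aCo j) :: T) ρ ∧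
      (∀ i, i ≠ j → ρ.nat aSeg i = τ.nat aSeg i ∧ ρ.real aCo i = τ.real aCo i) ∧
      ρ.nat aPos = Function.update (τ.nat aPos) (τ.nat aLoc j) j := by
  obtain ⟨κ, hκ, hnew, hcut⟩ := labelNext_spec (s := s) hB hvj hj hℓ hT
  have hU := hκ.unchanged
  have h1 : κ.nat vJ 0 = j := by rw [hU.nat vJ rfl, hvj]
  have h2 : κ.nat aLoc = τ.nat aLoc := hU.nat aLoc rfl
  have h3 : κ.nat aSeg = τ.nat aSeg := hU.nat aSeg rfl
  have h4 : κ.nat aPos = τ.nat aPos := hU.nat aPos rfl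
  have h5 : κ.real aCo = τ.real aCo := hU.real aCo rfl
  refine ⟨_, hκ.seq (Exec.setNat.seq (Exec.setReal.seq (Exec.setNat.seq Exec.setNat))),
    .inr ⟨?_, ?_, ?_, T, ?_⟩, fun i hi => ?_, ?_⟩
  · simpa [NExp.eval] using hnew
  · simpa [NExp.eval, RExp.eval, h1, h2] using hcut
  · simpa [NExp.eval, h1, h2] using hj
  · simp [NExp.eval, RExp.eval, h1, h2]
  · simp [NExp.eval, RExp.eval, h1, h3, h5, hi]
  · simp [NExp.eval, h1, h2, h4]

/-- The labels of the vertices with the tag `c` among the first `k` ones, in reverse order. -/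
def labels (τ : Memory) (c k : ℕ) : List (ℕ × ℕ × ℝ) :=
  (((List.range k).filter fun j => τ.nat aTag j = c).map
    fun j => (τ.nat aLoc j, τ.nat aSeg j, τ.real aCo j)).reverse

theorem labels_congr {σ τ : Memory} {c k : ℕ} (h1 : τ.nat aTag = σ.nat aTag)
    (h2 : τ.nat aLoc = σ.nat aLoc)
    (h3 : ∀ j < k, τ.nat aTag j = c → τ.nat aSeg j = σ.nat aSeg j ∧ τ.real aCo j = σ.real aCo j) :
    labels τ c k = labels σ c k := by
  simp only [labels, h1, h2]
  congr 1
  refine List.map_congr_left fun j hj => ?_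
  simp only [List.mem_filter, List.mem_range, decide_eq_true_eq] at hj
  have := h3 j hj.1 (by rw [h1]; exact hj.2)
  rw [this.1, this.2]

theorem labels_succ (τ : Memory) (c k : ℕ) :
    labels τ c (k + 1) = if τ.nat aTag k = c then
      (τ.nat aLoc k, τ.nat aSeg k, τ.real aCo k) :: labels τ c k else labels τ c k := by
  by_cases h : τ.nat aTag k = c <;> simp [labels, List.range_succ, h]

theorem map_fst_labels {τ : Memory} {L : List (ℕ × ℕ)} (hL : HoldsList L τ) (c : ℕ) :
    ((labels τ c L.length).map Prod.fst).reverse = block L c := by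
  have hLr : L = (List.range L.length).map fun j => (τ.nat aLoc j, τ.nat aTag j) := by
    refine List.ext_getElem (by simp) fun j h1 h2 => ?_
    have := hL.get j _ (List.getElem?_eq_getElem h1)
    simp [this.1, this.2]
  conv_rhs => rw [hLr]
  simp [labels, block, List.filter_map, Function.comp_def]

/-- The position of `v` has been recorded correctly. -/
def PosOk (τ : Memory) (v : ℕ) : Prop :=
  τ.nat aPos v < τ.nat vCnt 0 ∧ τ.nat aLoc (τ.nat aPos v) = v

theorem labelTag_spec {X : Data} {s : ℕ} {ℓ : ℝ} {a₀ c : ℕ} {L : List (ℕ × ℕ)} {σ : Memory}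
    (hB : Base X σ) (hL : HoldsList L σ) (hLn : ∀ p ∈ L, p.1 < X.n) (hs : L.length ≤ s)
    (hℓ : σ.real rMax 0 = ℓ) (hc : σ.nat vC 0 = c) (hnew : σ.nat vNew 0 = 1)
    (hsg : σ.nat vSg 0 = a₀) :
    ∃ τ, Exec s labelTag σ τ ∧ CutState X ℓ a₀ (labels τ c L.length) τ ∧
      (∀ i, σ.nat aTag i ≠ c → τ.nat aSeg i = σ.nat aSeg i ∧ τ.real aCo i = σ.real aCo i) ∧
      (∀ v, PosOk σ v → PosOk τ v) ∧ ∀ v, (v, c) ∈ L → PosOk τ v := by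
  obtain ⟨τ, hτ, ⟨h1, h2, h3, h4⟩, -⟩ := Exec.forLoop (s := s) (σ := σ) (i := vJ) (N := .var vCnt)
    (P := .ite (.natLE (.cell aTag (.var vJ)) (.var vC))
      (.ite (.natLE (.var vC) (.cell aTag (.var vJ))) labelOne .skip) .skip) L.length hs
    (fun k τ => CutState X ℓ a₀ (labels τ c k) τ ∧
      (∀ i, σ.nat aTag i ≠ c → τ.nat aSeg i = σ.nat aSeg i ∧ τ.real aCo i = σ.real aCo i) ∧
      (∀ v, PosOk σ v → PosOk τ v) ∧ ∀ j < k, σ.nat aTag j = c → PosOk τ (σ.nat aLoc j)) rfl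
    ⟨.inl ⟨by simp [labels], by simpa using hnew, by simpa using hsg⟩, by simp,
      by simp [PosOk], by simp⟩
    (fun τ hτ => by simpa [NExp.eval, hτ.nat vCnt rfl] using hL.count)
    (by
      rintro k hk τ hτ hvj ⟨h1, h2, h3, h4⟩
      have htag : τ.nat aTag = σ.nat aTag := hτ.nat _ rfl
      have hloc : τ.nat aLoc = σ.nat aLoc := hτ.nat _ rfl
      have hcnt : τ.nat vCnt = σ.nat vCnt := hτ.nat _ rfl
      have hvc : τ.nat vC 0 = c := by rw [hτ.nat vC rfl, hc]
      by_cases hkc : σ.nat aTag k = c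
      · have hlk : τ.nat aLoc k < X.n := by
          rw [hloc]
          exact hLn _ (hL.get_lt hk)
        obtain ⟨ρ, hρ, g1, g2, g3⟩ := labelOne_spec (s := s) (hB.unchanged hτ rfl) hvj hlk
          (by rw [hτ.real rMax rfl, hℓ]) h1
        have hU := hρ.unchanged
        have htag' : ρ.nat aTag = τ.nat aTag := hU.nat _ rfl
        have hloc' : ρ.nat aLoc = τ.nat aLoc := hU.nat _ rfl
        have hcnt' : ρ.nat vCnt = τ.nat vCnt := hU.nat _ rfl
        have hpos : ∀ v, (PosOk τ v ∨ v = σ.nat aLoc k) → PosOk ρ v := by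
          intro v hv
          simp only [PosOk, hloc', hloc, hcnt', hcnt, g3] at hv ⊢
          by_cases hvk : v = σ.nat aLoc k
          · subst hvk
            rw [Function.update_self]
            exact ⟨by rw [hL.count]; exact hk, rfl⟩
          · rw [Function.update_of_ne hvk]
            exact hv.resolve_right hvk
        refine ⟨ρ, .ite_true ?_ (.ite_true ?_ hρ), ?_, fun i hi => ?_, fun v hv => ?_,
          fun j hj hjc => ?_⟩
        · simp [Test.Holds, NExp.eval, hvj, htag, hvc, hkc]
        · simp [Test.Holds, NExp.eval, hvj, htag, hvc, hkc]
        · have : labels (ρ.setNat vJ 0 (k + 1)) c (k + 1) =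
              (τ.nat aLoc k, ρ.nat aSeg k, ρ.real aCo k) :: labels τ c k := by
            rw [labels_succ, if_pos (by simpa [htag', htag] using hkc)]
            congr 1
            · simp [hloc']
            · refine labels_congr (by simp [htag']) (by simp [hloc']) fun j hj _ => ?_
              simpa using g2 j hj.ne
          rw [this]
          simpa [CutState] using g1
        · have := g2 i (fun h => hi (h ▸ hkc))
          simp [this.1, this.2, h2 i hi]
        · simpa [PosOk] using hpos v (.inl (h3 v hv))
        · have : PosOk ρ (σ.nat aLoc j) := by
            rcases (show j < k ∨ j = k by omega) with hj | rfl
            · exact hpos _ (.inl (h4 j hj hjc))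
            · exact hpos _ (.inr rfl)
          simpa [PosOk] using this
      · refine ⟨τ, ?_, ?_, by simpa using h2, by simpa [PosOk] using h3, fun j hj hjc => ?_⟩
        · rcases lt_or_gt_of_ne hkc with h | h
          · refine .ite_true ?_ (.ite_false ?_ .skip)
            · simp [Test.Holds, NExp.eval, hvj, htag, hvc, h.le]
            · simpa [Test.Holds, NExp.eval, hvj, htag, hvc] using h
          · refine .ite_false ?_ .skip
            simpa [Test.Holds, NExp.eval, hvj, htag, hvc] using h
        · have : labels (τ.setNat vJ 0 (k + 1)) c (k + 1) = labels τ c k := by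
            rw [labels_succ, if_neg (by simpa [htag] using hkc)]
            exact labels_congr (by simp) (by simp) (by simp)
          rw [this]
          simpa [CutState] using h1
        · have : j < k := by
            rcases (show j < k ∨ j = k by omega) with hj | rfl
            · exact hj
            · exact absurd hjc hkc
          simpa [PosOk] using h4 j this hjc)
  refine ⟨τ, hτ, h1, h2, h3, fun v hv => ?_⟩
  obtain ⟨j, hj, hjv⟩ := List.getElem_of_mem hv
  have := hL.get j _ (List.getElem?_eq_getElem hj)
  rw [hjv] at this
  have h := h4 j hj this.2
  rwa [this.1] at h

/-- The labels of the vertices with the tag `c` are a cut with the appropriate numbers of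
segments. -/
def CutTag (X : Data) (ℓ : ℝ) (k c : ℕ) (τ : Memory) : Prop :=
  (labels τ c k = [] ∧ τ.nat aSt (c + 1) = τ.nat aSt c) ∨
    (Cut X.d ℓ (τ.nat aSt c) (labels τ c k) ∧
      ((labels τ c k).headD (0, 0, 0)).2.1 = τ.nat aSt (c + 1))

theorem label_spec {X : Data} {s : ℕ} {ℓ : ℝ} {L : List (ℕ × ℕ)} {σ : Memory}
    (hB : Base X σ) (hL : HoldsList L σ) (hLn : ∀ p ∈ L, p.1 < X.n)
    (hLt : ∀ p ∈ L, p.2 < L.length) (hs : L.length ≤ s) (hℓ : σ.real rMax 0 = ℓ) :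
    ∃ τ, Exec s label σ τ ∧ (∀ v ∈ L.map Prod.fst, PosOk τ v) ∧
      (0 < L.length → τ.nat aSt 0 = σ.nat vSg 0) ∧ τ.nat aSt L.length = τ.nat vSg 0 ∧
      ∀ c < L.length, CutTag X ℓ L.length c τ := by
  -- the state before the tag `c`, with the counter already stored as the start of this tag
  let inv : ℕ → Memory → Prop := fun c τ =>
    (0 < c → τ.nat aSt 0 = σ.nat vSg 0) ∧ (c = 0 → τ.nat vSg 0 = σ.nat vSg 0) ∧
    (∀ p ∈ L, p.2 < c → PosOk τ p.1) ∧
    ∀ c' < c, CutTag X ℓ L.length c' (τ.setNat aSt c (τ.nat vSg 0))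
  have hinv : ∀ c τ i v, inv c τ → inv c (τ.setNat vC i v) := by
    intro c τ i v ⟨g1, g2, g3, g4⟩
    refine ⟨by simpa using g1, by simpa using g2, by simpa [PosOk] using g3, ?_⟩
    intro c' hc'
    have := g4 c' hc'
    have hl : ∀ k, labels ((τ.setNat vC i v).setNat aSt c ((τ.setNat vC i v).nat vSg 0)) c' k =
        labels (τ.setNat aSt c (τ.nat vSg 0)) c' k := fun k =>
      labels_congr (by simp) (by simp) (by simp)
    simp only [CutTag, hl] at this ⊢
    simpa using this
  obtain ⟨τ, hτ, ⟨h1, h2, h3, h4⟩, hU⟩ := Exec.forLoop (s := s) (σ := σ) (i := vC) (N := .var vCnt)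
    (P := .seq (.setNat vNew (.lit 0) (.lit 1))
      (.seq (.setNat aSt (.var vC) (.var vSg)) labelTag)) L.length hs
    inv rfl (hinv 0 σ _ _ ⟨by simp, by simp, by simp, by simp⟩)
    (fun τ hτ => by simpa [NExp.eval, hτ.nat vCnt rfl] using hL.count)
    (by
      rintro c hc τ hτ hvc ⟨h1, h2, h3, h4⟩
      set σ' := (τ.setNat vNew 0 1).setNat aSt c (τ.nat vSg 0) with hσ'
      have hτL : HoldsList L τ := hL.congr (hτ.nat _ rfl) (hτ.nat _ rfl) (hτ.nat _ rfl)
      obtain ⟨ρ, hρ, g1, g2, g3, g4⟩ := labelTag_spec (s := s) (σ := σ') (c := c) (ℓ := ℓ)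
        (a₀ := τ.nat vSg 0) (((hB.unchanged hτ rfl).setNat 0 1).setNat c _)
        (hτL.congr (by simp [hσ']) (by simp [hσ']) (by simp [hσ'])) hLn hs
        (by simp [hσ', hτ.real rMax rfl, hℓ]) (by simpa [hσ'] using hvc) (by simp [hσ'])
        (by simp [hσ'])
      have hU := hρ.unchanged
      have hSt : ρ.nat aSt = Function.update (τ.nat aSt) c (τ.nat vSg 0) := by
        rw [hU.nat aSt rfl]; simp [hσ']
      have htag : ρ.nat aTag = τ.nat aTag := by rw [hU.nat aTag rfl]; simp [hσ']
      have hloc : ρ.nat aLoc = τ.nat aLoc := by rw [hU.nat aLoc rfl]; simp [hσ']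
      refine ⟨ρ, Exec.setNat.seq (Exec.setNat.seq ?_), hinv _ _ _ _
        ⟨fun _ => ?_, by simp, fun p hp hpc => ?_, fun c' hc' => ?_⟩⟩
      · simpa [NExp.eval, hvc, hσ'] using hρ
      · rw [hSt]
        by_cases hc0 : c = 0
        · subst hc0
          simpa using h2 rfl
        · rw [Function.update_of_ne (Ne.symm hc0)]
          exact h1 (by omega)
      · rcases (show p.2 < c ∨ p.2 = c by omega) with h | h
        · exact g3 _ (by simpa [PosOk, hσ'] using h3 p hp h)
        · exact g4 _ (h ▸ hp)
      · have hl : ∀ k, labels (ρ.setNat aSt (c + 1) (ρ.nat vSg 0)) c' k = labels ρ c' k := fun k =>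
          labels_congr (by simp) (by simp) (by simp)
        rcases (show c' < c ∨ c' = c by omega) with h | rfl
        · have := h4 c' h
          have hl' : labels (τ.setNat aSt c (τ.nat vSg 0)) c' L.length = labels ρ c' L.length := by
            refine labels_congr (by simp [htag]) (by simp [hloc]) fun j hj hjc => ?_
            have hjc : τ.nat aTag j = c' := by simpa using hjc
            have := g2 j (by simp [hσ']; omega)
            simp [this.1, this.2, hσ']
          simp only [CutTag, hl, hl', Memory.setNat_nat_self, hSt] at this ⊢
          rw [Function.update_of_ne (a := c') (a' := c + 1) (by omega)]
          by_cases hcc : c' + 1 = c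
          · rw [hcc, Function.update_of_ne (a := c) (a' := c + 1) (by omega)]
            rwa [hcc] at this
          · rwa [Function.update_of_ne (a := c' + 1) (a' := c + 1) (by omega)]
        · simp only [CutTag, hl, Memory.setNat_nat_self, hSt, Function.update_self]
          rw [Function.update_of_ne (a := c') (a' := c' + 1) (by omega), Function.update_self]
          rcases g1 with ⟨g1, -, g5⟩ | ⟨-, g5, -, T', g6⟩
          · exact .inl ⟨g1, g5⟩
          · exact .inr ⟨g5, by rw [g6]; simp⟩)
  have hset := Exec.setNat (s := s) (σ := τ) (a := aSt) (i := .var vCnt) (e := .var vSg)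
  have hcnt : τ.nat vCnt 0 = L.length := by rw [hU.nat vCnt rfl, hL.count]
  simp only [NExp.eval, hcnt] at hset
  refine ⟨_, hτ.seq hset, fun v hv => ?_, fun h0 => ?_, by simp, h4⟩
  · obtain ⟨p, hp, rfl⟩ := List.mem_map.1 hv
    simpa [PosOk] using h3 p hp (hLt p hp)
  · simp only [Memory.setNat_nat_self]
    rw [Function.update_of_ne (by omega)]
    exact h1 h0

/-! ### Segments of requests -/

/-- The ends `f q` of the requests in `Q` lie on segments: `(κ q).1` is the number of the segment,
`(κ q).2.1` the position and `(κ q).2.2` the coordinate of `f q`, and `len a` is the length of the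
segment `a`. -/
structure KeySide (d : ℕ → ℕ → ℝ) (f : ℕ → ℕ) (Q : Set ℕ) (Z₀ Z₁ : ℕ) (κ : ℕ → ℕ × ℕ × ℝ)
    (len : ℕ → ℝ) : Prop where
  seg_mem : ∀ q ∈ Q, Z₀ < (κ q).1 ∧ (κ q).1 ≤ Z₁
  co_mem : ∀ q ∈ Q, 0 ≤ (κ q).2.2 ∧ (κ q).2.2 ≤ len (κ q).1
  dist_le : ∀ q ∈ Q, ∀ q' ∈ Q, (κ q).1 = (κ q').1 → (κ q).2.1 ≤ (κ q').2.1 →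
    d (f q) (f q') ≤ (κ q').2.2 - (κ q).2.2

/-- The sources and the targets of the requests in `Q` lie on segments of length at most `r` times
their scale `sc`, where a request has about the length of the scale of its two segments, and these
are among the at most `M` segments that come right after the segment `cp`. -/
structure Keys (X : Data) (r M : ℕ) (Q : Set ℕ) (Z₀ Z₁ : ℕ) (κ κ' : ℕ → ℕ × ℕ × ℝ)
    (len sc : ℕ → ℝ) (cp : ℕ → ℕ) : Prop where
  src : KeySide X.d X.src Q Z₀ Z₁ κ len
  tgt : KeySide X.d X.tgt Q Z₀ Z₁ κ' len
  len_nonneg : ∀ a, 0 ≤ len a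
  sc_nonneg : ∀ a, 0 ≤ sc a
  len_le : ∀ a, len a ≤ r * sc a
  sc_eq : ∀ q ∈ Q, sc (κ' q).1 = sc (κ q).1
  sc_le : ∀ q ∈ Q, sc (κ q).1 ≤ X.len q
  le_sc : ∀ q ∈ Q, X.len q ≤ 2 * sc (κ q).1
  cp_eq : ∀ q ∈ Q, cp (κ' q).1 = cp (κ q).1
  cp_src : ∀ q ∈ Q, cp (κ q).1 < (κ q).1 ∧ (κ q).1 ≤ cp (κ q).1 + M
  cp_tgt : ∀ q ∈ Q, cp (κ' q).1 < (κ' q).1 ∧ (κ' q).1 ≤ cp (κ' q).1 + M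

theorem KeySide.union {d : ℕ → ℕ → ℝ} {f : ℕ → ℕ} {Q C : Set ℕ} {Z₀ Z₁ Z₂ : ℕ}
    {κ : ℕ → ℕ × ℕ × ℝ} {len len' : ℕ → ℝ} (h : KeySide d f Q Z₀ Z₁ κ len)
    (h' : KeySide d f C Z₁ Z₂ κ len') (h0 : Z₀ ≤ Z₁) (h1 : Z₁ ≤ Z₂) :
    KeySide d f (Q ∪ C) Z₀ Z₂ κ fun a => if a ≤ Z₁ then len a else len' a where
  seg_mem q hq := by
    rcases hq with hq | hq
    · have := h.seg_mem q hq; omega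
    · have := h'.seg_mem q hq; omega
  co_mem q hq := by
    rcases hq with hq | hq
    · rw [if_pos (h.seg_mem q hq).2]; exact h.co_mem q hq
    · rw [if_neg (by have := (h'.seg_mem q hq).1; omega)]; exact h'.co_mem q hq
  dist_le q hq q' hq' hk hp := by
    rcases hq with hq | hq <;> rcases hq' with hq' | hq'
    · exact h.dist_le q hq q' hq' hk hp
    · have := h.seg_mem q hq; have := h'.seg_mem q' hq'; omega
    · have := h'.seg_mem q hq; have := h.seg_mem q' hq'; omega
    · exact h'.dist_le q hq q' hq' hk hp

/-- The segments of a new scale are numbered after those of the earlier scales. -/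
theorem Keys.union {X : Data} {r M : ℕ} {Q C : Set ℕ} {Z₀ Z₁ Z₂ : ℕ} {κ κ' : ℕ → ℕ × ℕ × ℝ}
    {len sc len' sc' : ℕ → ℝ} {cp cp' : ℕ → ℕ} (h : Keys X r M Q Z₀ Z₁ κ κ' len sc cp)
    (h' : Keys X r M C Z₁ Z₂ κ κ' len' sc' cp') (h0 : Z₀ ≤ Z₁) (h1 : Z₁ ≤ Z₂) :
    Keys X r M (Q ∪ C) Z₀ Z₂ κ κ' (fun a => if a ≤ Z₁ then len a else len' a)
      (fun a => if a ≤ Z₁ then sc a else sc' a) (fun a => if a ≤ Z₁ then cp a else cp' a) := by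
  have hQ : ∀ q ∈ Q, (κ q).1 ≤ Z₁ ∧ (κ' q).1 ≤ Z₁ := fun q hq =>
    ⟨(h.src.seg_mem q hq).2, (h.tgt.seg_mem q hq).2⟩
  have hC : ∀ q ∈ C, ¬ (κ q).1 ≤ Z₁ ∧ ¬ (κ' q).1 ≤ Z₁ := fun q hq =>
    ⟨not_le.2 (h'.src.seg_mem q hq).1, not_le.2 (h'.tgt.seg_mem q hq).1⟩
  refine ⟨h.src.union h'.src h0 h1, h.tgt.union h'.tgt h0 h1, fun a => ?_, fun a => ?_,
    fun a => ?_, fun q hq => ?_, fun q hq => ?_, fun q hq => ?_, fun q hq => ?_, fun q hq => ?_,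
    fun q hq => ?_⟩
  · by_cases ha : a ≤ Z₁ <;> simp [ha, h.len_nonneg, h'.len_nonneg]
  · by_cases ha : a ≤ Z₁ <;> simp [ha, h.sc_nonneg, h'.sc_nonneg]
  · by_cases ha : a ≤ Z₁ <;> simp [ha, h.len_le, h'.len_le]
  all_goals rcases hq with hq | hq
  · simpa [hQ q hq] using h.sc_eq q hq
  · simpa [hC q hq] using h'.sc_eq q hq
  · simpa [hQ q hq] using h.sc_le q hq
  · simpa [hC q hq] using h'.sc_le q hq
  · simpa [hQ q hq] using h.le_sc q hq
  · simpa [hC q hq] using h'.le_sc q hq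
  · simpa [hQ q hq] using h.cp_eq q hq
  · simpa [hC q hq] using h'.cp_eq q hq
  · simpa [hQ q hq] using h.cp_src q hq
  · simpa [hC q hq] using h'.cp_src q hq
  · simpa [hQ q hq] using h.cp_tgt q hq
  · simpa [hC q hq] using h'.cp_tgt q hq

theorem Keys.congr {X : Data} {r M : ℕ} {Q : Set ℕ} {Z₀ Z₁ : ℕ} {κ κ' η η' : ℕ → ℕ × ℕ × ℝ}
    {len sc : ℕ → ℝ} {cp : ℕ → ℕ} (h : Keys X r M Q Z₀ Z₁ κ κ' len sc cp)
    (hη : ∀ q ∈ Q, η q = κ q) (hη' : ∀ q ∈ Q, η' q = κ' q) :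
    Keys X r M Q Z₀ Z₁ η η' len sc cp := by
  have side : ∀ {f : ℕ → ℕ} {κ η : ℕ → ℕ × ℕ × ℝ}, KeySide X.d f Q Z₀ Z₁ κ len →
      (∀ q ∈ Q, η q = κ q) → KeySide X.d f Q Z₀ Z₁ η len := fun h hη =>
    ⟨fun q hq => by rw [hη q hq]; exact h.seg_mem q hq,
      fun q hq => by rw [hη q hq]; exact h.co_mem q hq,
      fun q hq q' hq' => by rw [hη q hq, hη q' hq']; exact h.dist_le q hq q' hq'⟩
  refine ⟨side h.src hη, side h.tgt hη', h.len_nonneg, h.sc_nonneg, h.len_le, fun q hq => ?_,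
    fun q hq => ?_, fun q hq => ?_, fun q hq => ?_, fun q hq => ?_, fun q hq => ?_⟩
  all_goals simp only [hη q hq, hη' q hq]
  · exact h.sc_eq q hq
  · exact h.sc_le q hq
  · exact h.le_sc q hq
  · exact h.cp_eq q hq
  · exact h.cp_src q hq
  · exact h.cp_tgt q hq

theorem sum_Ioc_blocks {N : ℕ} {st : ℕ → ℕ} (hst : ∀ c < N, st c ≤ st (c + 1)) (f : ℕ → ℝ) :
    st 0 ≤ st N ∧ ∑ a ∈ Finset.Ioc (st 0) (st N), f a =
      ∑ c ∈ Finset.range N, ∑ a ∈ Finset.Ioc (st c) (st (c + 1)), f a := by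
  induction N with
  | zero => simp
  | succ N ih =>
    obtain ⟨h1, h2⟩ := ih fun c hc => hst c (by omega)
    have h3 := hst N (by omega)
    refine ⟨h1.trans h3, ?_⟩
    rw [Finset.sum_range_succ, ← h2, Finset.sum_Ioc_consecutive _ h1 h3]

/-- The segments obtained from one run of Prim's algorithm, for requests with lengths between `D`
and `2 * D`. -/
theorem keys_of_cut {X : Data} {r : ℕ} {D Wp : ℝ} {v₀ : ℕ} {K₀ : Finset ℕ} {L : List (ℕ × ℕ)}
    {τ : Memory} {C : Set ℕ} {Z Z' : ℕ} (hr : 1 ≤ r) (hD : 0 ≤ D)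
    (hP : Prim X.d (2 * D) [(v₀, 0)] K₀ L ∅ Wp) (hK₀ : K₀ ⊆ Finset.range X.n) (hL : HoldsList L τ)
    (hpos : ∀ v ∈ L.map Prod.fst, PosOk τ v) (hZ : τ.nat aSt 0 = Z) (hZ' : τ.nat aSt L.length = Z')
    (hcut : ∀ c < L.length, CutTag X (r * D) L.length c τ)
    (hC : ∀ q ∈ C, X.src q ∈ L.map Prod.fst ∧ X.tgt q ∈ L.map Prod.fst ∧ D ≤ X.len q ∧
      X.len q ≤ 2 * D) :
    Z ≤ Z' ∧ ∃ len sc cp, Keys X r (1 + 4 * X.n / r) C Z Z'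
      (fun q => (τ.nat aSeg (τ.nat aPos (X.src q)), τ.nat aPos (X.src q),
        τ.real aCo (τ.nat aPos (X.src q))))
      (fun q => (τ.nat aSeg (τ.nat aPos (X.tgt q)), τ.nat aPos (X.tgt q),
        τ.real aCo (τ.nat aPos (X.tgt q)))) len sc cp ∧
      ∑ a ∈ Finset.Ioc Z Z', (len a + sc a) ≤ 5 * (Wp + D) := by
  have hd := X.metric
  have hlim : (0 : ℝ) ≤ 2 * D := by linarith
  have hr' : (1 : ℝ) ≤ r := by exact_mod_cast hr
  have hℓ : 0 ≤ r * D := by positivity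
  have hDℓ : D ≤ r * D := by nlinarith
  set N := L.length with hN
  obtain ⟨st, hst_def⟩ : ∃ st, st = τ.nat aSt := ⟨_, rfl⟩
  simp only [CutTag, ← hst_def] at hcut
  rw [← hst_def] at hZ hZ'
  have htag : ∀ p ∈ L, p.2 < N := hP.tag_lt (by simp)
  have hWp := hP.weight_nonneg hd hlim
  have hWn : Wp ≤ X.n * (2 * D) := by
    have h1 := hP.sum_le
    have h2 : (K₀.card : ℝ) ≤ X.n := by
      have := Finset.card_le_card hK₀
      rw [Finset.card_range] at this
      exact_mod_cast this
    have : (K₀.card : ℝ) * (2 * D) ≤ X.n * (2 * D) := by gcongr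
    simp at h1
    linarith
  -- the total length of the walks that are cut
  have hblocks : ∑ c ∈ Finset.range N, pathLen X.d (block L c) ≤ 2 * Wp := by
    refine (hP.sum_pathLen_block_le hd hlim (by simp) N).trans ?_
    have : ∀ c, pathLen X.d (block [(v₀, 0)] c) = 0 := fun c => by
      by_cases h : 0 = c <;> simp [block, h, pathLen]
    simp [this]
  have hblock : ∀ c < N, pathLen X.d (block L c) ≤ 2 * Wp := fun c hc =>
    (Finset.single_le_sum (f := fun c => pathLen X.d (block L c))
      (fun c _ => pathLen_nonneg hd _) (Finset.mem_range.2 hc)).trans hblocks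
  have hst : ∀ c < N, st c ≤ st (c + 1) := by
    intro c hc
    rcases hcut c hc with ⟨-, h⟩ | ⟨h1, h2⟩
    · exact h.ge
    · have := ((h1.bounds hd hℓ).1 _ h1.headD_mem).1
      omega
  have hstle : ∀ c c', c < c' → c' ≤ N → st (c + 1) ≤ st c' := by
    intro c c' hcc
    induction c', hcc using Nat.le_induction with
    | base => intro _; exact le_rfl
    | succ k hk ih => intro hk'; exact (ih (by omega)).trans (hst k (by omega))
  have huniq : ∀ c < N, ∀ c' < N, ∀ a, st c < a → a ≤ st (c + 1) → st c' < a → a ≤ st (c' + 1) →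
      c = c' := by
    intro c hc c' hc' a h1 h2 h3 h4
    rcases lt_trichotomy c c' with h | h | h
    · have := hstle c c' h hc'.le; omega
    · exact h
    · have := hstle c' c h hc.le; omega
  have hlens : ∀ c, ∃ len : ℕ → ℝ, (∀ b, 0 ≤ len b ∧ len b ≤ r * D) ∧ (c < N →
      (∀ p ∈ labels τ c N, p.2.2 ≤ len p.2.1) ∧
      ∑ b ∈ Finset.Ioc (st c) (st (c + 1)), len b ≤ pathLen X.d (block L c)) := by
    intro c
    by_cases hc : c < N
    · rcases hcut c hc with ⟨h0, h⟩ | ⟨h1, h2⟩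
      · refine ⟨fun _ => 0, by simp [hℓ], fun _ => ⟨by simp [h0], ?_⟩⟩
        simpa using pathLen_nonneg hd _
      · obtain ⟨len, g1, g2, g3⟩ := h1.lens hd hℓ
        refine ⟨len, g1, fun _ => ⟨g2, ?_⟩⟩
        rwa [h2, map_fst_labels hL] at g3
    · exact ⟨fun _ => 0, by simp [hℓ], fun h => absurd h hc⟩
  choose lens hlens1 hlens2 using hlens
  have hex : ∀ a, ∃ c, ∀ c' < N, st c' < a → a ≤ st (c' + 1) → c = c' := by
    intro a
    by_cases h : ∃ c < N, st c < a ∧ a ≤ st (c + 1)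
    · obtain ⟨c, hc, h1, h2⟩ := h
      exact ⟨c, fun c' hc' h3 h4 => huniq c hc c' hc' a h1 h2 h3 h4⟩
    · exact ⟨0, fun c' hc' h3 h4 => absurd ⟨c', hc', h3, h4⟩ h⟩
  choose tagOf htagOf using hex
  have hmem : ∀ j < N, (τ.nat aLoc j, τ.nat aSeg j, τ.real aCo j) ∈ labels τ (τ.nat aTag j) N := by
    intro j hj
    simp only [labels, List.mem_reverse, List.mem_map, List.mem_filter, List.mem_range,
      decide_eq_true_eq]
    exact ⟨j, ⟨hj, rfl⟩, rfl⟩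
  have hcutj : ∀ j < N, τ.nat aTag j < N ∧ Cut X.d (r * D) (st (τ.nat aTag j))
      (labels τ (τ.nat aTag j) N) ∧
      ((labels τ (τ.nat aTag j) N).headD (0, 0, 0)).2.1 = st (τ.nat aTag j + 1) := by
    intro j hj
    have ht := htag _ (hL.get_lt hj)
    refine ⟨ht, (hcut _ ht).resolve_left fun h => ?_⟩
    have := hmem j hj
    rw [h.1] at this
    simp at this
  have hidx : ∀ j < N, st (τ.nat aTag j) < τ.nat aSeg j ∧ τ.nat aSeg j ≤ st (τ.nat aTag j + 1) ∧
      0 ≤ τ.real aCo j ∧ τ.real aCo j ≤ lens (τ.nat aTag j) (τ.nat aSeg j) := by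
    intro j hj
    obtain ⟨ht, h1, h2⟩ := hcutj j hj
    have hb := h1.bounds hd hℓ
    have := hb.1 _ (hmem j hj)
    exact ⟨this.1, h2 ▸ hb.2 _ (hmem j hj), this.2.1, (hlens2 _ ht).1 _ (hmem j hj)⟩
  have htagj : ∀ j < N, tagOf (τ.nat aSeg j) = τ.nat aTag j := fun j hj =>
    htagOf _ _ (hcutj j hj).1 (hidx j hj).1 (hidx j hj).2.1
  have hdist : ∀ i < N, ∀ j < N, τ.nat aSeg i = τ.nat aSeg j → i ≤ j →
      X.d (τ.nat aLoc i) (τ.nat aLoc j) ≤ τ.real aCo j - τ.real aCo i := by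
    intro i hi j hj hij hle
    rcases hle.eq_or_lt with rfl | hlt
    · simp [hd.self]
    have htt : τ.nat aTag i = τ.nat aTag j := by rw [← htagj i hi, ← htagj j hj, hij]
    have hpw := (hcutj j hj).2.1.dist_le hd
    simp only [labels, List.pairwise_reverse, List.pairwise_map] at hpw
    have hsorted : ((List.range N).filter fun k => τ.nat aTag k = τ.nat aTag j).Pairwise (· < ·) :=
      List.Pairwise.filter _ List.pairwise_lt_range
    have hi' : i ∈ (List.range N).filter fun k => τ.nat aTag k = τ.nat aTag j := by simp [hi, htt]
    have hj' : j ∈ (List.range N).filter fun k => τ.nat aTag k = τ.nat aTag j := by simp [hj]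
    obtain ⟨a, ha, rfl⟩ := List.getElem_of_mem hi'
    obtain ⟨b, hb, hbj⟩ := List.getElem_of_mem hj'
    rw [List.pairwise_iff_getElem] at hpw hsorted
    have hab : a < b := by
      by_contra hab
      rcases (not_lt.1 hab).eq_or_lt with rfl | h
      · omega
      · have := hsorted b a hb ha h
        omega
    have := hpw a b ha hb hab
    rw [hbj] at this
    exact this hij.symm
  have hpos' : ∀ v ∈ L.map Prod.fst, τ.nat aPos v < N ∧ τ.nat aLoc (τ.nat aPos v) = v :=
    fun v hv => by
      have := hpos v hv
      exact ⟨by rw [hN, ← hL.count]; exact this.1, this.2⟩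
  have hM : ∀ c < N, st (c + 1) ≤ st c + (1 + 4 * X.n / r) := by
    intro c hc
    obtain ⟨z, hz⟩ : ∃ z, 4 * X.n / r = z := ⟨_, rfl⟩
    rw [hz]
    rcases hcut c hc with ⟨-, h⟩ | ⟨h1, h2⟩
    · omega
    · have h3 := h1.count_le hd hℓ
      rw [h2, map_fst_labels hL] at h3
      rcases h3 with h3 | h3
      · omega
      · have h4 : ((st (c + 1) : ℝ) - st c - 1) * (r * D) < 4 * X.n * D := by
          have := hblock c hc
          linarith
        have hDpos : 0 < D := by
          rcases hD.eq_or_lt with h | h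
          · rw [← h] at h4; simp at h4
          · exact h
        have h5 : ((st (c + 1) : ℝ) - st c - 1) * r < 4 * X.n := by
          by_contra hcon
          push Not at hcon
          have := mul_le_mul_of_nonneg_right hcon hD
          linarith
        by_contra hcon
        push Not at hcon
        obtain ⟨e, he⟩ : ∃ e, st (c + 1) = st c + 1 + e := ⟨st (c + 1) - st c - 1, by omega⟩
        rw [he] at h5
        push_cast at h5
        have h6 : e * r < 4 * X.n := by
          have : (e : ℝ) * r < 4 * X.n := by linarith
          exact_mod_cast this
        have h7 : e ≤ z := by
          rw [← hz, Nat.le_div_iff_mul_le (by omega)]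
          exact h6.le
        omega
  have hpair : ∀ q ∈ C, τ.nat aTag (τ.nat aPos (X.tgt q)) = τ.nat aTag (τ.nat aPos (X.src q)) := by
    intro q hq
    obtain ⟨h1, h2, -, h4⟩ := hC q hq
    by_contra hne
    have := hP.lt_dist hd _ (hL.get_lt (hpos' _ h1).1) _ (hL.get_lt (hpos' _ h2).1) (Ne.symm hne)
    simp only [(hpos' _ h1).2, (hpos' _ h2).2] at this
    exact absurd h4 (not_le.2 this)
  have hsum := sum_Ioc_blocks hst
  have hZst : Z ≤ Z' := by
    have := (hsum 0).1
    rwa [hZ, hZ'] at this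
  -- the segments of the ends of the requests
  have hside : ∀ f : ℕ → ℕ, (∀ q ∈ C, f q ∈ L.map Prod.fst) → KeySide X.d f C Z Z'
      (fun q => (τ.nat aSeg (τ.nat aPos (f q)), τ.nat aPos (f q), τ.real aCo (τ.nat aPos (f q))))
      (fun a => lens (tagOf a) a) := by
    intro f hf
    refine ⟨fun q hq => ?_, fun q hq => ?_, fun q hq q' hq' hk hp => ?_⟩
    · have hp := hpos' _ (hf q hq)
      have h1 := hidx _ hp.1
      have h2 := (hcutj _ hp.1).1
      have h3 := hstle _ N h2 le_rfl
      have h4 : st 0 ≤ st (τ.nat aTag (τ.nat aPos (f q))) :=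
        (sum_Ioc_blocks (N := τ.nat aTag (τ.nat aPos (f q)))
          (fun c hc => hst c (by omega)) (fun _ => 0)).1
      simp only
      omega
    · have hp := hpos' _ (hf q hq)
      have h1 := hidx _ hp.1
      simp only [htagj _ hp.1]
      exact h1.2.2
    · have hpq := hpos' _ (hf q hq)
      have hpq' := hpos' _ (hf q' hq')
      have := hdist _ hpq.1 _ hpq'.1 hk hp
      rwa [hpq.2, hpq'.2] at this
  refine ⟨hZst, fun a => lens (tagOf a) a, fun _ => D, fun a => st (tagOf a),
    ⟨hside _ fun q hq => (hC q hq).1, hside _ fun q hq => (hC q hq).2.1, fun a => (hlens1 _ _).1,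
      fun _ => hD, fun a => (hlens1 _ _).2, fun _ _ => rfl, fun q hq => (hC q hq).2.2.1,
      fun q hq => (hC q hq).2.2.2, fun q hq => ?_, fun q hq => ?_, fun q hq => ?_⟩, ?_⟩
  · have h1 := hpos' _ (hC q hq).1
    have h2 := hpos' _ (hC q hq).2.1
    simp only [htagj _ h1.1, htagj _ h2.1, hpair q hq]
  · have h1 := hpos' _ (hC q hq).1
    have h2 := hidx _ h1.1
    have h3 := hM _ (hcutj _ h1.1).1
    simp only [htagj _ h1.1]
    omega
  · have h1 := hpos' _ (hC q hq).2.1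
    have h2 := hidx _ h1.1
    have h3 := hM _ (hcutj _ h1.1).1
    simp only [htagj _ h1.1]
    omega
  · -- each segment but the last one of a walk is charged to the length of the walk
    have hone : ∀ c ∈ Finset.range N, ∑ a ∈ Finset.Ioc (st c) (st (c + 1)),
        (lens (tagOf a) a + D) ≤ 2 * pathLen X.d (block L c) +
          if c ∈ (L.map Prod.snd).toFinset then D else 0 := by
      intro c hc
      have hc := Finset.mem_range.1 hc
      have h1 : ∑ a ∈ Finset.Ioc (st c) (st (c + 1)), lens (tagOf a) a =
          ∑ a ∈ Finset.Ioc (st c) (st (c + 1)), lens c a := by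
        refine Finset.sum_congr rfl fun a ha => ?_
        rw [htagOf a c hc (Finset.mem_Ioc.1 ha).1 (Finset.mem_Ioc.1 ha).2]
      rw [Finset.sum_add_distrib, h1, Finset.sum_const, Nat.card_Ioc, nsmul_eq_mul]
      have h2 := (hlens2 c hc).2
      have hpl := pathLen_nonneg hd (block L c)
      rcases hcut c hc with ⟨-, h⟩ | ⟨h3, h4⟩
      · rw [h] at h2 ⊢
        simp at h2 ⊢
        split_ifs <;> linarith
      · have hmemc : c ∈ (L.map Prod.snd).toFinset := by
          have := h3.headD_mem
          simp only [labels, List.mem_reverse, List.mem_map, List.mem_filter, List.mem_range,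
            decide_eq_true_eq] at this
          obtain ⟨j, ⟨hj, hjc⟩, -⟩ := this
          rw [List.mem_toFinset, ← hjc]
          exact List.mem_map_of_mem (f := Prod.snd) (hL.get_lt hj)
        rw [if_pos hmemc, Nat.cast_sub (hst c hc)]
        have h5 := h3.count_le hd hℓ
        rw [h4, map_fst_labels hL] at h5
        rcases h5 with h5 | h5
        · rw [h5] at h2 ⊢
          push_cast
          linarith
        · have h6 : (1 : ℝ) ≤ st (c + 1) - st c := by
            have h7 := ((h3.bounds hd hℓ).1 _ h3.headD_mem).1
            rw [h4] at h7
            have : ((st c + 1 : ℕ) : ℝ) ≤ st (c + 1) := by exact_mod_cast h7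
            push_cast at this
            linarith
          have h7 : ((st (c + 1) : ℝ) - st c - 1) * D ≤
              ((st (c + 1) : ℝ) - st c - 1) * (r * D) :=
            mul_le_mul_of_nonneg_left hDℓ (by linarith)
          linarith
    have htot := (hsum fun a => lens (tagOf a) a + D).2.le.trans (Finset.sum_le_sum hone)
    rw [hZ, hZ', Finset.sum_add_distrib (s := Finset.range N), ← Finset.mul_sum] at htot
    have htags : ∑ c ∈ Finset.range N, (if c ∈ (L.map Prod.snd).toFinset then D else 0) ≤
        D + Wp / 2 := by
      rw [← Finset.sum_filter, Finset.sum_const, nsmul_eq_mul]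
      have h1 := hP.card_tags_le hd hlim
      simp only [List.map_cons, List.map_nil, List.toFinset_cons, List.toFinset_nil,
        insert_empty_eq, Finset.card_singleton, Nat.cast_one, one_mul] at h1
      have h2 : (((Finset.range N).filter (· ∈ (L.map Prod.snd).toFinset)).card : ℝ) ≤
          (L.map Prod.snd).toFinset.card := by
        exact_mod_cast Finset.card_le_card fun c hc => (Finset.mem_filter.1 hc).2
      nlinarith
    linarith

/-! ### Lower bounds for the weight of a solution -/

/-- The lower bounds for the weight `W` of a solution to which the algorithm is compared. -/
structure LowerBound (X : Data) (W : ℝ) : Prop where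
  sum_len_le : ∑ q ∈ Finset.range X.m, X.len q ≤ X.cap * W
  len_le : ∀ q < X.m, X.len q ≤ W
  exists_path : ∀ D : ℝ, ∀ C ⊆ Finset.range X.m, C.Nonempty → (∀ q ∈ C, D ≤ X.len q) →
    ∃ l : List ℕ, (∀ q ∈ C, X.src q ∈ l ∧ X.tgt q ∈ l) ∧
      pathLen (fun a b => min (X.d a b) (2 * D)) l ≤ 3 * W
  exists_walks : ∃ F : ℕ → List ℕ, (∀ q < X.m, ∃ k < X.h, X.src q ∈ F k) ∧
    ∑ k ∈ Finset.range X.h, walkLen X.d (X.depot k) (F k) ≤ W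

/-- The sources and the targets of the requests in `C`. -/
def Data.ends (X : Data) (C : Finset ℕ) : Finset ℕ := C.image X.src ∪ C.image X.tgt

/-- The run of Prim's algorithm for the requests of one scale is compared with the path in the lower
bound, after skipping the vertices that are not ends of requests of the scale. -/
theorem LowerBound.weight_le {X : Data} {W D Wp : ℝ} (hW : LowerBound X W) (hD : 0 ≤ D)
    {C : Finset ℕ} (hC : C ⊆ Finset.range X.m) (hCD : ∀ q ∈ C, D ≤ X.len q) {q₀ : ℕ} (hq₀ : q₀ ∈ C)
    {L : List (ℕ × ℕ)} {K : Finset ℕ}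
    (hP : Prim X.d (2 * D) [(X.src q₀, 0)] ((X.ends C).erase (X.src q₀)) L K Wp) : Wp ≤ 3 * W := by
  obtain ⟨l, hl, hlW⟩ := hW.exists_path D C hC ⟨q₀, hq₀⟩ hCD
  have hd := X.metric.min (c := 2 * D) (by linarith)
  have hends : ∀ v ∈ X.ends C, v ∈ l := by
    intro v hv
    simp only [Data.ends, Finset.mem_union, Finset.mem_image] at hv
    rcases hv with ⟨q, hq, rfl⟩ | ⟨q, hq, rfl⟩
    · exact (hl q hq).1
    · exact (hl q hq).2
  have hs : X.src q₀ ∈ X.ends C := by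
    simp only [Data.ends, Finset.mem_union, Finset.mem_image]
    exact .inl ⟨q₀, hq₀, rfl⟩
  have := hP.weight_le X.metric (by linarith) (by simp) (F := [l.filter (· ∈ X.ends C)])
    ⟨by
      simp only [List.mem_singleton, forall_eq, List.mem_filter, decide_eq_true_eq]
      rintro v ⟨-, hv⟩
      by_cases h : v = X.src q₀ <;> simp [h, hv],
    by
      simp only [List.mem_singleton, forall_eq, List.mem_filter, decide_eq_true_eq]
      exact ⟨X.src q₀, ⟨hends _ hs, hs⟩, by simp⟩,
    by
      simp only [List.mem_singleton, exists_eq_left, List.mem_filter, decide_eq_true_eq]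
      intro v hv
      have hv := Finset.mem_of_mem_erase hv
      exact ⟨hends _ hv, hv⟩⟩
  simp only [List.map_cons, List.map_nil, List.sum_cons, List.sum_nil, add_zero] at this
  exact this.trans ((pathLen_sublist hd List.filter_sublist).trans hlW)

/-! ### Grouping the requests by scales on the machine -/

notation "vQ" => 30
notation "vBq" => 31
notation "aAs" => 32
notation "vI" => 33
notation "vR" => 34
notation "aKS" => 35
notation "aKT" => 36
notation "aPS" => 37
notation "aPT" => 38
notation "rCS" => 7
notation "rCT" => 8

/-- The length of the request `vQ`. -/
def lenExp : RExp := distExp (.cell 2 (.var vQ)) (.cell 3 (.var vQ))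

theorem Base.eval_lenExp {X : Data} {σ : Memory} (hB : Base X σ) {q : ℕ} (hq : q < X.m)
    (hvq : σ.nat vQ 0 = q) : lenExp.eval σ = X.len q :=
  hB.eval_distExp (by simp [NExp.eval, hvq, hB.src q hq]) (by simp [NExp.eval, hvq, hB.tgt q hq])
    (X.src_lt q) (X.tgt_lt q)

/-- Find the shortest request without a segment. -/
def findMin : Program :=
  .seq (.setNat vFound (.lit 0) (.lit 0)) (.forLoop vQ (.cell 0 (.lit 2))
    (.ite (.natLE (.lit 1) (.cell aAs (.var vQ))) .skip
      (.ite (.natLE (.var vFound) (.lit 0)) keep (.ite (.realLE lenExp (.var rD)) keep .skip))))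
where
  keep : Program := .seq (.setNat vFound (.lit 0) (.lit 1))
    (.seq (.setNat vBq (.lit 0) (.var vQ)) (.setReal rD (.lit 0) lenExp))

/-- The request `vBq`, of length `rD`, is the shortest one among the first `k` requests without a
segment; `vFound` tells whether there is any. -/
def IsMin (X : Data) (as : ℕ → ℕ) (k : ℕ) (τ : Memory) : Prop :=
  (τ.nat vFound 0 = 0 ∧ ∀ q < k, 1 ≤ as q) ∨
    (τ.nat vFound 0 = 1 ∧ τ.nat vBq 0 < k ∧ as (τ.nat vBq 0) = 0 ∧
      τ.real rD 0 = X.len (τ.nat vBq 0) ∧ ∀ q < k, as q = 0 → τ.real rD 0 ≤ X.len q)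

theorem findMin_spec {X : Data} {s : ℕ} {σ : Memory} (hB : Base X σ) (hm : X.m ≤ s) :
    ∃ τ, Exec s findMin σ τ ∧ IsMin X (σ.nat aAs) X.m τ := by
  obtain ⟨τ, hτ, hi, -⟩ := Exec.forLoop (s := s) (σ := σ.setNat vFound 0 0) (i := vQ)
    (N := .cell 0 (.lit 2))
    (P := .ite (.natLE (.lit 1) (.cell aAs (.var vQ))) .skip
      (.ite (.natLE (.var vFound) (.lit 0)) findMin.keep
        (.ite (.realLE lenExp (.var rD)) findMin.keep .skip)))
    X.m hm (fun k τ => IsMin X (σ.nat aAs) k τ) rfl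
    (.inl ⟨by simp, by simp⟩)
    (fun τ hτ => by simpa [NExp.eval, hτ.nat 0 rfl] using hB.m)
    (by
      intro q hq τ hτ hvq hi
      have hB' : Base X τ := (hB.setNat 0 0).unchanged hτ rfl
      have has : τ.nat aAs = σ.nat aAs := by simpa using hτ.nat aAs rfl
      have hlen := hB'.eval_lenExp hq hvq
      by_cases h1 : 1 ≤ σ.nat aAs q
      · refine ⟨τ, .ite_true (by simpa [Test.Holds, NExp.eval, hvq, has] using h1) .skip, ?_⟩
        rcases hi with ⟨h2, h3⟩ | ⟨h2, h3, h4, h5, h6⟩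
        · refine .inl ⟨by simpa using h2, fun q' hq' => ?_⟩
          rcases (show q' < q ∨ q' = q by omega) with h | rfl
          · exact h3 q' h
          · exact h1
        · refine .inr ⟨by simpa using h2, by simp; omega, by simpa using h4, by simpa using h5,
            fun q' hq' h0 => ?_⟩
          rcases (show q' < q ∨ q' = q by omega) with h | rfl
          · exact h6 q' h h0
          · omega
      have h0 : σ.nat aAs q = 0 := by omega
      have hf1 : ¬ Test.Holds τ (.natLE (.lit 1) (.cell aAs (.var vQ))) := by
        simpa [Test.Holds, NExp.eval, hvq, has] using h0
      have hkeep : (∀ q' < q, σ.nat aAs q' = 0 → X.len q ≤ X.len q') →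
          ∃ ρ, Exec s findMin.keep τ ρ ∧
            IsMin X (σ.nat aAs) (q + 1) (ρ.setNat vQ 0 (q + 1)) := by
        intro hle
        refine ⟨_, Exec.setNat.seq (Exec.setNat.seq Exec.setReal), .inr ?_⟩
        have hlen' : lenExp.eval ((τ.setNat vFound 0 1).setNat vBq 0 q) = X.len q :=
          ((hB'.setNat 0 1).setNat 0 q).eval_lenExp hq (by simpa using hvq)
        simp only [NExp.eval, ne_eq, Nat.reduceEqDiff, not_false_eq_true,
          Memory.setNat_nat_ne, hvq, hlen', Memory.setReal_nat, Memory.setNat_nat_self,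
          Function.update_self, Memory.setNat_real, Memory.setReal_real_self]
        refine ⟨trivial, by omega, h0, trivial, fun q' hq' h0' => ?_⟩
        rcases (show q' < q ∨ q' = q by omega) with h | rfl
        · exact hle q' h h0'
        · exact le_rfl
      rcases hi with ⟨h2, h3⟩ | ⟨h2, h3, h4, h5, h6⟩
      · obtain ⟨ρ, hρ, h⟩ := hkeep fun q' hq' h0' => by have := h3 q' hq'; omega
        exact ⟨ρ, .ite_false hf1 (.ite_true (by simp [Test.Holds, NExp.eval, h2]) hρ), h⟩
      · have hf2 : ¬ Test.Holds τ (.natLE (.var vFound) (.lit 0)) := by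
          simp [Test.Holds, NExp.eval, h2]
        by_cases hlt : X.len q ≤ τ.real rD 0
        · obtain ⟨ρ, hρ, h⟩ := hkeep fun q' hq' h0' => hlt.trans (h6 q' hq' h0')
          refine ⟨ρ, .ite_false hf1 (.ite_false hf2 (.ite_true ?_ hρ)), h⟩
          simpa [Test.Holds, RExp.eval, NExp.eval, hlen] using hlt
        · refine ⟨τ, .ite_false hf1 (.ite_false hf2 (.ite_false ?_ .skip)), .inr ?_⟩
          · simpa [Test.Holds, RExp.eval, NExp.eval, hlen] using hlt
          · refine ⟨by simpa using h2, by simp; omega, by simpa using h4, by simpa using h5,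
              fun q' hq' h0' => ?_⟩
            rcases (show q' < q ∨ q' = q by omega) with h | rfl
            · simpa using h6 q' h h0'
            · simpa using (not_le.1 hlt).le)
  exact ⟨τ, Exec.setNat.seq hτ, hi⟩

/-- Set the limits `rLim = 2 * rD` and `rMax = vR * rD`. -/
def setScale : Program :=
  .seq (.setReal rLim (.lit 0) (.add (.var rD) (.var rD)))
    (.seq (.setReal rMax (.lit 0) (.sub (.var rD) (.var rD)))
      (.forLoop vI (.var vR) (.setReal rMax (.lit 0) (.add (.var rMax) (.var rD)))))

theorem setScale_spec {s r : ℕ} {σ : Memory} (hr : σ.nat vR 0 = r) (hrs : r ≤ s) :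
    ∃ τ, Exec s setScale σ τ ∧ τ.real rLim 0 = 2 * σ.real rD 0 ∧
      τ.real rMax 0 = r * σ.real rD 0 := by
  set σ' := (σ.setReal rLim 0 (2 * σ.real rD 0)).setReal rMax 0 0 with hσ'
  obtain ⟨τ, hτ, hi, hU⟩ := Exec.forLoop (s := s) (σ := σ') (i := vI) (N := .var vR)
    (P := .setReal rMax (.lit 0) (.add (.var rMax) (.var rD))) r hrs
    (fun k τ => τ.real rMax 0 = k * σ.real rD 0) rfl (by simp [hσ'])
    (fun τ hτ => by simpa [NExp.eval, hτ.nat vR rfl, hσ'] using hr)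
    (by
      intro k hk τ hτ hvi hi
      refine ⟨_, Exec.setReal, ?_⟩
      have : τ.real rD = σ.real rD := by simpa [hσ'] using hτ.real rD rfl
      simp [NExp.eval, RExp.eval, hi, this]
      ring)
  refine ⟨τ, ?_, ?_, hi⟩
  · have h1 := Exec.setReal (s := s) (σ := σ) (a := rLim) (i := .lit 0)
      (e := .add (.var rD) (.var rD))
    have h2 := h1.seq ((Exec.setReal (a := rMax) (i := .lit 0) (e := .sub (.var rD) (.var rD))).seq
      (ρ := τ) (by simpa [NExp.eval, RExp.eval, hσ', two_mul] using hτ))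
    exact h2
  · rw [hU.real rLim rfl]; simp [hσ']

/-- Run `P` if the request `vQ` has no segment yet and belongs to the present scale. -/
def ifClass (P : Program) : Program :=
  .ite (.natLE (.lit 1) (.cell aAs (.var vQ))) .skip (.ite (.realLE lenExp (.var rLim)) P .skip)

theorem ifClass_exec {X : Data} {s q : ℕ} {lim : ℝ} {P : Program} {τ ρ : Memory} (hB : Base X τ)
    (hvq : τ.nat vQ 0 = q) (hq : q < X.m) (hlim : τ.real rLim 0 = lim)
    (h1 : τ.nat aAs q = 0 → X.len q ≤ lim → Exec s P τ ρ)
    (h2 : ¬ (τ.nat aAs q = 0 ∧ X.len q ≤ lim) → ρ = τ) : Exec s (ifClass P) τ ρ := by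
  have hlen := hB.eval_lenExp hq hvq
  by_cases ha : τ.nat aAs q = 0
  · refine .ite_false (by simp [Test.Holds, NExp.eval, hvq, ha]) ?_
    by_cases hl : X.len q ≤ lim
    · exact .ite_true (by simpa [Test.Holds, NExp.eval, RExp.eval, hlen, hlim] using hl) (h1 ha hl)
    · rw [h2 (by tauto)]
      exact .ite_false (by simpa [Test.Holds, NExp.eval, RExp.eval, hlen, hlim] using hl) .skip
  · rw [h2 (by tauto)]
    exact .ite_true (by simp [Test.Holds, NExp.eval, hvq]; omega) .skip

/-- Mark the ends of the requests of the present scale. -/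
def flags : Program :=
  .seq (.forLoop vI (.cell 0 (.lit 0)) (.setNat aNeed (.var vI) (.lit 0)))
    (.forLoop vQ (.cell 0 (.lit 2)) (ifClass (.seq (.setNat aNeed (.cell 2 (.var vQ)) (.lit 1))
      (.setNat aNeed (.cell 3 (.var vQ)) (.lit 1)))))

/-- The requests without a segment of length at most `lim`. -/
def scaleClass (X : Data) (as : ℕ → ℕ) (lim : ℝ) : Finset ℕ := by
  classical exact (Finset.range X.m).filter fun q => as q = 0 ∧ X.len q ≤ lim

theorem mem_scaleClass {X : Data} {as : ℕ → ℕ} {lim : ℝ} {q : ℕ} :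
    q ∈ scaleClass X as lim ↔ q < X.m ∧ as q = 0 ∧ X.len q ≤ lim := by
  simp [scaleClass]

theorem clear_spec {s n : ℕ} {σ : Memory} (hn : σ.nat 0 0 = n) (hs : n ≤ s) :
    ∃ τ, Exec s (.forLoop vI (.cell 0 (.lit 0)) (.setNat aNeed (.var vI) (.lit 0))) σ τ ∧
      ∀ u < n, τ.nat aNeed u = 0 := by
  obtain ⟨τ, hτ, hi, -⟩ := Exec.forLoop (s := s) (σ := σ) (i := vI) (N := .cell 0 (.lit 0))
    (P := .setNat aNeed (.var vI) (.lit 0)) n hs (fun k τ => ∀ u < k, τ.nat aNeed u = 0) rfl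
    (by simp) (fun τ hτ => by simpa [NExp.eval, hτ.nat 0 rfl] using hn)
    (by
      intro k hk τ hτ hvi hi
      refine ⟨_, Exec.setNat, fun u hu => ?_⟩
      by_cases h : u = k
      · simp [NExp.eval, hvi, h]
      · simpa [NExp.eval, hvi, h] using hi u (by omega))
  exact ⟨τ, hτ, hi⟩

theorem flags_spec {X : Data} {s : ℕ} {σ : Memory} {lim : ℝ} (hB : Base X σ) (hn : X.n ≤ s)
    (hm : X.m ≤ s) (hlim : σ.real rLim 0 = lim) :
    ∃ τ, Exec s flags σ τ ∧ HoldsSet X.n (X.ends (scaleClass X (σ.nat aAs) lim)) τ := by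
  obtain ⟨σ', hσ', hclear⟩ := clear_spec (s := s) hB.n hn
  have hU := hσ'.unchanged
  have hB' := hB.unchanged hU rfl
  obtain ⟨τ, hτ, hi, -⟩ := Exec.forLoop (s := s) (σ := σ') (i := vQ) (N := .cell 0 (.lit 2))
    (P := ifClass (.seq (.setNat aNeed (.cell 2 (.var vQ)) (.lit 1))
      (.setNat aNeed (.cell 3 (.var vQ)) (.lit 1)))) X.m hm
    (fun k τ => ∀ u < X.n, 1 ≤ τ.nat aNeed u ↔
      ∃ q < k, q ∈ scaleClass X (σ.nat aAs) lim ∧ (X.src q = u ∨ X.tgt q = u)) rfl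
    (fun u hu => by simp [hclear u hu])
    (fun τ hτ => by simpa [NExp.eval, hτ.nat 0 rfl] using hB'.m)
    (by
      intro q hq τ hτ hvq hi
      have hBτ := hB'.unchanged hτ rfl
      have has : τ.nat aAs = σ.nat aAs := by rw [hτ.nat aAs rfl, hU.nat aAs rfl]
      have hl : τ.real rLim 0 = lim := by rw [hτ.real rLim rfl, hU.real rLim rfl, hlim]
      by_cases hc : τ.nat aAs q = 0 ∧ X.len q ≤ lim
      · refine ⟨_, ifClass_exec hBτ hvq hq hl (fun _ _ => Exec.setNat.seq Exec.setNat)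
          (absurd hc), fun u hu => ?_⟩
        have hcl : q ∈ scaleClass X (σ.nat aAs) lim :=
          mem_scaleClass.2 ⟨hq, by rw [← has]; exact hc.1, hc.2⟩
        simp only [NExp.eval, ne_eq, Nat.reduceEqDiff, not_false_eq_true, Memory.setNat_nat_ne,
          Memory.setNat_nat_self, hvq, hBτ.src q hq, hBτ.tgt q hq]
        by_cases h1 : u = X.tgt q
        · subst h1
          simp only [Function.update_self, le_refl, true_iff]
          exact ⟨q, by omega, hcl, .inr rfl⟩
        by_cases h2 : u = X.src q
        · subst h2
          simp only [ne_eq, h1, not_false_eq_true, Function.update_of_ne, Function.update_self,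
            le_refl, true_iff]
          exact ⟨q, by omega, hcl, .inl rfl⟩
        rw [Function.update_of_ne h1, Function.update_of_ne h2, hi u hu]
        constructor
        · rintro ⟨q', h3, h4⟩
          exact ⟨q', by omega, h4⟩
        · rintro ⟨q', h3, h4, h5⟩
          refine ⟨q', ?_, h4, h5⟩
          rcases (show q' < q ∨ q' = q by omega) with h | rfl
          · exact h
          · rcases h5 with h5 | h5
            · exact absurd h5.symm h2
            · exact absurd h5.symm h1
      · refine ⟨τ, ifClass_exec hBτ hvq hq hl (fun h h' => absurd ⟨h, h'⟩ hc) fun _ => rfl,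
          fun u hu => ?_⟩
        simp only [ne_eq, Nat.reduceEqDiff, not_false_eq_true, Memory.setNat_nat_ne]
        rw [hi u hu]
        constructor
        · rintro ⟨q', h3, h4⟩
          exact ⟨q', by omega, h4⟩
        · rintro ⟨q', h3, h4, h5⟩
          refine ⟨q', ?_, h4, h5⟩
          rcases (show q' < q ∨ q' = q by omega) with h | rfl
          · exact h
          · rw [has] at hc
            exact absurd (mem_scaleClass.1 h4).2 hc)
  refine ⟨τ, hσ'.seq hτ, fun u hu => ?_, fun u hu => ?_⟩
  · simp only [Data.ends, Finset.mem_union, Finset.mem_image] at hu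
    rw [Finset.mem_range]
    rcases hu with ⟨q, -, rfl⟩ | ⟨q, -, rfl⟩
    · exact X.src_lt q
    · exact X.tgt_lt q
  · rw [hi u hu]
    simp only [Data.ends, Finset.mem_union, Finset.mem_image]
    constructor
    · rintro ⟨q, h1, h2, h3 | h3⟩
      · exact .inl ⟨q, h2, h3⟩
      · exact .inr ⟨q, h2, h3⟩
    · rintro (⟨q, h2, h3⟩ | ⟨q, h2, h3⟩)
      · exact ⟨q, (mem_scaleClass.1 h2).1, h2, .inl h3⟩
      · exact ⟨q, (mem_scaleClass.1 h2).1, h2, .inr h3⟩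

/-- Give segments to the requests of the present scale. -/
def assign : Program :=
  .forLoop vQ (.cell 0 (.lit 2)) (ifClass (.seq (.setNat aAs (.var vQ) (.lit 1))
    (.seq (side aKS aPS rCS 2) (side aKT aPT rCT 3))))
where
  side (k p c e : ℕ) : Program :=
    .seq (.setNat p (.var vQ) (.cell aPos (.cell e (.var vQ))))
      (.seq (.setNat k (.var vQ) (.cell aSeg (.cell p (.var vQ))))
        (.setReal c (.var vQ) (.cell aCo (.cell p (.var vQ)))))

/-- The segment, position and coordinate of the source of a request. -/
def srcKey (τ : Memory) (q : ℕ) : ℕ × ℕ × ℝ := (τ.nat aKS q, τ.nat aPS q, τ.real rCS q)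

/-- The segment, position and coordinate of the target of a request. -/
def tgtKey (τ : Memory) (q : ℕ) : ℕ × ℕ × ℝ := (τ.nat aKT q, τ.nat aPT q, τ.real rCT q)

/-- The segment, position and coordinate of a vertex. -/
def vertexKey (τ : Memory) (v : ℕ) : ℕ × ℕ × ℝ :=
  (τ.nat aSeg (τ.nat aPos v), τ.nat aPos v, τ.real aCo (τ.nat aPos v))

theorem assign_spec {X : Data} {s : ℕ} {σ : Memory} {lim : ℝ} (hB : Base X σ) (hm : X.m ≤ s)
    (hlim : σ.real rLim 0 = lim) :
    ∃ τ, Exec s assign σ τ ∧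
      (∀ q ∈ scaleClass X (σ.nat aAs) lim, τ.nat aAs q = 1 ∧
        srcKey τ q = vertexKey σ (X.src q) ∧ tgtKey τ q = vertexKey σ (X.tgt q)) ∧
      (∀ q, q ∉ scaleClass X (σ.nat aAs) lim → τ.nat aAs q = σ.nat aAs q ∧
        srcKey τ q = srcKey σ q ∧ tgtKey τ q = tgtKey σ q) := by
  obtain ⟨τ, hτ, ⟨h1, h2⟩, -⟩ := Exec.forLoop (s := s) (σ := σ) (i := vQ) (N := .cell 0 (.lit 2))
    (P := ifClass (.seq (.setNat aAs (.var vQ) (.lit 1))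
      (.seq (assign.side aKS aPS rCS 2) (assign.side aKT aPT rCT 3)))) X.m hm
    (fun k τ => (∀ q, q < k ∧ q ∈ scaleClass X (σ.nat aAs) lim → τ.nat aAs q = 1 ∧
        srcKey τ q = vertexKey σ (X.src q) ∧ tgtKey τ q = vertexKey σ (X.tgt q)) ∧
      (∀ q, ¬ (q < k ∧ q ∈ scaleClass X (σ.nat aAs) lim) → τ.nat aAs q = σ.nat aAs q ∧
        srcKey τ q = srcKey σ q ∧ tgtKey τ q = tgtKey σ q)) rfl
    (by simp [srcKey, tgtKey])
    (fun τ hτ => by simpa [NExp.eval, hτ.nat 0 rfl] using hB.m)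
    (by
      rintro q hq τ hτ hvq ⟨h1, h2⟩
      have hBτ := hB.unchanged hτ rfl
      have hl : τ.real rLim 0 = lim := by rw [hτ.real rLim rfl, hlim]
      have hq0 := h2 q (by omega)
      have hSeg : τ.nat aSeg = σ.nat aSeg := hτ.nat aSeg rfl
      have hPos : τ.nat aPos = σ.nat aPos := hτ.nat aPos rfl
      have hCo : τ.real aCo = σ.real aCo := hτ.real aCo rfl
      by_cases hc : τ.nat aAs q = 0 ∧ X.len q ≤ lim
      · have hcl : q ∈ scaleClass X (σ.nat aAs) lim :=
          mem_scaleClass.2 ⟨hq, by rw [← hq0.1]; exact hc.1, hc.2⟩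
        refine ⟨_, ifClass_exec hBτ hvq hq hl (fun _ _ => Exec.setNat.seq
          ((Exec.setNat.seq (Exec.setNat.seq Exec.setReal)).seq
            (Exec.setNat.seq (Exec.setNat.seq Exec.setReal)))) (absurd hc), ?_⟩
        have key : ∀ q', q' ≠ q → ∀ (f : ℕ → ℕ) (x : ℕ), Function.update f q x q' = f q' :=
          fun q' h f x => Function.update_of_ne h _ _
        refine ⟨fun q' hq' => ?_, fun q' hq' => ?_⟩
        · by_cases h : q' = q
          · subst h
            simp [NExp.eval, RExp.eval, srcKey, tgtKey, vertexKey, hvq, hBτ.src q' hq,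
              hBτ.tgt q' hq,
              hSeg, hPos, hCo]
          · have := h1 q' ⟨by omega, hq'.2⟩
            simpa [NExp.eval, RExp.eval, srcKey, tgtKey, hvq, h] using this
        · have h : q' ≠ q := fun h => hq' ⟨by omega, h ▸ hcl⟩
          have := h2 q' fun hh => hq' ⟨by omega, hh.2⟩
          simpa [NExp.eval, RExp.eval, srcKey, tgtKey, hvq, h] using this
      · have hcl : q ∉ scaleClass X (σ.nat aAs) lim := fun h => hc (by
          rw [hq0.1]; exact (mem_scaleClass.1 h).2)
        refine ⟨τ, ifClass_exec hBτ hvq hq hl (fun h h' => absurd ⟨h, h'⟩ hc) fun _ => rfl,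
          fun q' hq' => ?_, fun q' hq' => ?_⟩
        · have h : q' ≠ q := fun h => hcl (h ▸ hq'.2)
          simpa [srcKey, tgtKey] using h1 q' ⟨by omega, hq'.2⟩
        · simpa [srcKey, tgtKey] using h2 q' fun hh => hq' ⟨by omega, hh.2⟩)
  exact ⟨τ, hτ, fun q hq => h1 q ⟨(mem_scaleClass.1 hq).1, hq⟩, fun q hq => h2 q fun h => hq h.2⟩

/-- Start a walk at the source of the request `vBq`. -/
def startWalk : Program :=
  .seq (.setNat aLoc (.lit 0) (.cell 2 (.var vBq))) (.seq (.setNat aTag (.lit 0) (.lit 0))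
    (.seq (.setNat vCnt (.lit 0) (.lit 1)) (.setNat aNeed (.cell 2 (.var vBq)) (.lit 0))))

theorem startWalk_spec {X : Data} {s q : ℕ} {σ : Memory} {K : Finset ℕ} (hB : Base X σ)
    (hK : HoldsSet X.n K σ) (hq : q < X.m) (hbq : σ.nat vBq 0 = q) :
    ∃ τ, Exec s startWalk σ τ ∧ HoldsList [(X.src q, 0)] τ ∧
      HoldsSet X.n (K.erase (X.src q)) τ := by
  refine ⟨_, Exec.setNat.seq (Exec.setNat.seq (Exec.setNat.seq Exec.setNat)), ⟨?_, ?_⟩,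
    (Finset.erase_subset _ _).trans hK.1, fun u hu => ?_⟩
  · simp [NExp.eval]
  · intro j p hp
    rcases j with _ | j
    · simp at hp
      simp [NExp.eval, ← hp, hbq, hB.src q hq]
    · simp at hp
  · simp only [NExp.eval, ne_eq, Nat.reduceEqDiff, not_false_eq_true, Memory.setNat_nat_ne,
      Memory.setNat_nat_self, hbq, hB.src q hq]
    by_cases h : u = X.src q
    · simp [h]
    · rw [Function.update_of_ne h, hK.2 u hu]
      simp [h]

/-- Prim's algorithm on the ends of the requests of one scale, and the cutting of its walks. -/
def scaleWalks : Program :=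
  .seq setScale (.seq flags (.seq startWalk
    (.seq (prim (.realLE (.var rBest) (.var rLim))) label)))

/-- Give segments to all the requests, scale by scale. -/
def scales : Program :=
  .seq findMin (.loop (.natLE (.lit 1) (.var vFound))
    (.seq (.seq scaleWalks assign) findMin))

/-- The requests that have segments. -/
def assigned (X : Data) (τ : Memory) : Set ℕ := {q | q < X.m ∧ 1 ≤ τ.nat aAs q}

/-- The state after the treatment of the scales `Ds`. -/
structure Scaled (X : Data) (r : ℕ) (Ds : List ℝ) (τ : Memory) : Prop where
  base : Base X τ
  keys : ∃ len sc cp, Keys X r (1 + 4 * X.n / r) (assigned X τ) 0 (τ.nat vSg 0)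
    (srcKey τ) (tgtKey τ) len sc cp ∧ ∀ W, LowerBound X W →
      ∑ a ∈ Finset.Ioc 0 (τ.nat vSg 0), (len a + sc a) ≤
        (Ds.map fun D => 5 * (min (3 * W) (X.n * (2 * D)) + D)).sum
  pos_lt : ∀ q ∈ assigned X τ, (srcKey τ q).2.1 < X.n ∧ (tgtKey τ q).2.1 < X.n
  pairwise : Ds.Pairwise fun a b => 2 * b < a
  mem : ∀ D ∈ Ds, ∃ q < X.m, D = X.len q
  lt : ∀ q < X.m, τ.nat aAs q = 0 → ∀ D ∈ Ds, 2 * D < X.len q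

theorem Data.len_nonneg (X : Data) (q : ℕ) : 0 ≤ X.len q := X.metric.nonneg _ _

theorem scaleWalks_spec {X : Data} {s r q₀ : ℕ} {σ : Memory} (hB : Base X σ) (hn : X.n ≤ s)
    (hm : X.m ≤ s) (hr : 1 ≤ r) (hrs : r ≤ s) (hvr : σ.nat vR 0 = r) (hbq : σ.nat vBq 0 = q₀)
    (hq₀ : q₀ < X.m) (has : σ.nat aAs q₀ = 0) (hD : σ.real rD 0 = X.len q₀)
    (hle : ∀ q < X.m, σ.nat aAs q = 0 → X.len q₀ ≤ X.len q) :
    ∃ τ, Exec s scaleWalks σ τ ∧ τ.real rLim 0 = 2 * X.len q₀ ∧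
      (∀ q ∈ scaleClass X (σ.nat aAs) (2 * X.len q₀),
        τ.nat aPos (X.src q) < X.n ∧ τ.nat aPos (X.tgt q) < X.n) ∧
      σ.nat vSg 0 ≤ τ.nat vSg 0 ∧ ∃ len sc cp, Keys X r (1 + 4 * X.n / r)
        (scaleClass X (σ.nat aAs) (2 * X.len q₀)) (σ.nat vSg 0) (τ.nat vSg 0)
        (fun q => vertexKey τ (X.src q)) (fun q => vertexKey τ (X.tgt q)) len sc cp ∧
        ∀ W, LowerBound X W → ∑ a ∈ Finset.Ioc (σ.nat vSg 0) (τ.nat vSg 0), (len a + sc a) ≤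
          5 * (min (3 * W) (X.n * (2 * X.len q₀)) + X.len q₀) := by
  have hlen := X.len_nonneg q₀
  obtain ⟨σ₁, e₁, hlim, hmax⟩ := setScale_spec (s := s) hvr hrs
  rw [hD] at hlim hmax
  have hB₁ := hB.unchanged e₁.unchanged rfl
  obtain ⟨σ₂, e₂, hK⟩ := flags_spec (s := s) hB₁ hn hm hlim
  rw [e₁.unchanged.nat aAs rfl] at hK
  set C := scaleClass X (σ.nat aAs) (2 * X.len q₀) with hCdef
  have hB₂ := hB₁.unchanged e₂.unchanged rfl
  obtain ⟨σ₃, e₃, hL₃, hK₃⟩ := startWalk_spec (s := s) (q := q₀) hB₂ hK hq₀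
    (by rw [e₂.unchanged.nat vBq rfl, e₁.unchanged.nat vBq rfl, hbq])
  have hB₃ := hB₂.unchanged e₃.unchanged rfl
  have hq₀C : q₀ ∈ C := mem_scaleClass.2 ⟨hq₀, has, by linarith⟩
  have hends : X.src q₀ ∈ X.ends C := by
    simp only [Data.ends, Finset.mem_union, Finset.mem_image]
    exact .inl ⟨q₀, hq₀C, rfl⟩
  have hcard : ((X.ends C).erase (X.src q₀)).card + 1 ≤ X.n := by
    rw [Finset.card_erase_add_one hends]
    simpa using Finset.card_le_card hK.1
  have hlim₃ : σ₃.real rLim 0 = 2 * X.len q₀ := by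
    rw [e₃.unchanged.real rLim rfl, e₂.unchanged.real rLim rfl, hlim]
  obtain ⟨σ₄, L, Wp, e₄, hP, hL₄, -⟩ := prim_spec (s := s) (lim := 2 * X.len q₀)
    (b := .realLE (.var rBest) (.var rLim)) hB₃ hL₃ hK₃ (by simp)
    (by simp [X.src_lt]) (by simp; omega) hn
    (fun τ hτ _ => by simp [Test.Holds, RExp.eval, NExp.eval, hτ.real rLim rfl, hlim₃])
  have hB₄ := hB₃.unchanged e₄.unchanged rfl
  have hLlen := hP.length_add_card
  simp only [Finset.card_empty, List.length_cons, List.length_nil] at hLlen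
  have hLn : ∀ p ∈ L, p.1 < X.n := by
    intro p hp
    rcases hP.mem_start (List.mem_map_of_mem (f := Prod.fst) hp) with h | h
    · simp at h
      rw [h]
      exact X.src_lt q₀
    · exact Finset.mem_range.1 (hK.1 (Finset.mem_of_mem_erase h))
  have hmax₄ : σ₄.real rMax 0 = r * X.len q₀ := by
    rw [e₄.unchanged.real rMax rfl, e₃.unchanged.real rMax rfl, e₂.unchanged.real rMax rfl, hmax]
  obtain ⟨σ₅, e₅, hpos, hst0, hstN, hcut⟩ := label_spec (s := s) hB₄ hL₄ hLn
    (hP.tag_lt (by simp)) (by omega) hmax₄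
  have hL₅ : HoldsList L σ₅ := hL₄.congr (e₅.unchanged.nat _ rfl) (e₅.unchanged.nat _ rfl)
    (e₅.unchanged.nat _ rfl)
  have hmemL : ∀ v ∈ X.ends C, v ∈ L.map Prod.fst := by
    intro v hv
    by_cases h : v = X.src q₀
    · rw [h]
      exact List.mem_map_of_mem (f := Prod.fst) (hP.start_subset (p := (X.src q₀, 0)) (by simp))
    · exact (hP.mem_or (Finset.mem_erase.2 ⟨h, hv⟩)).resolve_left (by simp)
  have hsrc : ∀ q ∈ C, X.src q ∈ L.map Prod.fst := fun q hq =>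
    hmemL _ (Finset.mem_union_left _ (Finset.mem_image_of_mem _ hq))
  have htgt : ∀ q ∈ C, X.tgt q ∈ L.map Prod.fst := fun q hq =>
    hmemL _ (Finset.mem_union_right _ (Finset.mem_image_of_mem _ hq))
  have hsg : σ₄.nat vSg 0 = σ.nat vSg 0 := by
    rw [e₄.unchanged.nat vSg rfl, e₃.unchanged.nat vSg rfl, e₂.unchanged.nat vSg rfl,
      e₁.unchanged.nat vSg rfl]
  have hlow : ∀ q ∈ C, X.len q₀ ≤ X.len q := fun q hq =>
    hle q (mem_scaleClass.1 hq).1 (mem_scaleClass.1 hq).2.1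
  obtain ⟨hZ, len, sc, cp, hkeys, hsum⟩ := keys_of_cut (C := (C : Set ℕ)) (Z := σ.nat vSg 0)
    (Z' := σ₅.nat vSg 0) hr hlen hP ((Finset.erase_subset _ _).trans hK.1) hL₅ hpos
    (by rw [hst0 (by omega), hsg]) hstN hcut (by
      intro q hq
      exact ⟨hsrc q hq, htgt q hq, hlow q hq, (mem_scaleClass.1 hq).2.2⟩)
  refine ⟨σ₅, e₁.seq (e₂.seq (e₃.seq (e₄.seq e₅))), ?_, fun q hq => ?_, hZ, len, sc, cp, hkeys,
    fun W hW => ?_⟩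
  · rw [e₅.unchanged.real rLim rfl, e₄.unchanged.real rLim rfl, hlim₃]
  · have h1 := (hpos _ (hsrc q hq)).1
    have h2 := (hpos _ (htgt q hq)).1
    rw [hL₅.count] at h1 h2
    omega
  · refine hsum.trans ?_
    gcongr
    refine le_min (hW.weight_le hlen (fun q hq => Finset.mem_range.2 (mem_scaleClass.1 hq).1) hlow
      hq₀C hP) ?_
    have h1 := hP.sum_le
    have h2 : (((X.ends C).erase (X.src q₀)).card : ℝ) ≤ X.n := by
      exact_mod_cast (Nat.le_succ _).trans hcard
    simp only [Finset.card_empty, Nat.cast_zero, zero_mul, add_zero] at h1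
    refine h1.trans ?_
    gcongr

/-- Every request of the present scale gets its segments; the requests that remain are longer than
`2 * X.len q₀`, so the scales grow geometrically. -/
theorem scaleStep_spec {X : Data} {s r q₀ : ℕ} {Ds : List ℝ} {σ : Memory} (hσ : Scaled X r Ds σ)
    (hn : X.n ≤ s) (hm : X.m ≤ s) (hr : 1 ≤ r) (hrs : r ≤ s) (hvr : σ.nat vR 0 = r)
    (hbq : σ.nat vBq 0 = q₀) (hq₀ : q₀ < X.m) (has : σ.nat aAs q₀ = 0)
    (hD : σ.real rD 0 = X.len q₀) (hle : ∀ q < X.m, σ.nat aAs q = 0 → X.len q₀ ≤ X.len q) :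
    ∃ τ, Exec s (.seq scaleWalks assign) σ τ ∧ Scaled X r (X.len q₀ :: Ds) τ ∧
      (∀ q, τ.nat aAs q = 0 → σ.nat aAs q = 0) ∧ τ.nat aAs q₀ = 1 := by
  obtain ⟨ρ, eρ, hlim, hposlt, hZ, len', sc', cp', hk', hsum'⟩ :=
    scaleWalks_spec (s := s) hσ.base hn hm hr hrs hvr hbq hq₀ has hD hle
  have hU := eρ.unchanged
  have hasρ : ρ.nat aAs = σ.nat aAs := hU.nat aAs rfl
  have hsρ : srcKey ρ = srcKey σ := by
    ext1 q; simp only [srcKey, hU.nat aKS rfl, hU.nat aPS rfl, hU.real rCS rfl]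
  have htρ : tgtKey ρ = tgtKey σ := by
    ext1 q; simp only [tgtKey, hU.nat aKT rfl, hU.nat aPT rfl, hU.real rCT rfl]
  have hBρ := hσ.base.unchanged hU rfl
  obtain ⟨τ, eτ, hnew, hold⟩ := assign_spec (s := s) hBρ hm hlim
  rw [hasρ] at hnew hold
  rw [hsρ, htρ] at hold
  set C := scaleClass X (σ.nat aAs) (2 * X.len q₀) with hC
  have hq₀C : q₀ ∈ C := mem_scaleClass.2 ⟨hq₀, has, by linarith [X.len_nonneg q₀]⟩
  have hsg : τ.nat vSg = ρ.nat vSg := eτ.unchanged.nat vSg rfl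
  obtain ⟨len, sc, cp, hk, hsum⟩ := hσ.keys
  have hassigned : assigned X τ = assigned X σ ∪ ↑C := by
    ext q
    simp only [assigned, Set.mem_ofPred_eq, Set.mem_union, Finset.mem_coe]
    by_cases h : q ∈ C
    · have := (mem_scaleClass.1 h).1
      simp [h, (hnew q h).1, this]
    · simp [h, (hold q h).1]
  have hnotC : ∀ q ∈ assigned X σ, q ∉ C := fun q hq h => by
    have h1 := hq.2
    rw [(mem_scaleClass.1 h).2.1] at h1
    omega
  refine ⟨τ, eρ.seq eτ, ⟨hBρ.unchanged eτ.unchanged rfl, ?_, ?_, ?_, ?_, ?_⟩, fun q hq => ?_,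
    (hnew q₀ hq₀C).1⟩
  · refine ⟨_, _, _, hassigned ▸ hsg ▸ Keys.union (hk.congr (η := srcKey τ) (η' := tgtKey τ)
      (fun q hq => (hold q (hnotC q hq)).2.1) (fun q hq => (hold q (hnotC q hq)).2.2))
      (hk'.congr (fun q hq => (hnew q hq).2.1) (fun q hq => (hnew q hq).2.2)) (Nat.zero_le _) hZ,
      fun W hW => ?_⟩
    rw [hsg, ← Finset.sum_Ioc_consecutive _ (Nat.zero_le _) hZ, List.map_cons, List.sum_cons,
      add_comm]
    refine add_le_add (le_trans (le_of_eq ?_) (hsum' W hW))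
      (le_trans (le_of_eq ?_) (hsum W hW))
    · refine Finset.sum_congr rfl fun a ha => ?_
      have := (Finset.mem_Ioc.1 ha).1
      rw [if_neg (by omega), if_neg (by omega)]
    · refine Finset.sum_congr rfl fun a ha => ?_
      have := (Finset.mem_Ioc.1 ha).2
      rw [if_pos (by omega), if_pos (by omega)]
  · rw [hassigned]
    rintro q (hq | hq)
    · rw [(hold q (hnotC q hq)).2.1, (hold q (hnotC q hq)).2.2]
      exact hσ.pos_lt q hq
    · rw [(hnew q hq).2.1, (hnew q hq).2.2]
      exact hposlt q hq
  · exact List.pairwise_cons.2 ⟨hσ.lt q₀ hq₀ has, hσ.pairwise⟩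
  · intro D hD'
    rcases List.mem_cons.1 hD' with rfl | h
    · exact ⟨q₀, hq₀, rfl⟩
    · exact hσ.mem D h
  · intro q hq h0 D hD'
    have hqC : q ∉ C := fun h => by rw [(hnew q h).1] at h0; omega
    have h0' : σ.nat aAs q = 0 := by rw [← (hold q hqC).1, h0]
    rcases List.mem_cons.1 hD' with rfl | h
    · by_contra hcon
      exact hqC (mem_scaleClass.2 ⟨hq, h0', not_lt.1 hcon⟩)
    · exact hσ.lt q hq h0' D h
  · by_cases h : q ∈ C
    · exact (mem_scaleClass.1 h).2.1
    · rw [← (hold q h).1, hq]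

theorem scales_spec {X : Data} {s r : ℕ} {σ : Memory} (hB : Base X σ) (hn : X.n ≤ s) (hm : X.m ≤ s)
    (hr : 1 ≤ r) (hrs : r ≤ s) (hvr : σ.nat vR 0 = r) (has : ∀ q, σ.nat aAs q = 0)
    (hsg : σ.nat vSg 0 = 0) :
    ∃ τ Ds, Exec s scales σ τ ∧ Scaled X r Ds τ ∧ ∀ q < X.m, 1 ≤ τ.nat aAs q := by
  have hcongr : ∀ {Ds : List ℝ} {τ ρ : Memory}, Scaled X r Ds τ → Unchanged findMin τ ρ →
      Scaled X r Ds ρ := by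
    intro Ds τ ρ h hU
    have h1 : ρ.nat aAs = τ.nat aAs := hU.nat aAs rfl
    have h2 : ρ.nat vSg = τ.nat vSg := hU.nat vSg rfl
    have h3 : srcKey ρ = srcKey τ := by
      ext1 q; simp only [srcKey, hU.nat aKS rfl, hU.nat aPS rfl, hU.real rCS rfl]
    have h4 : tgtKey ρ = tgtKey τ := by
      ext1 q; simp only [tgtKey, hU.nat aKT rfl, hU.nat aPT rfl, hU.real rCT rfl]
    refine ⟨h.base.unchanged hU rfl, ?_, ?_, h.pairwise, h.mem, by rw [h1]; exact h.lt⟩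
    · rw [h2, h3, h4]
      simpa only [assigned, h1] using h.keys
    · rw [h3, h4]
      simpa only [assigned, h1] using h.pos_lt
  obtain ⟨σ', e', hmin⟩ := findMin_spec (s := s) hB hm
  have h0 : Scaled X r [] σ := by
    have hempty : assigned X σ = ∅ := by ext q; simp [assigned, has]
    refine ⟨hB, ⟨fun _ => 0, fun _ => 0, fun _ => 0, ?_, fun W _ => by simp [hsg]⟩,
      by simp [hempty], by simp, by simp, by simp⟩
    rw [hempty]
    refine ⟨⟨?_, ?_, ?_⟩, ⟨?_, ?_, ?_⟩, ?_, ?_, ?_, ?_, ?_, ?_, ?_, ?_, ?_⟩ <;> simp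
  obtain ⟨τ, g, eτ, hnot, ⟨Ds, -, hS, -, hM⟩⟩ := Exec.loop (s := s)
    (b := .natLE (.lit 1) (.var vFound)) (σ := σ') (P := .seq (.seq scaleWalks assign) findMin)
    X.m hm (fun f τ => ∃ Ds, ((Finset.range X.m).filter fun q => τ.nat aAs q = 0).card ≤ f ∧
      Scaled X r Ds τ ∧ τ.nat vR 0 = r ∧ IsMin X (τ.nat aAs) X.m τ)
    ⟨[], by simpa using Finset.card_filter_le (Finset.range X.m) fun q => σ'.nat aAs q = 0,
      hcongr h0 e'.unchanged, by rw [e'.unchanged.nat vR rfl, hvr],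
      by rw [e'.unchanged.nat aAs rfl]; exact hmin⟩ (by
    rintro f τ hτ ⟨Ds, hf, hS, hvr, hmin⟩ hfound
    have hfound : 1 ≤ τ.nat vFound 0 := hfound
    obtain ⟨-, hq₀, has₀, hD, hle⟩ := hmin.resolve_left (by omega)
    obtain ⟨ρ, eρ, hSρ, h1, h2⟩ := scaleStep_spec (s := s) hS hn hm hr hrs hvr rfl hq₀ has₀ hD
      (fun q hq h => hD ▸ hle q hq h)
    obtain ⟨κ, eκ, hmin'⟩ := findMin_spec (s := s) hSρ.base hm
    have hasκ : κ.nat aAs = ρ.nat aAs := eκ.unchanged.nat aAs rfl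
    have hlt : ((Finset.range X.m).filter fun q => κ.nat aAs q = 0).card <
        ((Finset.range X.m).filter fun q => τ.nat aAs q = 0).card := by
      refine Finset.card_lt_card (Finset.ssubset_iff_of_subset ?_ |>.2 ⟨τ.nat vBq 0, ?_, ?_⟩)
      · intro q hq
        rw [Finset.mem_filter] at hq ⊢
        exact ⟨hq.1, h1 q (hasκ ▸ hq.2)⟩
      · simp [hq₀, has₀]
      · simp [hasκ, h2]
    exact ⟨_, κ, hlt.trans_le hf, eρ.seq eκ, _, le_rfl, hcongr hSρ eκ.unchanged,
      by rw [eκ.unchanged.nat vR rfl, eρ.unchanged.nat vR rfl, hvr], by rw [hasκ]; exact hmin'⟩)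
  refine ⟨τ, Ds, e'.seq eτ, hS, ?_⟩
  rcases hM with ⟨-, h⟩ | ⟨h, -⟩
  · exact h
  · simp [Test.Holds, NExp.eval, h] at hnot

/-! ### Forming loads on the machine -/

notation "aLdr" => 39
notation "aNum" => 40
notation "vB" => 41
notation "vLd" => 42
notation "vX" => 43
notation "vTar" => 44
notation "vSq" => 45

/-- The first `k` requests are partitioned into loads of at most `cap` requests with the same key.
The leader of a load is its first request. Of the loads with the same key all but the last one are
full. -/
structure Loads (key : ℕ → ℕ × ℕ) (cap k : ℕ) (ldr : ℕ → ℕ) : Prop where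
  le : ∀ q < k, ldr q ≤ q
  idem : ∀ q < k, ldr (ldr q) = ldr q
  key_eq : ∀ q < k, key (ldr q) = key q
  card_le : ∀ a, ((Finset.range k).filter fun q => ldr q = a).card ≤ cap
  full : ∀ a b, a < b → b < k → ldr a = a → ldr b = b → key a = key b →
    ((Finset.range k).filter fun q => ldr q = a).card = cap

theorem card_filter_range_succ (k : ℕ) (f g : ℕ → ℕ) (h : ∀ q < k, g q = f q) (a : ℕ) :
    ((Finset.range (k + 1)).filter fun q => g q = a).card =
      ((Finset.range k).filter fun q => f q = a).card + if g k = a then 1 else 0 := by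
  have : ((Finset.range k).filter fun q => g q = a) = (Finset.range k).filter fun q => f q = a :=
    Finset.filter_congr fun q hq => by rw [h q (Finset.mem_range.1 hq)]
  rw [Finset.range_add_one, Finset.filter_insert, this]
  split_ifs with h1
  · rw [Finset.card_insert_of_notMem (by simp)]
  · simp

/-- The next request opens a new load if all loads with its key are full, and otherwise joins a load
that is not full. -/
theorem Loads.succ {key : ℕ → ℕ × ℕ} {cap k : ℕ} {ldr ldr' : ℕ → ℕ} (h : Loads key cap k ldr)
    (hcap : 0 < cap) (hl : ∀ q < k, ldr' q = ldr q)
    (hk : (ldr' k = k ∧ ∀ a < k, ldr a = a → key a = key k →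
        ((Finset.range k).filter fun q => ldr q = a).card = cap) ∨
      (ldr' k < k ∧ ldr (ldr' k) = ldr' k ∧ key (ldr' k) = key k ∧
        ((Finset.range k).filter fun q => ldr q = ldr' k).card < cap)) :
    Loads key cap (k + 1) ldr' := by
  have hcard := card_filter_range_succ k ldr ldr' hl
  have h0 : ((Finset.range k).filter fun q => ldr q = k).card = 0 := by
    rw [Finset.card_eq_zero, Finset.filter_eq_empty_iff]
    intro q hq
    have := Finset.mem_range.1 hq
    have := h.le q this
    omega
  have hlt : ∀ q, q < k + 1 → q < k ∨ q = k := fun q hq => by omega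
  refine ⟨fun q hq => ?_, fun q hq => ?_, fun q hq => ?_, fun a => ?_,
    fun a b hab hb ha hb' hkey => ?_⟩
  · rcases hlt q hq with hq | rfl
    · rw [hl q hq]; exact h.le q hq
    · omega
  · rcases hlt q hq with hq | rfl
    · have := h.le q hq
      rw [hl q hq, hl _ (by omega)]; exact h.idem q hq
    · rcases hk with ⟨h1, -⟩ | ⟨h1, h2, -⟩
      · rw [h1, h1]
      · rw [hl _ h1, h2]
  · rcases hlt q hq with hq | rfl
    · rw [hl q hq]; exact h.key_eq q hq
    · rcases hk with ⟨h1, -⟩ | ⟨-, -, h2, -⟩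
      · rw [h1]
      · exact h2
  · rw [hcard]
    by_cases ha : ldr' k = a
    · subst ha
      rcases hk with ⟨h1, -⟩ | ⟨-, -, -, h2⟩
      · rw [h1, h0]; simp; omega
      · simp; omega
    · simpa [ha] using h.card_le a
  · have hne : ldr' k ≠ a := by
      intro he
      rcases hk with ⟨h1, -⟩ | ⟨h1, -, h2, h3⟩
      · omega
      · rcases hlt b hb with hbk | rfl
        · rw [hl a (by omega)] at ha
          rw [hl b hbk] at hb'
          have := h.full a b hab hbk ha hb' hkey
          rw [he] at h3
          omega
        · omega
    rw [hcard, if_neg hne, add_zero]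
    rw [hl a (by omega)] at ha
    rcases hlt b hb with hbk | rfl
    · rw [hl b hbk] at hb'
      exact h.full a b hab hbk ha hb' hkey
    · rcases hk with ⟨-, h2⟩ | ⟨h1, -⟩
      · exact h2 a hab ha hkey
      · omega

/-- Run `P` if the values of `e` and `f` are equal. -/
def Program.ifEq (e f : NExp) (P : Program) : Program :=
  .ite (.natLE e f) (.ite (.natLE f e) P .skip) .skip

theorem Exec.ifEq {s : ℕ} {e f : NExp} {P : Program} {σ τ : Memory}
    (h1 : e.eval σ = f.eval σ → Exec s P σ τ) (h2 : e.eval σ ≠ f.eval σ → τ = σ) :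
    Exec s (.ifEq e f P) σ τ := by
  rcases lt_trichotomy (e.eval σ) (f.eval σ) with h | h | h
  · rw [h2 h.ne]
    exact .ite_true h.le (.ite_false (not_le.2 h) .skip)
  · exact .ite_true h.le (.ite_true h.ge (h1 h))
  · rw [h2 h.ne']
    exact .ite_false (not_le.2 h) .skip

/-- If the load with the leader `vB` can take up the request `vQ`, remember this in `vLd`. -/
def tryLoad : Program :=
  .ifEq (.cell aKS (.var vB)) (.cell aKS (.var vQ))
    (.ifEq (.cell aKT (.var vB)) (.cell aKT (.var vQ))
      (.ifEq (.cell aLdr (.var vB)) (.var vB)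
        (.ite (.natLE (.add (.cell aNum (.var vB)) (.lit 1)) (.cell 0 (.lit 3)))
          (.setNat vLd (.lit 0) (.var vB)) .skip)))

/-- Find the leader of the load of the request `vQ`. -/
def findLoad : Program :=
  .seq (.setNat vLd (.lit 0) (.var vQ)) (.forLoop vB (.var vQ) tryLoad)

/-- Partition the requests into loads. -/
def loads : Program :=
  .forLoop vQ (.cell 0 (.lit 2)) (.seq findLoad (.seq (.setNat aLdr (.var vQ) (.var vLd))
    (.setNat aNum (.var vLd) (.add (.cell aNum (.var vLd)) (.lit 1)))))

/-- The numbers of the two segments of a request. -/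
def segKey (τ : Memory) (q : ℕ) : ℕ × ℕ := (τ.nat aKS q, τ.nat aKT q)

theorem findLoad_spec {X : Data} {s q : ℕ} {σ : Memory} (hB : Base X σ) (hqs : q ≤ s)
    (hvq : σ.nat vQ 0 = q) :
    ∃ τ, Exec s findLoad σ τ ∧
      ((τ.nat vLd 0 = q ∧ ∀ a < q, ¬ (segKey σ a = segKey σ q ∧ σ.nat aLdr a = a ∧
        σ.nat aNum a < X.cap)) ∨ (τ.nat vLd 0 < q ∧ segKey σ (τ.nat vLd 0) = segKey σ q ∧
        σ.nat aLdr (τ.nat vLd 0) = τ.nat vLd 0 ∧ σ.nat aNum (τ.nat vLd 0) < X.cap)) := by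
  obtain ⟨τ, hτ, hi, -⟩ := Exec.forLoop (s := s) (σ := σ.setNat vLd 0 q) (i := vB)
    (N := .var vQ) (P := tryLoad) q hqs
    (fun k τ => (τ.nat vLd 0 = q ∧ ∀ a < k, ¬ (segKey σ a = segKey σ q ∧ σ.nat aLdr a = a ∧
        σ.nat aNum a < X.cap)) ∨ (τ.nat vLd 0 < k ∧ segKey σ (τ.nat vLd 0) = segKey σ q ∧
        σ.nat aLdr (τ.nat vLd 0) = τ.nat vLd 0 ∧ σ.nat aNum (τ.nat vLd 0) < X.cap)) rfl
    (.inl ⟨by simp, by simp⟩)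
    (fun τ hτ => by simpa [NExp.eval, hτ.nat vQ rfl] using hvq)
    (by
      intro b hb τ hτ hvb hi
      have h1 : τ.nat aKS = σ.nat aKS := by simpa using hτ.nat aKS rfl
      have h2 : τ.nat aKT = σ.nat aKT := by simpa using hτ.nat aKT rfl
      have h3 : τ.nat aLdr = σ.nat aLdr := by simpa using hτ.nat aLdr rfl
      have h4 : τ.nat aNum = σ.nat aNum := by simpa using hτ.nat aNum rfl
      have h5 : τ.nat 0 3 = X.cap := by rw [hτ.nat 0 rfl]; simpa using hB.cap
      have h6 : τ.nat vQ 0 = q := by rw [hτ.nat vQ rfl]; simpa using hvq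
      by_cases hc : segKey σ b = segKey σ q ∧ σ.nat aLdr b = b ∧ σ.nat aNum b < X.cap
      · refine ⟨τ.setNat vLd 0 b, ?_, .inr (by simpa [segKey] using hc)⟩
        have hkey := hc.1
        simp only [segKey, Prod.mk.injEq] at hkey
        refine Exec.ifEq
          (fun _ => Exec.ifEq (fun _ => Exec.ifEq (fun _ => .ite_true ?_ ?_) ?_) ?_) ?_
        · simpa [Test.Holds, NExp.eval, hvb, h4, h5] using hc.2.2
        · simpa [NExp.eval, hvb] using Exec.setNat (s := s) (σ := τ) (a := vLd) (i := .lit 0)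
            (e := .var vB)
        · intro h; simp [NExp.eval, hvb, h3, hc.2.1] at h
        · intro h; simp [NExp.eval, hvb, h2, h6, hkey.2] at h
        · intro h; simp [NExp.eval, hvb, h1, h6, hkey.1] at h
      · refine ⟨τ, ?_, ?_⟩
        · refine Exec.ifEq (fun g1 => Exec.ifEq (fun g2 => Exec.ifEq (fun g3 => .ite_false ?_ .skip)
            fun _ => rfl) fun _ => rfl) fun _ => rfl
          simp only [NExp.eval, hvb, h1, h6, h2, h3] at g1 g2 g3
          have : ¬ σ.nat aNum b < X.cap := fun h => hc ⟨by simp [segKey, g1, g2], g3, h⟩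
          simpa [Test.Holds, NExp.eval, hvb, h4, h5] using this
        · rcases hi with ⟨g1, g2⟩ | ⟨g1, g2⟩
          · refine .inl ⟨by simpa using g1, fun a ha => ?_⟩
            rcases (show a < b ∨ a = b by omega) with h | rfl
            · exact g2 a h
            · exact hc
          · exact .inr ⟨by simp; omega, by simpa using g2⟩)
  refine ⟨τ, Exec.seq (τ := σ.setNat vLd 0 q) ?_ hτ, hi⟩
  simpa [NExp.eval, hvq] using Exec.setNat (s := s) (σ := σ) (a := vLd) (i := .lit 0)
    (e := .var vQ)

theorem loads_spec {X : Data} {s : ℕ} {σ : Memory} (hB : Base X σ) (hm : X.m ≤ s)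
    (h0 : ∀ q, σ.nat aNum q = 0) :
    ∃ τ, Exec s loads σ τ ∧ Loads (segKey σ) X.cap X.m (τ.nat aLdr) := by
  obtain ⟨τ, hτ, ⟨hi, -⟩, -⟩ := Exec.forLoop (s := s) (σ := σ) (i := vQ)
    (N := .cell 0 (.lit 2)) (P := .seq findLoad (.seq (.setNat aLdr (.var vQ) (.var vLd))
      (.setNat aNum (.var vLd) (.add (.cell aNum (.var vLd)) (.lit 1))))) X.m hm
    (fun k τ => Loads (segKey σ) X.cap k (τ.nat aLdr) ∧
      ∀ a, τ.nat aNum a = ((Finset.range k).filter fun q => τ.nat aLdr q = a).card) rfl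
    ⟨by constructor <;> simp, by simp [h0]⟩
    (fun τ hτ => by simpa [NExp.eval, hτ.nat 0 rfl] using hB.m)
    (by
      rintro q hq τ hτ hvq ⟨hL, hnum⟩
      obtain ⟨ρ, hρ, hfind⟩ := findLoad_spec (s := s) (hB.unchanged hτ rfl) (by omega) hvq
      have hkey : segKey τ = segKey σ := by
        ext1 q; simp only [segKey, hτ.nat aKS rfl, hτ.nat aKT rfl]
      have hU := hρ.unchanged
      have h1 : ρ.nat vQ 0 = q := by rw [hU.nat vQ rfl, hvq]
      have h2 : ρ.nat aLdr = τ.nat aLdr := hU.nat aLdr rfl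
      have h3 : ρ.nat aNum = τ.nat aNum := hU.nat aNum rfl
      rw [hkey] at hfind
      simp only [hnum] at hfind
      set a := ρ.nat vLd 0 with ha
      have hex := hρ.seq ((Exec.setNat (s := s) (σ := ρ) (a := aLdr) (i := .var vQ)
        (e := .var vLd)).seq (Exec.setNat (a := aNum) (i := .var vLd)
          (e := .add (.cell aNum (.var vLd)) (.lit 1))))
      have hlit : (((ρ.setNat aLdr (NExp.eval ρ (.var vQ)) (NExp.eval ρ (.var vLd)))).setNat aNum
          (NExp.eval (ρ.setNat aLdr (NExp.eval ρ (.var vQ)) (NExp.eval ρ (.var vLd))) (.var vLd))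
          (NExp.eval (ρ.setNat aLdr (NExp.eval ρ (.var vQ)) (NExp.eval ρ (.var vLd)))
            (.add (.cell aNum (.var vLd)) (.lit 1)))) =
          (ρ.setNat aLdr q a).setNat aNum a (τ.nat aNum a + 1) := by
        simp [NExp.eval, h1, ← ha, h3]
      rw [hlit] at hex
      refine ⟨_, hex, ?_, fun b => ?_⟩
      · have : ((((ρ.setNat aLdr q a).setNat aNum a (τ.nat aNum a + 1)).setNat vQ 0 (q + 1)).nat
            aLdr) = Function.update (τ.nat aLdr) q a := by simp [h2]
        rw [this]
        refine hL.succ X.cap_pos (fun q' hq' => Function.update_of_ne (by omega) _ _) ?_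
        rw [Function.update_self]
        rcases hfind with ⟨g1, g2⟩ | g
        · refine .inl ⟨g1, fun b hb hb1 hb2 => ?_⟩
          by_contra hne
          exact g2 b hb ⟨hb2, hb1, lt_of_le_of_ne (hL.card_le b) hne⟩
        · exact .inr ⟨g.1, g.2.2.1, g.2.1, g.2.2.2⟩
      · have : ((((ρ.setNat aLdr q a).setNat aNum a (τ.nat aNum a + 1)).setNat vQ 0 (q + 1)).nat
            aLdr) = Function.update (τ.nat aLdr) q a := by simp [h2]
        rw [this, card_filter_range_succ q (τ.nat aLdr) _
          (fun q' hq' => Function.update_of_ne (by omega) _ _), Function.update_self]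
        by_cases hb : a = b
        · subst hb; simp [hnum]
        · simp [hb, Function.update_of_ne (Ne.symm hb), h3, hnum])
  exact ⟨τ, hτ, hi⟩

/-! ### The order of the loads and the output on the machine -/

/-- Mark the sources of all requests. -/
def markSources : Program :=
  .seq (.forLoop vI (.cell 0 (.lit 0)) (.setNat aNeed (.var vI) (.lit 0)))
    (.forLoop vQ (.cell 0 (.lit 2)) (.setNat aNeed (.cell 2 (.var vQ)) (.lit 1)))

/-- Start a walk at the location of each vehicle. -/
def startDepots : Program :=
  .seq (.forLoop vI (.cell 0 (.lit 1)) (.seq (.setNat aLoc (.var vI) (.cell 1 (.var vI)))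
      (.seq (.setNat aTag (.var vI) (.var vI)) (.setNat aNeed (.cell 1 (.var vI)) (.lit 0)))))
    (.setNat vCnt (.lit 0) (.cell 0 (.lit 1)))

/-- Connect the sources of all requests to the locations of the vehicles by walks that start at the
vehicles; the tag of a vertex is its vehicle. -/
def depotWalks : Program :=
  .seq markSources (.seq startDepots (.seq (prim (.natLE (.lit 0) (.lit 0))) label))

/-- The locations of the vehicles, with the numbers of the vehicles as tags. -/
def Data.depots (X : Data) : List (ℕ × ℕ) := (List.range X.h).map fun k => (X.depot k, k)

/-- The sources that are not the location of a vehicle. -/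
def Data.freeSources (X : Data) : Finset ℕ :=
  (Finset.range X.m).image X.src \ (Finset.range X.h).image X.depot

theorem markSources_spec {X : Data} {s : ℕ} {σ : Memory} (hB : Base X σ) (hn : X.n ≤ s)
    (hm : X.m ≤ s) :
    ∃ τ, Exec s markSources σ τ ∧
      ∀ u < X.n, 1 ≤ τ.nat aNeed u ↔ u ∈ (Finset.range X.m).image X.src := by
  obtain ⟨σ₁, e₁, h₁⟩ := clear_spec (s := s) hB.n hn
  have hB₁ := hB.unchanged e₁.unchanged rfl
  obtain ⟨σ₂, e₂, h₂, -⟩ := Exec.forLoop (s := s) (σ := σ₁) (i := vQ) (N := .cell 0 (.lit 2))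
    (P := .setNat aNeed (.cell 2 (.var vQ)) (.lit 1)) X.m hm
    (fun k τ => ∀ u < X.n, 1 ≤ τ.nat aNeed u ↔ u ∈ (Finset.range k).image X.src) rfl
    (fun u hu => by simp [h₁ u hu])
    (fun τ hτ => by simpa [NExp.eval, hτ.nat 0 rfl] using hB₁.m)
    (by
      intro q hq τ hτ hvq hi
      have hBτ := hB₁.unchanged hτ rfl
      refine ⟨_, Exec.setNat, fun u hu => ?_⟩
      simp only [NExp.eval, ne_eq, Nat.reduceEqDiff, not_false_eq_true, Memory.setNat_nat_ne,
        Memory.setNat_nat_self, hvq, hBτ.src q hq]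
      rw [Finset.range_add_one, Finset.image_insert, Finset.mem_insert]
      by_cases h : u = X.src q
      · simp [h]
      · rw [Function.update_of_ne h, hi u hu]
        simp [h])
  exact ⟨σ₂, e₁.seq e₂, h₂⟩

theorem startDepots_spec {X : Data} {s : ℕ} {σ : Memory} (hB : Base X σ) (hh : X.h ≤ s)
    (hσ : ∀ u < X.n, 1 ≤ σ.nat aNeed u ↔ u ∈ (Finset.range X.m).image X.src) :
    ∃ τ, Exec s startDepots σ τ ∧ HoldsList X.depots τ ∧
      HoldsSet X.n X.freeSources τ := by
  obtain ⟨τ, e, ⟨h1, h2⟩, hU⟩ := Exec.forLoop (s := s) (σ := σ) (i := vI) (N := .cell 0 (.lit 1))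
    (P := .seq (.setNat aLoc (.var vI) (.cell 1 (.var vI)))
      (.seq (.setNat aTag (.var vI) (.var vI)) (.setNat aNeed (.cell 1 (.var vI)) (.lit 0)))) X.h hh
    (fun k τ => (∀ j < k, τ.nat aLoc j = X.depot j ∧ τ.nat aTag j = j) ∧
      ∀ u < X.n, 1 ≤ τ.nat aNeed u ↔
        u ∈ (Finset.range X.m).image X.src \ (Finset.range k).image X.depot) rfl
    ⟨by simp, fun u hu => by simpa using hσ u hu⟩
    (fun τ hτ => by simpa [NExp.eval, hτ.nat 0 rfl] using hB.h)
    (by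
      rintro k hk τ hτ hvk ⟨h1, h2⟩
      have hBτ := hB.unchanged hτ rfl
      refine ⟨_, Exec.setNat.seq (Exec.setNat.seq Exec.setNat), fun j hj => ?_, fun u hu => ?_⟩
      · simp only [NExp.eval, ne_eq, Nat.reduceEqDiff, not_false_eq_true, Memory.setNat_nat_ne,
          Memory.setNat_nat_self, hvk, hBτ.depot k hk]
        by_cases h : j = k
        · simp [h]
        · rw [Function.update_of_ne h, Function.update_of_ne h]
          exact h1 j (by omega)
      · simp only [NExp.eval, ne_eq, Nat.reduceEqDiff, not_false_eq_true, Memory.setNat_nat_ne,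
          Memory.setNat_nat_self, hvk, hBτ.depot k hk]
        rw [Finset.range_add_one, Finset.image_insert, Finset.mem_sdiff, Finset.mem_insert]
        by_cases h : u = X.depot k
        · simp [h]
        · rw [Function.update_of_ne h, h2 u hu, Finset.mem_sdiff]
          simp [h])
  refine ⟨_, e.seq Exec.setNat, ⟨?_, fun j p hp => ?_⟩, ?_, fun u hu => ?_⟩
  · have : τ.nat 0 1 = X.h := by rw [hU.nat 0 rfl, hB.h]
    simp [NExp.eval, Data.depots, this]
  · simp only [Data.depots, List.getElem?_map, Option.map_eq_some_iff] at hp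
    obtain ⟨i, hi, rfl⟩ := hp
    obtain ⟨hi', rfl⟩ := List.getElem?_eq_some_iff.1 hi
    simp at hi'
    simpa using h1 j hi'
  · intro u hu
    simp only [Data.freeSources, Finset.mem_sdiff, Finset.mem_image] at hu
    obtain ⟨⟨q, -, rfl⟩, -⟩ := hu
    exact Finset.mem_range.2 (X.src_lt q)
  · simpa [Data.freeSources] using h2 u hu

theorem depotWalks_spec {X : Data} {s : ℕ} {σ : Memory} (hB : Base X σ) (hs : X.size ≤ s) :
    ∃ τ L lim W, Exec s depotWalks σ τ ∧ (∀ u < X.n, ∀ v < X.n, X.d u v ≤ lim) ∧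
      Prim X.d lim X.depots X.freeSources L ∅ W ∧ HoldsList L τ ∧
      (∀ q < X.m, PosOk τ (X.src q)) ∧ L.length ≤ s := by
  simp only [Data.size] at hs
  obtain ⟨σ₁, e₁, h₁⟩ := markSources_spec (s := s) hB (by omega) (by omega)
  have hB₁ := hB.unchanged e₁.unchanged rfl
  obtain ⟨σ₂, e₂, hL₂, hK₂⟩ := startDepots_spec (s := s) hB₁ (by omega) h₁
  have hB₂ := hB₁.unchanged e₂.unchanged rfl
  obtain ⟨lim, hlim⟩ : ∃ lim, ∀ u < X.n, ∀ v < X.n, X.d u v ≤ lim := by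
    refine ⟨∑ u ∈ Finset.range X.n, ∑ v ∈ Finset.range X.n, X.d u v, fun u hu v hv => ?_⟩
    refine (Finset.single_le_sum (f := fun v => X.d u v) (fun v _ => X.metric.nonneg u v)
      (Finset.mem_range.2 hv)).trans ?_
    exact Finset.single_le_sum (f := fun u => ∑ v ∈ Finset.range X.n, X.d u v)
      (fun u _ => Finset.sum_nonneg fun v _ => X.metric.nonneg u v) (Finset.mem_range.2 hu)
  have hcard : X.freeSources.card ≤ X.n := by
    simpa using Finset.card_le_card hK₂.1
  have hlen : X.depots.length = X.h := by simp [Data.depots]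
  have hdn : ∀ p ∈ X.depots, p.1 < X.n := by
    simp only [Data.depots, List.mem_map, forall_exists_index, and_imp]
    rintro p k - rfl
    exact X.depot_lt k
  obtain ⟨σ₃, L, W, e₃, hP, hL₃, -⟩ := prim_spec (s := s) (lim := lim)
    (b := .natLE (.lit 0) (.lit 0)) hB₂ hL₂ hK₂
    (by rw [← List.length_pos_iff, hlen]; exact X.h_pos) hdn (by omega) (by omega)
    (fun τ _ ⟨u, hu, v, hv, h⟩ => by simpa [Test.Holds, NExp.eval, h] using hlim u hu v hv)
  have hB₃ := hB₂.unchanged e₃.unchanged rfl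
  have hLlen := hP.length_add_card
  simp only [Finset.card_empty] at hLlen
  obtain ⟨τ, e₄, hpos, -⟩ := label_spec (s := s) hB₃ hL₃ (fun p hp => by
      rcases hP.mem_start (List.mem_map_of_mem (f := Prod.fst) hp) with h | h
      · obtain ⟨p', hp', h⟩ := List.mem_map.1 h
        exact h ▸ hdn p' hp'
      · exact Finset.mem_range.1 (hK₂.1 h))
    (hP.tag_lt (by simp [Data.depots])) (by omega) rfl
  refine ⟨τ, L, lim, W, e₁.seq (e₂.seq (e₃.seq e₄)), hlim, hP, hL₃.congr (e₄.unchanged.nat _ rfl)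
    (e₄.unchanged.nat _ rfl) (e₄.unchanged.nat _ rfl), fun q hq => hpos _ ?_, by omega⟩
  · by_cases h : X.src q ∈ (Finset.range X.h).image X.depot
    · obtain ⟨k, hk, hkq⟩ := Finset.mem_image.1 h
      rw [← hkq]
      refine List.mem_map_of_mem (f := Prod.fst) (hP.start_subset (p := (X.depot k, k)) ?_)
      exact List.mem_map_of_mem (List.mem_range.2 (Finset.mem_range.1 hk))
    · refine (hP.mem_or (v := X.src q) ?_).resolve_left (by simp)
      simp only [Data.freeSources, Finset.mem_sdiff, h, not_false_eq_true, and_true]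
      exact Finset.mem_image_of_mem _ (Finset.mem_range.2 hq)

/-- The routes are written into the output arrays; a stop consists of the vehicle, the kind and the
request. -/
structure Emitted (out : List (ℕ × ℕ × ℕ)) (σ : Memory) : Prop where
  count : σ.nat 4 0 = out.length
  get : ∀ j p, out[j]? = some p → (σ.nat 5 j, σ.nat 6 j, σ.nat 7 j) = p

theorem Emitted.congr {out : List (ℕ × ℕ × ℕ)} {σ τ : Memory} (h : Emitted out σ)
    (h4 : τ.nat 4 = σ.nat 4) (h5 : τ.nat 5 = σ.nat 5) (h6 : τ.nat 6 = σ.nat 6)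
    (h7 : τ.nat 7 = σ.nat 7) : Emitted out τ :=
  ⟨by rw [h4, h.count], by rw [h5, h6, h7]; exact h.get⟩

/-- Write one stop, of the given kind and for the request `vQ`. -/
def emit (kind : ℕ) : Program :=
  .seq (.setNat 5 (.var 4) (.cell aTag (.var vJ))) (.seq (.setNat 6 (.var 4) (.lit kind))
    (.seq (.setNat 7 (.var 4) (.var vQ)) (.setNat 4 (.lit 0) (.add (.var 4) (.lit 1)))))

theorem emit_spec {s kind : ℕ} {σ : Memory} {out : List (ℕ × ℕ × ℕ)} (h : Emitted out σ) :
    ∃ τ, Exec s (emit kind) σ τ ∧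
      Emitted (out ++ [(σ.nat aTag (σ.nat vJ 0), kind, σ.nat vQ 0)]) τ := by
  refine ⟨_, Exec.setNat.seq (Exec.setNat.seq (Exec.setNat.seq Exec.setNat)), ?_, fun j p hp => ?_⟩
  · simp [NExp.eval, h.count]
  · simp only [NExp.eval, ne_eq, Nat.reduceEqDiff, not_false_eq_true, Memory.setNat_nat_ne,
      Memory.setNat_nat_self, h.count]
    by_cases hj : j < out.length
    · rw [List.getElem?_append_left hj] at hp
      rw [Function.update_of_ne hj.ne, Function.update_of_ne hj.ne, Function.update_of_ne hj.ne]
      exact h.get j p hp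
    · rw [List.getElem?_append_right (not_lt.1 hj)] at hp
      have hj' : j = out.length := by
        have := (List.getElem?_eq_some_iff.1 hp).1
        simp at this
        omega
      subst hj'
      simp at hp
      simp [← hp]

theorem Emitted.forLoop {s i : ℕ} {N : NExp} {P : Program} {σ : Memory}
    {out : List (ℕ × ℕ × ℕ)} (h : Emitted out σ) (k : ℕ) (hk : k ≤ s) (g : ℕ → List (ℕ × ℕ × ℕ))
    (hi : P.writesNat i = false) (hi7 : 7 < i)
    (hN : ∀ τ, Unchanged (.forLoop i N P) σ τ → N.eval τ = k)
    (step : ∀ j < k, ∀ τ out, Unchanged (.forLoop i N P) σ τ → τ.nat i 0 = j → Emitted out τ →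
      ∃ ρ, Exec s P τ ρ ∧ Emitted (out ++ g j) ρ) :
    ∃ τ, Exec s (.forLoop i N P) σ τ ∧ Emitted (out ++ (List.range k).flatMap g) τ := by
  have hset : ∀ {out : List (ℕ × ℕ × ℕ)} {τ : Memory} {v : ℕ}, Emitted out τ →
      Emitted out (τ.setNat i 0 v) := fun h =>
    h.congr (Memory.setNat_nat_ne _ _ _ _ _ (by omega)) (Memory.setNat_nat_ne _ _ _ _ _ (by omega))
      (Memory.setNat_nat_ne _ _ _ _ _ (by omega)) (Memory.setNat_nat_ne _ _ _ _ _ (by omega))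
  obtain ⟨τ, e, h1, -⟩ := Exec.forLoop (s := s) (σ := σ) (i := i) (N := N) (P := P) k hk
    (fun j τ => Emitted (out ++ (List.range j).flatMap g) τ) hi (by simpa using hset h) hN
    (fun j hj τ hτ hvj hE => by
      obtain ⟨ρ, eρ, hρ⟩ := step j hj τ _ hτ hvj hE
      refine ⟨ρ, eρ, ?_⟩
      rw [List.range_succ, List.flatMap_append, ← List.append_assoc]
      simpa using hset hρ)
  exact ⟨τ, e, h1⟩

theorem Emitted.ifEq {s : ℕ} {e f : NExp} {P : Program} {σ : Memory} {x y : ℕ}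
    {out l : List (ℕ × ℕ × ℕ)} (h : Emitted out σ) (hx : e.eval σ = x) (hy : f.eval σ = y)
    (hP : x = y → ∃ τ, Exec s P σ τ ∧ Emitted (out ++ l) τ) :
    ∃ τ, Exec s (.ifEq e f P) σ τ ∧ Emitted (out ++ if x = y then l else []) τ := by
  by_cases hxy : x = y
  · obtain ⟨τ, hτ, h'⟩ := hP hxy
    exact ⟨τ, .ifEq (fun _ => hτ) (fun hne => absurd (hx.trans (hxy.trans hy.symm)) hne),
      by simpa [hxy] using h'⟩
  · exact ⟨σ, .ifEq (fun he => absurd (hx.symm.trans (he.trans hy)) hxy) fun _ => rfl,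
      by simpa [hxy] using h⟩

/-- Write the stops of one kind for the load with the leader `vI`, in the order of the array `p`. -/
def emitHalf (p kind : ℕ) : Program :=
  .forLoop vC (.cell 0 (.lit 0)) (.forLoop vQ (.cell 0 (.lit 2))
    (.ifEq (.cell aLdr (.var vQ)) (.var vI) (.ifEq (.cell p (.var vQ)) (.var vC) (emit kind))))

/-- Write the routes: the loads follow the order of the walks that start at the vehicles. -/
def emitAll : Program :=
  .forLoop vJ (.var vCnt) (.forLoop vI (.cell 0 (.lit 2))
    (.ifEq (.cell aLdr (.var vI)) (.var vI)
      (.ifEq (.cell aPos (.cell 2 (.var vI))) (.var vJ)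
        (.seq (emitHalf aPS 0) (emitHalf aPT 1)))))

/-- The stops of one kind of the vehicle `k` for the load with the leader `a`, in the order of
`p`. -/
def halfTour (n m : ℕ) (ldr p : ℕ → ℕ) (kind a k : ℕ) : List (ℕ × ℕ × ℕ) :=
  (List.range n).flatMap fun c => (List.range m).flatMap fun q =>
    if ldr q = a then if p q = c then [(k, kind, q)] else [] else []

/-- The tour for the load with the leader `a`: all pick-ups, then all deliveries. -/
def loadTour (n m : ℕ) (ldr p p' : ℕ → ℕ) (a k : ℕ) : List (ℕ × ℕ × ℕ) :=
  halfTour n m ldr p 0 a k ++ halfTour n m ldr p' 1 a k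

/-- All tours, in the order of the positions `pos` of the sources of the leaders. -/
def allTours (X : Data) (ldr p p' pos tag : ℕ → ℕ) (cnt : ℕ) : List (ℕ × ℕ × ℕ) :=
  (List.range cnt).flatMap fun j => (List.range X.m).flatMap fun a =>
    if ldr a = a then if pos (X.src a) = j then loadTour X.n X.m ldr p p' a (tag j) else [] else []

theorem emitHalf_spec {X : Data} {s p kind j a : ℕ} {σ : Memory} {out : List (ℕ × ℕ × ℕ)}
    (hB : Base X σ) (hn : X.n ≤ s) (hm : X.m ≤ s) (h : Emitted out σ) (hj : σ.nat vJ 0 = j)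
    (ha : σ.nat vI 0 = a) (hp : (emitHalf p kind).writesNat p = false) :
    ∃ τ, Exec s (emitHalf p kind) σ τ ∧
      Emitted (out ++ halfTour X.n X.m (σ.nat aLdr) (σ.nat p) kind a (σ.nat aTag j)) τ := by
  refine h.forLoop X.n hn _ rfl (by norm_num)
    (fun τ hτ => by simpa [NExp.eval, hτ.nat 0 rfl] using hB.n) fun c hc τ out hτ hvc hE => ?_
  refine hE.forLoop X.m hm _ rfl (by norm_num)
    (fun ρ hρ => by simpa [NExp.eval, hρ.nat 0 rfl, hτ.nat 0 rfl] using hB.m)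
    fun q hq ρ out hρ hvq hE => ?_
  have hτp : τ.nat p = σ.nat p := hτ.nat p hp
  have hρp : ρ.nat p = τ.nat p := hρ.nat p (by
    simp only [emitHalf, Program.forLoop, Program.writesNat, Bool.or_eq_false_iff] at hp ⊢
    tauto)
  refine hE.ifEq (by simp [NExp.eval, hvq, hρ.nat aLdr rfl, hτ.nat aLdr rfl])
    (by simp [NExp.eval, hρ.nat vI rfl, hτ.nat vI rfl, ha]) fun _ => ?_
  refine hE.ifEq (by simp [NExp.eval, hvq, hρp, hτp])
    (by simp [NExp.eval, hρ.nat vC rfl, hvc]) fun _ => ?_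
  have := emit_spec (s := s) (kind := kind) hE
  rwa [hvq, hρ.nat aTag rfl, hρ.nat vJ rfl, hτ.nat aTag rfl, hτ.nat vJ rfl, hj] at this

theorem emitAll_spec {X : Data} {s : ℕ} {σ : Memory} (hB : Base X σ) (hn : X.n ≤ s) (hm : X.m ≤ s)
    (hc : σ.nat vCnt 0 ≤ s) (h0 : σ.nat 4 0 = 0) :
    ∃ τ, Exec s emitAll σ τ ∧ Emitted (allTours X (σ.nat aLdr) (σ.nat aPS) (σ.nat aPT) (σ.nat aPos)
      (σ.nat aTag) (σ.nat vCnt 0)) τ := by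
  have hE : Emitted [] σ := ⟨by simpa using h0, by simp⟩
  rw [← List.nil_append (allTours _ _ _ _ _ _ _)]
  refine hE.forLoop _ hc _ rfl (by norm_num)
    (fun τ hτ => by simp [NExp.eval, hτ.nat vCnt rfl]) fun j hj τ out hτ hvj hE => ?_
  have hBτ := hB.unchanged hτ rfl
  refine hE.forLoop X.m hm _ rfl (by norm_num)
    (fun ρ hρ => by simpa [NExp.eval, hρ.nat 0 rfl] using hBτ.m) fun a ha ρ out hρ hva hE => ?_
  have hBρ := hBτ.unchanged hρ rfl
  have hvj' : ρ.nat vJ 0 = j := by rw [hρ.nat vJ rfl, hvj]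
  refine hE.ifEq (by simp [NExp.eval, hva, hρ.nat aLdr rfl, hτ.nat aLdr rfl])
    (by simp [NExp.eval, hva]) fun _ => ?_
  refine hE.ifEq (by simp [NExp.eval, hva, hρ.nat aPos rfl, hτ.nat aPos rfl, hBρ.src a ha])
    (by simp [NExp.eval, hvj']) fun _ => ?_
  obtain ⟨κ, e₁, h₁⟩ := emitHalf_spec (s := s) (p := aPS) (kind := 0) hBρ hn hm hE hvj' hva rfl
  have hU := e₁.unchanged
  obtain ⟨μ, e₂, h₂⟩ := emitHalf_spec (s := s) (p := aPT) (kind := 1) (hBρ.unchanged hU rfl) hn hm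
    h₁ (by rw [hU.nat vJ rfl, hvj']) (by rw [hU.nat vI rfl, hva]) rfl
  refine ⟨μ, e₁.seq e₂, ?_⟩
  rw [hU.nat aLdr rfl, hU.nat aPT rfl, hU.nat aTag rfl] at h₂
  rwa [hρ.nat aLdr rfl, hρ.nat aTag rfl, hρ.nat aPS rfl, hρ.nat aPT rfl, hτ.nat aLdr rfl,
    hτ.nat aTag rfl, hτ.nat aPS rfl, hτ.nat aPT rfl, List.append_assoc] at h₂

/-! ### The whole algorithm -/

/-- Compute the indices of the rows of the matrix. -/
def rows : Program :=
  .forLoop vI (.cell 0 (.lit 0)) (.seq (.setNat aRow (.var vI) (.var vX))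
    (.setNat vX (.lit 0) (.add (.var vX) (.cell 0 (.lit 0)))))

/-- Compute `n` times the logarithm of `n`, rounded up. -/
def target : Program :=
  .seq (.setNat vX (.lit 0) (.lit 1)) (.loop (.natLE (.add (.var vX) (.lit 1)) (.cell 0 (.lit 0)))
    (.seq (.setNat vX (.lit 0) (.add (.var vX) (.var vX)))
      (.setNat vTar (.lit 0) (.add (.var vTar) (.cell 0 (.lit 0))))))

/-- Compute the square root of the target, rounded up. -/
def root : Program :=
  .seq (.setNat vR (.lit 0) (.lit 1)) (.seq (.setNat vSq (.lit 0) (.lit 1))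
    (.loop (.natLE (.add (.var vSq) (.lit 1)) (.var vTar))
      (.seq (.setNat vSq (.lit 0) (.add (.var vSq) (.add (.var vR) (.add (.var vR) (.lit 1)))))
        (.setNat vR (.lit 0) (.add (.var vR) (.lit 1))))))

/-- The algorithm. -/
def algorithm : Program :=
  .seq rows (.seq target (.seq root (.seq scales (.seq loads (.seq depotWalks emitAll)))))

/-- The memory holds the instance, and the other cells of the natural arrays are `0`. -/
structure Input (X : Data) (σ : Memory) : Prop where
  n : σ.nat 0 0 = X.n
  h : σ.nat 0 1 = X.h
  m : σ.nat 0 2 = X.m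
  cap : σ.nat 0 3 = X.cap
  depot : ∀ k < X.h, σ.nat 1 k = X.depot k
  src : ∀ q < X.m, σ.nat 2 q = X.src q
  tgt : ∀ q < X.m, σ.nat 3 q = X.tgt q
  dist : ∀ u < X.n, ∀ v < X.n, σ.real 0 (u * X.n + v) = X.d u v
  zero : ∀ a > 3, ∀ i, σ.nat a i = 0

theorem rows_spec {X : Data} {s : ℕ} {σ : Memory} (hσ : Input X σ) (hn : X.n ≤ s) :
    ∃ τ, Exec s rows σ τ ∧ Base X τ := by
  obtain ⟨τ, e, ⟨hrow, -⟩, hU⟩ := Exec.forLoop (s := s) (σ := σ) (i := vI) (N := .cell 0 (.lit 0))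
    (P := .seq (.setNat aRow (.var vI) (.var vX))
      (.setNat vX (.lit 0) (.add (.var vX) (.cell 0 (.lit 0))))) X.n hn
    (fun k τ => (∀ u < k, τ.nat aRow u = u * X.n) ∧ τ.nat vX 0 = k * X.n) rfl
    ⟨by simp, by simpa using hσ.zero vX (by norm_num) 0⟩
    (fun τ hτ => by simpa [NExp.eval, hτ.nat 0 rfl] using hσ.n)
    (by
      rintro k hk τ hτ hvk ⟨h1, h2⟩
      have h0 : τ.nat 0 0 = X.n := by rw [hτ.nat 0 rfl, hσ.n]
      refine ⟨_, Exec.setNat.seq Exec.setNat, fun u hu => ?_, ?_⟩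
      · by_cases h : u = k
        · simp [NExp.eval, hvk, h, h2]
        · simpa [NExp.eval, hvk, h] using h1 u (by omega)
      · simp [NExp.eval, h2, h0]
        ring)
  refine ⟨τ, e, ?_⟩
  constructor
  · rw [hU.nat 0 rfl, hσ.n]
  · rw [hU.nat 0 rfl, hσ.h]
  · rw [hU.nat 0 rfl, hσ.m]
  · rw [hU.nat 0 rfl, hσ.cap]
  · rw [hU.nat 1 rfl]; exact hσ.depot
  · rw [hU.nat 2 rfl]; exact hσ.src
  · rw [hU.nat 3 rfl]; exact hσ.tgt
  · intro u hu v hv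
    rw [hU.real 0 rfl, hrow u hu]; exact hσ.dist u hu v hv

/-- The factor `Lg` is the logarithm of `n` to the base `2`, rounded up. -/
theorem target_spec {n s : ℕ} {σ : Memory} (hσ : σ.nat 0 0 = n) (hs : n ≤ s)
    (h0 : σ.nat vTar 0 = 0) :
    ∃ τ Lg, Exec s target σ τ ∧ τ.nat vTar 0 = n * Lg ∧ n ≤ 2 ^ Lg ∧
      (Lg = 0 ∨ 2 ^ (Lg - 1) < n) := by
  obtain ⟨τ, f, e, hnot, Lg, -, hx, ht, hlg, hn⟩ := Exec.loop (s := s) (σ := σ.setNat vX 0 1)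
    (b := .natLE (.add (.var vX) (.lit 1)) (.cell 0 (.lit 0)))
    (P := .seq (.setNat vX (.lit 0) (.add (.var vX) (.var vX)))
      (.setNat vTar (.lit 0) (.add (.var vTar) (.cell 0 (.lit 0))))) (n - 2 ^ 0) (by omega)
    (fun f τ => ∃ Lg, f = n - 2 ^ Lg ∧ τ.nat vX 0 = 2 ^ Lg ∧ τ.nat vTar 0 = n * Lg ∧
      (Lg = 0 ∨ 2 ^ (Lg - 1) < n) ∧ τ.nat 0 0 = n)
    ⟨0, rfl, by simp, by simpa using h0, .inl rfl, by simpa using hσ⟩ (by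
      rintro f τ hτ ⟨Lg, rfl, hx, ht, hlg, hn⟩ hlt
      simp only [Test.Holds, NExp.eval, hx, hn] at hlt
      refine ⟨_, _, ?_, Exec.setNat.seq Exec.setNat, Lg + 1, rfl, ?_, ?_, .inr (by simpa using hlt),
        ?_⟩
      · have := Nat.one_le_two_pow (n := Lg)
        rw [pow_succ]
        omega
      · simp [NExp.eval, hx]; ring
      · simp [NExp.eval, ht, hn]; ring
      · simpa using hn)
  refine ⟨τ, Lg, Exec.setNat.seq e, ht, ?_, hlg⟩
  simpa [Test.Holds, NExp.eval, hx, hn] using hnot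

theorem root_spec {t s : ℕ} {σ : Memory} (ht : σ.nat vTar 0 = t) (hs : 1 ≤ s)
    (hts : t ≤ s * s) :
    ∃ τ r, Exec s root σ τ ∧ τ.nat vR 0 = r ∧ 1 ≤ r ∧ r ≤ s ∧ t ≤ r * r ∧
      (r = 1 ∨ (r - 1) * (r - 1) < t) := by
  obtain ⟨τ, f, e, hnot, r, -, hr, hsq, ht', h1, h2, h3⟩ := Exec.loop (s := s)
    (σ := (σ.setNat vR 0 1).setNat vSq 0 1) (b := .natLE (.add (.var vSq) (.lit 1)) (.var vTar))
    (P := .seq (.setNat vSq (.lit 0) (.add (.var vSq) (.add (.var vR) (.add (.var vR) (.lit 1)))))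
      (.setNat vR (.lit 0) (.add (.var vR) (.lit 1)))) (s + 1 - 1) (by omega)
    (fun f τ => ∃ r, f = s + 1 - r ∧ τ.nat vR 0 = r ∧ τ.nat vSq 0 = r * r ∧ τ.nat vTar 0 = t ∧
      1 ≤ r ∧ r ≤ s ∧ (r = 1 ∨ (r - 1) * (r - 1) < t))
    ⟨1, rfl, by simp, by simp, by simpa using ht, le_rfl, hs, .inl rfl⟩ (by
      rintro f τ hτ ⟨r, rfl, hr, hsq, ht', h1, h2, h3⟩ hlt
      simp only [Test.Holds, NExp.eval, hsq, ht'] at hlt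
      have hrs : r < s := by
        by_contra h
        have := Nat.mul_le_mul (not_lt.1 h) (not_lt.1 h)
        omega
      refine ⟨_, _, ?_, Exec.setNat.seq Exec.setNat, r + 1, rfl, ?_, ?_, ?_, by omega, by omega,
        .inr (by simpa using hlt)⟩
      · omega
      · simp [NExp.eval, hr]
      · simp [NExp.eval, hr, hsq]; ring
      · simpa using ht')
  refine ⟨τ, r, Exec.setNat.seq (Exec.setNat.seq e), hr, h1, h2, ?_, h3⟩
  simpa [Test.Holds, NExp.eval, hsq, ht'] using hnot

/-- What the algorithm has computed before it writes the routes: the segments `κ`, `κ'` of the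
sources and of the targets, the leaders `ldr` of the loads, the walks `L` that start at the
vehicles, and the positions `pos` of the sources in `L`. -/
structure Plan (X : Data) (r : ℕ) (κ κ' : ℕ → ℕ × ℕ × ℝ) (ldr pos : ℕ → ℕ)
    (L : List (ℕ × ℕ)) : Prop where
  r_pos : 1 ≤ r
  r_spec : ∃ Lg, X.n ≤ 2 ^ Lg ∧ (Lg = 0 ∨ 2 ^ (Lg - 1) < X.n) ∧ X.n * Lg ≤ r * r ∧
    (r = 1 ∨ (r - 1) * (r - 1) < X.n * Lg)
  keys : ∃ (Z : ℕ) (len sc : ℕ → ℝ) (cp : ℕ → ℕ) (Ds : List ℝ),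
    Keys X r (1 + 4 * X.n / r) {q | q < X.m} 0 Z κ κ' len sc cp ∧
    Ds.Pairwise (fun a b => 2 * b < a) ∧ (∀ D ∈ Ds, ∃ q < X.m, D = X.len q) ∧
    ∀ W, LowerBound X W → ∑ a ∈ Finset.Ioc 0 Z, (len a + sc a) ≤
      (Ds.map fun D => 5 * (min (3 * W) (X.n * (2 * D)) + D)).sum
  pos_lt : ∀ q < X.m, (κ q).2.1 < X.n ∧ (κ' q).2.1 < X.n
  loads : Loads (fun q => ((κ q).1, (κ' q).1)) X.cap X.m ldr
  walks : ∃ lim W : ℝ, (∀ u < X.n, ∀ v < X.n, X.d u v ≤ lim) ∧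
    Prim X.d lim X.depots X.freeSources L ∅ W
  pos : ∀ q < X.m, (L.map Prod.fst)[pos (X.src q)]? = some (X.src q)

theorem algorithm_spec {X : Data} {σ : Memory} (hσ : Input X σ) :
    ∃ τ r κ κ' ldr pos L, Exec X.size algorithm σ τ ∧ Plan X r κ κ' ldr pos L ∧
      Emitted (allTours X ldr (fun q => (κ q).2.1) (fun q => (κ' q).2.1) pos
        (fun j => (L.map Prod.snd).getD j 0) L.length) τ := by
  have hn0 : 0 < X.n := (Nat.zero_le _).trans_lt (X.depot_lt 0)
  have hsize : X.size = X.n + X.h + X.m := rfl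
  generalize hs : X.size = s at hsize ⊢
  obtain ⟨σ₁, e₁, hB₁⟩ := rows_spec (s := s) hσ (by omega)
  obtain ⟨σ₂, Lg, e₂, ht, hLg, hLg'⟩ := target_spec (s := s) hB₁.n (by omega)
    (by rw [e₁.unchanged.nat vTar rfl, hσ.zero _ (by norm_num)])
  have hB₂ := hB₁.unchanged e₂.unchanged rfl
  have hLgn : Lg ≤ X.n := by
    rcases hLg' with h | h
    · omega
    · have := Nat.lt_two_pow_self (n := Lg - 1)
      omega
  obtain ⟨σ₃, r, e₃, hr, hr1, hrs, hr2, hr3⟩ := root_spec (s := s) ht (by omega)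
    (Nat.mul_le_mul (by omega) (by omega))
  have hB₃ := hB₂.unchanged e₃.unchanged rfl
  obtain ⟨σ₄, Ds, e₄, hS, hall⟩ := scales_spec (s := s) hB₃ (by omega) (by omega) hr1 hrs hr
    (fun q => by
      rw [e₃.unchanged.nat aAs rfl, e₂.unchanged.nat aAs rfl, e₁.unchanged.nat aAs rfl,
        hσ.zero _ (by norm_num)])
    (by
      rw [e₃.unchanged.nat vSg rfl, e₂.unchanged.nat vSg rfl, e₁.unchanged.nat vSg rfl,
        hσ.zero _ (by norm_num)])
  have hassigned : assigned X σ₄ = {q | q < X.m} := by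
    ext q
    simp only [assigned, Set.mem_ofPred_eq]
    exact ⟨fun h => h.1, fun h => ⟨h, hall q h⟩⟩
  obtain ⟨σ₅, e₅, hLd⟩ := loads_spec (s := s) hS.base (by omega) (fun q => by
      rw [e₄.unchanged.nat aNum rfl, e₃.unchanged.nat aNum rfl, e₂.unchanged.nat aNum rfl,
        e₁.unchanged.nat aNum rfl, hσ.zero _ (by norm_num)])
  have hB₅ := hS.base.unchanged e₅.unchanged rfl
  obtain ⟨σ₆, L, lim, W, e₆, hlim, hP, hL, hpos, hLs⟩ := depotWalks_spec (s := s) hB₅ hs.le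
  have hB₆ := hB₅.unchanged e₆.unchanged rfl
  obtain ⟨τ, e₇, hE⟩ := emitAll_spec (s := s) hB₆ (by omega) (by omega)
    (by rw [hL.count]; exact hLs) (by
      rw [e₆.unchanged.nat 4 rfl, e₅.unchanged.nat 4 rfl, e₄.unchanged.nat 4 rfl,
        e₃.unchanged.nat 4 rfl, e₂.unchanged.nat 4 rfl, e₁.unchanged.nat 4 rfl,
        hσ.zero _ (by norm_num)])
  obtain ⟨len, sc, cp, hk, hsum⟩ := hS.keys
  rw [hassigned] at hk
  refine ⟨τ, r, srcKey σ₄, tgtKey σ₄, σ₆.nat aLdr, σ₆.nat aPos, L,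
    e₁.seq (e₂.seq (e₃.seq (e₄.seq (e₅.seq (e₆.seq e₇))))),
    ⟨hr1, ⟨Lg, hLg, hLg', hr2, hr3⟩, ⟨_, len, sc, cp, Ds, hk, hS.pairwise, hS.mem, hsum⟩,
      fun q hq => hS.pos_lt q (hassigned ▸ hq), ?_, ⟨lim, W, hlim, hP⟩, fun q hq => ?_⟩, ?_⟩
  · rw [e₆.unchanged.nat aLdr rfl]
    exact hLd
  · have h := hpos q hq
    have hlt : σ₆.nat aPos (X.src q) < L.length := by rw [← hL.count]; exact h.1
    have h2 := hL.get _ _ (List.getElem?_eq_getElem hlt)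
    simp only [List.getElem?_map, List.getElem?_eq_getElem hlt, Option.map_some, ← h2.1]
    rw [h.2]
  · have h1 : σ₆.nat aPS = fun q => (srcKey σ₄ q).2.1 := by
      rw [e₆.unchanged.nat aPS rfl, e₅.unchanged.nat aPS rfl]; rfl
    have h2 : σ₆.nat aPT = fun q => (tgtKey σ₄ q).2.1 := by
      rw [e₆.unchanged.nat aPT rfl, e₅.unchanged.nat aPT rfl]; rfl
    rw [h1, h2, hL.count] at hE
    convert hE using 1
    refine List.flatMap_congr fun j hj => ?_
    have hj := List.mem_range.1 hj
    have h3 := (hL.get j _ (List.getElem?_eq_getElem hj)).2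
    simp [h3, hj]

/-! ### The cost of the loads -/

theorem walkLen_append_le {V : Type*} {d : V → V → ℝ} {u y : V} {A B : List V} {c : ℝ}
    (h : ∀ x ∈ u :: A, d x y ≤ c) :
    walkLen d u (A ++ y :: B) ≤ walkLen d u A + c + walkLen d y B := by
  induction A generalizing u with
  | nil => simpa using h
  | cons a A ih =>
    have := ih (u := a) fun x hx => h x (List.mem_cons_of_mem _ hx)
    simp only [List.cons_append, walkLen_cons]
    linarith

section Walk

variable {V : Type*} {d : V → V → ℝ} (hd : IsPseudoMetric d)
include hd

/-- Closed walks that are attached to the stops of a walk add their lengths to its length. -/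
theorem walkLen_flatMap_le {ι : Type*} (js : List ι) (v : ι → V) (w : ι → List V) (u : V) :
    walkLen d u (js.flatMap w) ≤
      walkLen d u (js.map v) + (js.map fun j => walkLen d (v j) (w j ++ [v j])).sum := by
  induction js generalizing u with
  | nil => simp
  | cons j js ih =>
    have h1 : walkLen d (v j) (w j ++ js.flatMap w) ≤
        walkLen d (v j) (w j ++ [v j]) + walkLen d (v j) (js.flatMap w) := by
      rw [← walkLen_append_cons]
      exact walkLen_sublist hd ((List.sublist_cons_self _ _).append_left _) _
    have h2 := walkLen_le_add hd u (v j) (w j ++ js.flatMap w)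
    have h3 := ih (v j)
    simp only [List.flatMap_cons, List.map_cons, walkLen_cons, List.sum_cons]
    linarith

theorem walkLen_flatMap_closed_le {ι : Type*} (js : List ι) (w : ι → List V) (u : V) :
    walkLen d u (js.flatMap w ++ [u]) ≤ (js.map fun j => walkLen d u (w j ++ [u])).sum := by
  induction js with
  | nil => simp [hd.self]
  | cons j js ih =>
    have h1 : walkLen d u (w j ++ (js.flatMap w ++ [u])) ≤
        walkLen d u (w j ++ [u]) + walkLen d u (js.flatMap w ++ [u]) := by
      rw [← walkLen_append_cons]
      exact walkLen_sublist hd ((List.sublist_cons_self _ _).append_left _) _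
    simp only [List.flatMap_cons, List.map_cons, List.sum_cons, List.append_assoc]
    linarith

end Walk

theorem flatMap_ite_nil {α β : Type*} (P : α → Prop) [DecidablePred P] (l : List α)
    (f : α → List β) : (l.flatMap fun x => if P x then f x else []) = (l.filter P).flatMap f := by
  induction l with
  | nil => rfl
  | cons x l ih => by_cases h : P x <;> simp [h, ih]

theorem sum_map_filter {α : Type*} (P : α → Prop) [DecidablePred P] (l : List α) (f : α → ℝ) :
    ((l.filter P).map f).sum = (l.map fun x => if P x then f x else 0).sum := by
  induction l with
  | nil => rfl
  | cons x l ih => by_cases h : P x <;> simp [h, ih]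

theorem sum_map_range (n : ℕ) (f : ℕ → ℝ) :
    ((List.range n).map f).sum = ∑ i ∈ Finset.range n, f i := by
  rw [Finset.sum_eq_multiset_sum, Finset.range_val, ← Multiset.coe_range, Multiset.map_coe,
    Multiset.sum_coe]

/-- The requests in the load with the leader `a`, in the order of `p`. -/
def halfOrder (n m : ℕ) (ldr p : ℕ → ℕ) (a : ℕ) : List ℕ :=
  (List.range n).flatMap fun c => (List.range m).flatMap fun q =>
    if ldr q = a then if p q = c then [q] else [] else []

theorem halfTour_eq_map (n m : ℕ) (ldr p : ℕ → ℕ) (kind a k : ℕ) :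
    halfTour n m ldr p kind a k = (halfOrder n m ldr p a).map fun q => (k, kind, q) := by
  simp only [halfTour, halfOrder, List.map_flatMap]
  refine List.flatMap_congr fun c _ => List.flatMap_congr fun q _ => ?_
  split_ifs <;> rfl

theorem mem_halfOrder {n m : ℕ} {ldr p : ℕ → ℕ} {a q : ℕ} :
    q ∈ halfOrder n m ldr p a ↔ q < m ∧ ldr q = a ∧ p q < n := by
  simp only [halfOrder, List.mem_flatMap, List.mem_range]
  constructor
  · rintro ⟨c, hc, q', hq', h⟩
    split_ifs at h with h1 h2
    · obtain rfl : q = q' := by simpa using h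
      exact ⟨hq', h1, h2 ▸ hc⟩
    all_goals simp at h
  · rintro ⟨h1, h2, h3⟩
    exact ⟨p q, h3, q, h1, by simp [h2]⟩

theorem pairwise_halfOrder (n m : ℕ) (ldr p : ℕ → ℕ) (a : ℕ) :
    (halfOrder n m ldr p a).Pairwise fun q q' => p q ≤ p q' ∧ q ≠ q' := by
  have hmem : ∀ {c q q' : ℕ}, q' ∈ (if ldr q = a then if p q = c then [q] else [] else []) →
      q' = q ∧ p q = c := by
    intro c q q' h
    split_ifs at h with h1 h2
    · exact ⟨by simpa using h, h2⟩
    all_goals simp at h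
  rw [halfOrder, List.pairwise_flatMap]
  refine ⟨fun c _ => ?_, List.pairwise_lt_range.imp fun {c c'} hcc x hx y hy => ?_⟩
  · rw [List.pairwise_flatMap]
    refine ⟨fun q _ => ?_, List.pairwise_lt_range.imp fun {q q'} hqq x hx y hy => ?_⟩
    · split_ifs <;> simp
    · obtain ⟨rfl, h1⟩ := hmem hx
      obtain ⟨rfl, h2⟩ := hmem hy
      omega
  · obtain ⟨q, -, hq⟩ := List.mem_flatMap.1 hx
    obtain ⟨q', -, hq'⟩ := List.mem_flatMap.1 hy
    obtain ⟨rfl, h1⟩ := hmem hq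
    obtain ⟨rfl, h2⟩ := hmem hq'
    refine ⟨by omega, ?_⟩
    rintro rfl
    omega

theorem nodup_halfOrder (n m : ℕ) (ldr p : ℕ → ℕ) (a : ℕ) : (halfOrder n m ldr p a).Nodup :=
  (pairwise_halfOrder n m ldr p a).imp fun h => h.2

theorem length_halfOrder {n m : ℕ} {ldr p : ℕ → ℕ} (hp : ∀ q < m, p q < n) (a : ℕ) :
    (halfOrder n m ldr p a).length = ((Finset.range m).filter fun q => ldr q = a).card := by
  rw [← List.toFinset_card_of_nodup (nodup_halfOrder n m ldr p a)]
  congr 1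
  ext q
  simp only [List.mem_toFinset, mem_halfOrder, Finset.mem_filter, Finset.mem_range]
  exact ⟨fun h => ⟨h.1, h.2.1⟩, fun h => ⟨h.1, h.2, hp q h.1⟩⟩

namespace KeySide

variable {d : ℕ → ℕ → ℝ} {f : ℕ → ℕ} {Q : Set ℕ} {Z₀ Z₁ : ℕ} {κ : ℕ → ℕ × ℕ × ℝ} {len : ℕ → ℝ}

theorem dist_le_len (h : KeySide d f Q Z₀ Z₁ κ len) (hd : IsPseudoMetric d) {q q' : ℕ} (hq : q ∈ Q)
    (hq' : q' ∈ Q) (hk : (κ q).1 = (κ q').1) : d (f q) (f q') ≤ len (κ q).1 := by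
  have h1 := h.co_mem q hq
  have h2 := h.co_mem q' hq'
  rw [← hk] at h2
  rcases le_total (κ q).2.1 (κ q').2.1 with hp | hp
  · have := h.dist_le q hq q' hq' hk hp
    linarith
  · have := h.dist_le q' hq' q hq hk.symm hp
    rw [hd.symm]
    linarith

/-- A walk along one segment is no longer than the segment. -/
theorem walkLen_le (h : KeySide d f Q Z₀ Z₁ κ len) {q : ℕ} {l : List ℕ}
    (hl : (q :: l).Pairwise fun q q' => (κ q).2.1 ≤ (κ q').2.1) (hQ : ∀ x ∈ q :: l, x ∈ Q)
    (hk : ∀ x ∈ q :: l, (κ x).1 = (κ q).1) :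
    walkLen d (f q) (l.map f) ≤ len (κ q).1 - (κ q).2.2 := by
  induction l generalizing q with
  | nil => simpa using (h.co_mem q (hQ q (by simp))).2
  | cons x l ih =>
    have hkx : (κ x).1 = (κ q).1 := hk x (by simp)
    have h1 := ih (List.pairwise_cons.1 hl).2 (fun y hy => hQ y (List.mem_cons_of_mem _ hy))
      (fun y hy => (hk y (List.mem_cons_of_mem _ hy)).trans hkx.symm)
    have h2 := h.dist_le q (hQ q (by simp)) x (hQ x (by simp)) hkx.symm
      ((List.pairwise_cons.1 hl).1 x (by simp))
    rw [hkx] at h1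
    simp only [List.map_cons, walkLen_cons]
    linarith

end KeySide

/-- Serving a load and returning costs twice the two segments and the distance between them. -/
theorem Keys.walkLen_le {X : Data} {r M : ℕ} {Q : Set ℕ} {Z₀ Z₁ : ℕ} {κ κ' : ℕ → ℕ × ℕ × ℝ}
    {len sc : ℕ → ℝ} {cp : ℕ → ℕ} (h : Keys X r M Q Z₀ Z₁ κ κ' len sc cp) {a : ℕ} {l l' : List ℕ}
    (hl : l.Pairwise fun q q' => (κ q).2.1 ≤ (κ q').2.1)
    (hl' : l'.Pairwise fun q q' => (κ' q).2.1 ≤ (κ' q').2.1)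
    (hQ : ∀ q ∈ l, q ∈ Q ∧ (κ q).1 = (κ a).1) (hQ' : ∀ q ∈ l', q ∈ Q ∧ (κ' q).1 = (κ' a).1)
    (ha : a ∈ l) (ha' : a ∈ l') :
    walkLen X.d (X.src a) (l.map X.src ++ l'.map X.tgt ++ [X.src a]) ≤
      4 * ((len (κ a).1 + sc (κ a).1) + (len (κ' a).1 + sc (κ' a).1)) := by
  have hd := X.metric
  have haQ := (hQ a ha).1
  rcases l with _ | ⟨x, l⟩
  · simp at ha
  rcases l' with _ | ⟨y, l'⟩
  · simp at ha'
  have hx := hQ x (by simp)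
  have hy := hQ' y (by simp)
  have hlen2 := h.le_sc a haQ
  have hsc := h.sc_eq a haQ
  have hsc0 := h.sc_nonneg (κ a).1
  have hL0 := h.len_nonneg (κ a).1
  have hL0' := h.len_nonneg (κ' a).1
  have hcross : ∀ q ∈ x :: l, ∀ q' ∈ y :: l', X.d (X.src q) (X.tgt q') ≤
      len (κ a).1 + X.len a + len (κ' a).1 := by
    intro q hq q' hq'
    have h1 := h.src.dist_le_len hd (hQ q hq).1 haQ (hQ q hq).2
    have h2 := h.tgt.dist_le_len hd haQ (hQ' q' hq').1 (hQ' q' hq').2.symm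
    have h3 := hd.tri (X.src q) (X.src a) (X.tgt q')
    have h4 := hd.tri (X.src a) (X.tgt a) (X.tgt q')
    rw [(hQ q hq).2] at h1
    have : X.d (X.src a) (X.tgt a) = X.len a := rfl
    linarith
  have w1 := h.src.walkLen_le hl (fun q hq => (hQ q hq).1)
    (fun q hq => (hQ q hq).2.trans hx.2.symm)
  have w2 := h.tgt.walkLen_le hl' (fun q hq => (hQ' q hq).1)
    (fun q hq => (hQ' q hq).2.trans hy.2.symm)
  have c1 := (h.src.co_mem x hx.1).1
  have c2 := (h.tgt.co_mem y hy.1).1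
  rw [hx.2] at w1
  rw [hy.2] at w2
  have d1 := h.src.dist_le_len hd haQ hx.1 hx.2.symm
  have e1 := walkLen_append_le (d := X.d) (u := X.src x) (A := l.map X.src) (y := X.tgt y)
    (B := l'.map X.tgt ++ [X.src a]) (c := len (κ a).1 + X.len a + len (κ' a).1) (by
      intro v hv
      rw [← List.map_cons] at hv
      obtain ⟨q, hq, rfl⟩ := List.mem_map.1 hv
      exact hcross q hq y (by simp))
  have e2 := walkLen_append_le (d := X.d) (u := X.tgt y) (A := l'.map X.tgt) (y := X.src a)
    (B := []) (c := len (κ a).1 + X.len a + len (κ' a).1) (by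
      intro v hv
      rw [← List.map_cons] at hv
      obtain ⟨q, hq, rfl⟩ := List.mem_map.1 hv
      rw [hd.symm]
      exact hcross a ha q hq)
  simp only [List.map_cons, List.cons_append, walkLen_cons, List.append_assoc, walkLen_nil]
    at e1 e2 ⊢
  rw [hsc]
  linarith

/-- The loads that are not full are determined by their pairs of segments, and for each segment
there are at most `M` segments with which it can form a pair. -/
theorem sum_key_le {N : Finset ℕ} {f g cp : ℕ → ℕ} {E : ℕ → ℝ} {Z M : ℕ} (hE : ∀ a, 0 ≤ E a)
    (hinj : ∀ a ∈ N, ∀ b ∈ N, f a = f b → g a = g b → a = b) (hf : ∀ a ∈ N, f a ∈ Finset.Ioc 0 Z)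
    (hg : ∀ a ∈ N, cp (g a) = cp (f a) ∧ g a ∈ Finset.Ioc (cp (g a)) (cp (g a) + M)) :
    ∑ a ∈ N, E (f a) ≤ M * ∑ s ∈ Finset.Ioc 0 Z, E s := by
  rw [← Finset.sum_fiberwise_of_maps_to hf, Finset.mul_sum]
  refine Finset.sum_le_sum fun s _ => ?_
  have h1 : ∑ a ∈ N with f a = s, E (f a) = ((N.filter fun a => f a = s).card : ℝ) * E s := by
    rw [Finset.sum_congr rfl fun a ha => by rw [(Finset.mem_filter.1 ha).2], Finset.sum_const,
      nsmul_eq_mul]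
  rw [h1]
  refine mul_le_mul_of_nonneg_right ?_ (hE s)
  have h2 := Finset.card_le_card_of_injOn (s := N.filter fun a => f a = s)
    (t := Finset.Ioc (cp s) (cp s + M)) g (fun a ha => by
      have ha := Finset.mem_filter.1 ha
      have := hg a ha.1
      rw [this.1, ha.2] at this
      exact this.2) (fun a ha b hb hab => by
      have ha := Finset.mem_filter.1 ha
      have hb := Finset.mem_filter.1 hb
      exact hinj a ha.1 b hb.1 (ha.2.trans hb.2.symm) hab)
  rw [Nat.card_Ioc, Nat.add_sub_cancel_left] at h2
  exact_mod_cast h2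

/-- The full loads are paid for by the lengths of their requests. There is at most one other load
for a pair of segments, and a segment occurs in at most `M` pairs on either side. -/
theorem Keys.sum_loads_le {X : Data} {r M Z : ℕ} {κ κ' : ℕ → ℕ × ℕ × ℝ} {len sc : ℕ → ℝ}
    {cp ldr : ℕ → ℕ} {W : ℝ} (h : Keys X r M {q | q < X.m} 0 Z κ κ' len sc cp)
    (hL : Loads (fun q => ((κ q).1, (κ' q).1)) X.cap X.m ldr) (hW : LowerBound X W) :
    ∑ a ∈ Finset.range X.m with ldr a = a,
      4 * ((len (κ a).1 + sc (κ a).1) + (len (κ' a).1 + sc (κ' a).1)) ≤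
        8 * (r + 1) * W + 8 * M * ∑ s ∈ Finset.Ioc 0 Z, (len s + sc s) := by
  set A := (Finset.range X.m).filter fun a => ldr a = a with hA
  set size : ℕ → ℕ := fun a => ((Finset.range X.m).filter fun q => ldr q = a).card with hsize
  have hAm : ∀ a ∈ A, a < X.m ∧ ldr a = a := fun a ha => by
    simpa [hA] using ha
  have hE : ∀ s, 0 ≤ len s + sc s := fun s => add_nonneg (h.len_nonneg s) (h.sc_nonneg s)
  rw [← Finset.sum_filter_add_sum_filter_not A fun a => size a = X.cap]
  refine add_le_add ?_ ?_
  · have h1 : ∀ a ∈ A.filter fun a => size a = X.cap, (X.cap : ℝ) *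
        (4 * ((len (κ a).1 + sc (κ a).1) + (len (κ' a).1 + sc (κ' a).1))) ≤
          8 * (r + 1) * ∑ q ∈ Finset.range X.m with ldr q = a, X.len q := by
      intro a ha
      have ha := Finset.mem_filter.1 ha
      have ham := hAm a ha.1
      have h2 := h.len_le (κ a).1
      have h3 := h.len_le (κ' a).1
      have h4 := h.sc_eq a ham.1
      rw [h4] at h3
      have h5 : (X.cap : ℝ) * sc (κ a).1 ≤ ∑ q ∈ Finset.range X.m with ldr q = a, X.len q := by
        rw [← ha.2, hsize, ← nsmul_eq_mul]
        refine Finset.card_nsmul_le_sum _ _ _ fun q hq => ?_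
        have hq := Finset.mem_filter.1 hq
        have hqm := Finset.mem_range.1 hq.1
        have h6 := hL.key_eq q hqm
        rw [hq.2] at h6
        simp only [Prod.mk.injEq] at h6
        rw [h6.1]
        exact h.sc_le q hqm
      rw [h4]
      calc (X.cap : ℝ) * (4 * ((len (κ a).1 + sc (κ a).1) + (len (κ' a).1 + sc (κ a).1)))
          ≤ X.cap * (8 * (r + 1) * sc (κ a).1) := by
            refine mul_le_mul_of_nonneg_left ?_ (Nat.cast_nonneg _)
            linarith
        _ = 8 * (r + 1) * (X.cap * sc (κ a).1) := by ring
        _ ≤ _ := by gcongr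
    have h2 := Finset.sum_le_sum h1
    rw [← Finset.mul_sum _ _ (X.cap : ℝ), ← Finset.mul_sum _ _ (8 * ((r : ℝ) + 1))] at h2
    have h3 : ∑ a ∈ A with size a = X.cap, ∑ q ∈ Finset.range X.m with ldr q = a, X.len q ≤
        X.cap * W := by
      refine le_trans ?_ hW.sum_len_le
      refine (Finset.sum_le_sum_of_subset_of_nonneg (Finset.filter_subset _ _)
        fun a _ _ => Finset.sum_nonneg fun q _ => X.len_nonneg q).trans ?_
      refine le_of_eq (Finset.sum_fiberwise_of_maps_to (fun q hq => ?_) X.len)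
      have hq := Finset.mem_range.1 hq
      have := hL.le q hq
      simp only [hA, Finset.mem_filter, Finset.mem_range]
      exact ⟨by omega, hL.idem q hq⟩
    have hcap : (0 : ℝ) < X.cap := by exact_mod_cast X.cap_pos
    refine le_of_mul_le_mul_left (h2.trans ?_) hcap
    calc 8 * ((r : ℝ) + 1) * _ ≤ 8 * (r + 1) * (X.cap * W) := by gcongr
      _ = _ := by ring
  · set N := A.filter fun a => ¬ size a = X.cap with hN
    have hNA : ∀ a ∈ N, a < X.m := fun a ha => (hAm a (Finset.mem_filter.1 ha).1).1
    have hinj : ∀ a ∈ N, ∀ b ∈ N, (κ a).1 = (κ b).1 → (κ' a).1 = (κ' b).1 → a = b := by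
      intro a ha b hb h1 h2
      have hna := Finset.mem_filter.1 ha
      have hnb := Finset.mem_filter.1 hb
      have hla := hAm a hna.1
      have hlb := hAm b hnb.1
      rcases lt_trichotomy a b with hab | hab | hab
      · exact absurd (hL.full a b hab hlb.1 hla.2 hlb.2 (by simp [h1, h2])) hna.2
      · exact hab
      · exact absurd (hL.full b a hab hla.1 hlb.2 hla.2 (by simp [h1, h2])) hnb.2
    have s1 := sum_key_le (N := N) (f := fun a => (κ a).1) (g := fun a => (κ' a).1) (cp := cp)
      (M := M) (Z := Z) hE hinj (fun a ha => Finset.mem_Ioc.2 (h.src.seg_mem a (hNA a ha)))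
      (fun a ha => ⟨h.cp_eq a (hNA a ha), Finset.mem_Ioc.2 (h.cp_tgt a (hNA a ha))⟩)
    have s2 := sum_key_le (N := N) (f := fun a => (κ' a).1) (g := fun a => (κ a).1) (cp := cp)
      (M := M) (Z := Z) hE (fun a ha b hb h1 h2 => hinj a ha b hb h2 h1)
      (fun a ha => Finset.mem_Ioc.2 (h.tgt.seg_mem a (hNA a ha)))
      (fun a ha => ⟨(h.cp_eq a (hNA a ha)).symm, Finset.mem_Ioc.2 (h.cp_src a (hNA a ha))⟩)
    rw [← Finset.mul_sum, Finset.sum_add_distrib]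
    linarith

/-! ### The cost of all routes -/

theorem sum_le_two_mul {W : ℝ} {l : List ℝ} (hl : l.Pairwise fun a b => 2 * b < a)
    (h : ∀ D ∈ l, D ≤ W) (h0 : 0 ≤ W) : l.sum ≤ 2 * W := by
  induction l generalizing W with
  | nil => simpa using h0
  | cons D l ih =>
    have h1 := List.pairwise_cons.1 hl
    have hD := h D (by simp)
    rw [List.sum_cons]
    by_cases hD0 : 0 ≤ D
    · have := ih h1.2 (W := D / 2) (fun D' hD' => by have := h1.1 D' hD'; linarith) (by linarith)
      linarith
    · have := ih h1.2 (W := 0) (fun D' hD' => by have := h1.1 D' hD'; linarith) le_rfl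
      linarith

/-- Scales that grow by factors larger than `2` contribute a logarithmic number of times the weight:
the few largest ones at most `W` each, and the other ones a geometric series. -/
theorem sum_min_le {n W : ℝ} (hn : 0 ≤ n) (hW : 0 ≤ W) (k : ℕ) {l : List ℝ}
    (hl : l.Pairwise fun a b => 2 * b < a) (h : ∀ D ∈ l, n * D ≤ 2 ^ k * W) :
    (l.map fun D => min W (n * D)).sum ≤ (k + 2) * W := by
  induction k generalizing l with
  | zero =>
    rcases hn.eq_or_lt with rfl | hn
    · have : (l.map fun D => min W (0 * D)).sum = 0 := by
        simp [min_eq_right hW]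
      rw [this]
      positivity
    have h1 : (l.map fun D => min W (n * D)).sum ≤ (l.map fun D => n * D).sum :=
      List.sum_le_sum fun D _ => min_le_right _ _
    have h2 := sum_le_two_mul hl (W := W / n) (fun D hD => by
      rw [le_div_iff₀ hn]
      have := h D hD
      linarith) (by positivity)
    rw [List.sum_map_mul_left] at h1
    simp only [List.map_id'] at h1
    have h3 : n * l.sum ≤ n * (2 * (W / n)) := by gcongr
    have h4 : n * (2 * (W / n)) = 2 * W := by field_simp
    push_cast
    linarith
  | succ k ih =>
    rcases l with _ | ⟨D, l⟩
    · simp; positivity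
    · have h1 := List.pairwise_cons.1 hl
      have h2 := ih h1.2 fun D' hD' => by
        have h3 := h1.1 D' hD'
        have h4 := h D (by simp)
        have h5 : n * (2 * D') ≤ n * D := by gcongr
        rw [pow_succ] at h4
        linarith
      have h3 : min W (n * D) ≤ W := min_le_left _ _
      simp only [List.map_cons, List.sum_cons]
      push_cast
      linarith

/-- The walk of a vehicle keeps its first vertex, the location of the vehicle. -/
theorem Prim.exists_block_eq {d : ℕ → ℕ → ℝ} {lim : ℝ} {L₀ L : List (ℕ × ℕ)} {K₀ K : Finset ℕ}
    {W : ℝ} (h : Prim d lim L₀ K₀ L K W) {c v : ℕ} (h₀ : ∃ l, block L₀ c = v :: l) :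
    ∃ l, block L c = v :: l := by
  induction h with
  | start => exact h₀
  | @insert A B x c' K W u _ _ _ _ ih =>
    obtain ⟨l, hl⟩ := ih
    rw [block_append, block_cons] at hl
    rw [block_append, block_cons, block_cons]
    rcases hA : block A c with _ | ⟨y, A'⟩
    · rw [hA] at hl
      by_cases hc : c' = c
      · simp only [hc, if_true, List.nil_append, List.cons.injEq] at hl ⊢
        exact ⟨_, hl.1, rfl⟩
      · simp only [hc, if_false, List.nil_append] at hl ⊢
        exact ⟨_, hl⟩
    · rw [hA] at hl
      simp only [List.cons_append, List.cons.injEq] at hl ⊢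
      exact ⟨_, hl.1, rfl⟩
  | append _ _ _ ih =>
    obtain ⟨l, hl⟩ := ih
    exact ⟨_, by rw [block_append, hl]; rfl⟩

/-- If all distances are below the limit, no new walk is started. -/
theorem Prim.tag_mem {d : ℕ → ℕ → ℝ} {lim : ℝ} {n : ℕ} {L₀ L : List (ℕ × ℕ)} {K₀ K : Finset ℕ}
    {W : ℝ} (h : Prim d lim L₀ K₀ L K W) (hlim : ∀ u < n, ∀ v < n, d u v ≤ lim) (hL₀ : L₀ ≠ [])
    (hn : ∀ p ∈ L₀, p.1 < n) (hK₀ : ∀ v ∈ K₀, v < n) : ∀ p ∈ L, p.2 ∈ L₀.map Prod.snd := by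
  induction h with
  | start => exact fun p hp => List.mem_map_of_mem hp
  | @insert A B x c K W u _ _ _ _ ih =>
    intro p hp
    have : p ∈ A ++ (x, c) :: B ∨ p = (u, c) := by
      simp at hp ⊢; tauto
    rcases this with h | rfl
    · exact ih p h
    · exact ih (x, c) (by simp)
  | @append L K W v hP hv hlt _ =>
    obtain ⟨p, hp⟩ := List.exists_mem_of_ne_nil _ hL₀
    exact absurd (hlim _ (hn p hp) v (hK₀ v (hP.subset hv))) (not_le.2
      (hlt p (hP.start_subset hp) v hv))

theorem pathLen_mono {d d' : ℕ → ℕ → ℝ} (h : ∀ u v, d u v ≤ d' u v) (l : List ℕ) :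
    pathLen d l ≤ pathLen d' l := by
  have : ∀ u l, walkLen d u l ≤ walkLen d' u l := by
    intro u l
    induction l generalizing u with
    | nil => simp
    | cons x l ih => exact add_le_add (h u x) (ih x)
  cases l with
  | nil => simp
  | cons x l => exact this x l

/-- The walks that start at the vehicles have length at most `2 * W`. -/
theorem depotWalks_le {X : Data} {lim W Wp : ℝ} {L : List (ℕ × ℕ)} (hW : LowerBound X W)
    (hlim : ∀ u < X.n, ∀ v < X.n, X.d u v ≤ lim)
    (hP : Prim X.d lim X.depots X.freeSources L ∅ Wp) :
    ∑ k ∈ Finset.range X.h, walkLen X.d (X.depot k) (block L k) ≤ 2 * W := by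
  have hd := X.metric
  have hlim0 : 0 ≤ lim := (hd.nonneg _ _).trans (hlim _ (X.depot_lt 0) _ (X.depot_lt 0))
  have hblock₀ : ∀ k < X.h, block X.depots k = [X.depot k] := by
    intro k hk
    have : (List.range X.h).filter (fun j => decide (j = k)) = [k] := by
      rw [List.filter_eq, List.count_range, if_pos hk]
      rfl
    simp [block, Data.depots, List.filter_map, Function.comp_def, this]
  have h1 : ∀ k ∈ Finset.range X.h, walkLen X.d (X.depot k) (block L k) =
      pathLen X.d (block L k) := by
    intro k hk
    obtain ⟨l, hl⟩ := hP.exists_block_eq ⟨[], hblock₀ k (Finset.mem_range.1 hk)⟩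
    rw [hl, walkLen_cons, hd.self, zero_add, pathLen_cons]
  rw [Finset.sum_congr rfl h1]
  have h2 := hP.sum_pathLen_block_le hd hlim0 (by simp [Data.depots]) X.h
  have h3 : ∑ k ∈ Finset.range X.h, pathLen X.d (block X.depots k) = 0 :=
    Finset.sum_eq_zero fun k hk => by
      rw [hblock₀ k (Finset.mem_range.1 hk)]; simp [pathLen]
  have hX : (X.depots.map Prod.fst).toFinset = (Finset.range X.h).image X.depot := by
    ext v; simp [Data.depots]
  obtain ⟨F, hF, hFW⟩ := hW.exists_walks
  set S := (X.depots.map Prod.fst).toFinset ∪ X.freeSources with hS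
  have h4 := hP.weight_le hd hlim0 (by rw [hX]; exact Finset.disjoint_sdiff)
    (F := (List.range X.h).map fun k => (X.depot k :: F k).filter (· ∈ S))
    ⟨by simp only [List.mem_map, forall_exists_index, and_imp]
        rintro l k - rfl v hv
        exact (List.mem_filter.1 hv).2 |> of_decide_eq_true,
      by simp only [List.mem_map, List.mem_range, forall_exists_index, and_imp]
         rintro l k hk rfl
         have : X.depot k ∈ (X.depots.map Prod.fst).toFinset := by
           rw [hX]; exact Finset.mem_image_of_mem _ (Finset.mem_range.2 hk)
         refine ⟨X.depot k, List.mem_filter.2 ⟨by simp, ?_⟩, this⟩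
         simpa [hS] using Or.inl (by simpa using this),
      by intro v hv
         have hv' := hv
         simp only [Data.freeSources, Finset.mem_sdiff, Finset.mem_image, Finset.mem_range] at hv'
         obtain ⟨⟨q, hq, rfl⟩, -⟩ := hv'
         obtain ⟨k, hk, hqk⟩ := hF q hq
         refine ⟨_, List.mem_map_of_mem (List.mem_range.2 hk), List.mem_filter.2
           ⟨List.mem_cons_of_mem _ hqk, ?_⟩⟩
         exact decide_eq_true (Finset.mem_union_right _ hv)⟩
  rw [List.map_map, sum_map_range] at h4
  have h5 : ∀ k ∈ Finset.range X.h, (pathLen fun a b => min (X.d a b) lim)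
      ((X.depot k :: F k).filter (· ∈ S)) ≤ walkLen X.d (X.depot k) (F k) := fun k _ =>
    (pathLen_mono (fun _ _ => min_le_left _ _) _).trans (pathLen_sublist hd List.filter_sublist)
  have h6 := Finset.sum_le_sum h5
  simp only [Function.comp_def] at h4
  linarith

/-- The vertex at which a stop takes place. -/
def stopLoc (X : Data) (t : ℕ × ℕ × ℕ) : ℕ := if t.2.1 = 0 then X.src t.2.2 else X.tgt t.2.2

theorem filter_loadTour (n m : ℕ) (ldr p p' : ℕ → ℕ) (a j k : ℕ) :
    (loadTour n m ldr p p' a j).filter (fun t => t.1 = k) =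
      if j = k then loadTour n m ldr p p' a j else [] := by
  split_ifs with h
  · rw [List.filter_eq_self]
    intro t ht
    simp only [loadTour, halfTour_eq_map, List.mem_append, List.mem_map] at ht
    rcases ht with ⟨q, -, rfl⟩ | ⟨q, -, rfl⟩ <;> simp [h]
  · rw [List.filter_eq_nil_iff]
    intro t ht
    simp only [loadTour, halfTour_eq_map, List.mem_append, List.mem_map] at ht
    rcases ht with ⟨q, -, rfl⟩ | ⟨q, -, rfl⟩ <;> simp [h]

/-- The stops of the vehicle `k`. -/
theorem filter_allTours (X : Data) (ldr p p' pos tag : ℕ → ℕ) (cnt k : ℕ) :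
    (allTours X ldr p p' pos tag cnt).filter (fun t => t.1 = k) =
      ((List.range cnt).filter fun j => tag j = k).flatMap fun j =>
        ((List.range X.m).filter fun a => ldr a = a ∧ pos (X.src a) = j).flatMap fun a =>
          loadTour X.n X.m ldr p p' a k := by
  rw [← flatMap_ite_nil, allTours, List.filter_flatMap]
  refine List.flatMap_congr fun j _ => ?_
  rw [List.filter_flatMap, ← flatMap_ite_nil]
  by_cases hj : tag j = k
  · simp only [hj, if_true]
    refine List.flatMap_congr fun a _ => ?_
    by_cases h1 : ldr a = a <;> by_cases h2 : pos (X.src a) = j <;> simp [h1, h2, filter_loadTour]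
  · simp only [hj, if_false]
    rw [List.flatMap_eq_nil_iff]
    intro a _
    split_ifs <;> simp [filter_loadTour, hj]

theorem stopLoc_loadTour (X : Data) (ldr p p' : ℕ → ℕ) (a k : ℕ) :
    (loadTour X.n X.m ldr p p' a k).map (stopLoc X) =
      (halfOrder X.n X.m ldr p a).map X.src ++ (halfOrder X.n X.m ldr p' a).map X.tgt := by
  simp [loadTour, halfTour_eq_map, stopLoc, Function.comp_def]

/-- The cost of the routes is the length of the walks that start at the vehicles and the lengths of
the closed tours for the loads. -/
theorem sum_routes_le {X : Data} {ldr p p' pos : ℕ → ℕ} {L : List (ℕ × ℕ)} {c : ℕ → ℝ}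
    (hc0 : ∀ a < X.m, 0 ≤ c a)
    (hc : ∀ a < X.m, ldr a = a → walkLen X.d (X.src a)
      ((halfOrder X.n X.m ldr p a).map X.src ++ (halfOrder X.n X.m ldr p' a).map X.tgt ++
        [X.src a]) ≤ c a)
    (hpos : ∀ q < X.m, (L.map Prod.fst)[pos (X.src q)]? = some (X.src q)) :
    ∑ k ∈ Finset.range X.h, walkLen X.d (X.depot k) (((allTours X ldr p p' pos
      (fun j => (L.map Prod.snd).getD j 0) L.length).filter fun t => t.1 = k).map (stopLoc X)) ≤
      ∑ k ∈ Finset.range X.h, walkLen X.d (X.depot k) (block L k) +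
        ∑ a ∈ Finset.range X.m with ldr a = a, c a := by
  have hd := X.metric
  set tag : ℕ → ℕ := fun j => (L.map Prod.snd).getD j 0 with htag
  set v : ℕ → ℕ := fun j => (L.map Prod.fst).getD j 0 with hv
  have hblock : ∀ k, ((List.range L.length).filter fun j => tag j = k).map v = block L k := by
    intro k
    have hLr : L = (List.range L.length).map fun j => (v j, tag j) := by
      refine List.ext_getElem (by simp) fun j h1 h2 => ?_
      simp [hv, htag, h1]
    conv_rhs => rw [hLr]
    simp [block, List.filter_map, Function.comp_def]
  -- the loads whose leaders have their sources at the position `j`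
  set g : ℕ → ℝ := fun j => ∑ a ∈ Finset.range X.m with ldr a = a,
    if pos (X.src a) = j then c a else 0 with hg
  have hg0 : ∀ j, 0 ≤ g j := fun j => Finset.sum_nonneg fun a ha => by
    have := hc0 a (by simpa using (Finset.mem_filter.1 ha).1)
    split_ifs <;> simp [this]
  have hone : ∀ k, walkLen X.d (X.depot k) (((allTours X ldr p p' pos tag L.length).filter
      fun t => t.1 = k).map (stopLoc X)) ≤ walkLen X.d (X.depot k) (block L k) +
        ∑ j ∈ Finset.range L.length, if tag j = k then g j else 0 := by
    intro k
    rw [filter_allTours, List.map_flatMap]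
    refine (walkLen_flatMap_le hd _ v _ _).trans ?_
    rw [hblock, sum_map_filter, sum_map_range]
    gcongr with j hj
    split_ifs with hjk
    swap
    · exact le_rfl
    rw [List.map_flatMap]
    refine (walkLen_flatMap_closed_le hd _ _ _).trans ?_
    rw [sum_map_filter, sum_map_range, hg]
    simp only [Finset.sum_filter]
    refine Finset.sum_le_sum fun a ha => ?_
    have ham := Finset.mem_range.1 ha
    by_cases h1 : ldr a = a
    · by_cases h2 : pos (X.src a) = j
      · have hva : v j = X.src a := by
          have := hpos a ham
          rw [h2] at this
          simp only [hv, List.getD_eq_getElem?_getD, this, Option.getD_some]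
        simp only [h1, h2, and_self, if_true, stopLoc_loadTour, hva]
        exact hc a ham h1
      · simp [h1, h2]
    · simp [h1]
  refine (Finset.sum_le_sum fun k _ => hone k).trans ?_
  rw [Finset.sum_add_distrib, Finset.sum_comm (s := Finset.range X.h)]
  gcongr
  calc ∑ j ∈ Finset.range L.length, ∑ k ∈ Finset.range X.h, (if tag j = k then g j else 0)
      ≤ ∑ j ∈ Finset.range L.length, g j := by
        refine Finset.sum_le_sum fun j _ => ?_
        rw [Finset.sum_ite_eq]
        split_ifs
        · exact le_rfl
        · exact hg0 j
    _ ≤ _ := by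
        simp only [hg]
        rw [Finset.sum_comm]
        refine Finset.sum_le_sum fun a ha => ?_
        rw [Finset.sum_ite_eq]
        split_ifs
        · exact le_rfl
        · exact hc0 a (by simpa using (Finset.mem_filter.1 ha).1)

/-- The routes cost `O(√(n * log n))` times any weight that satisfies the lower bounds. The walks from
the vehicles contribute a constant, the full loads `O(r)`, and the other loads `O(n / r)` times the
total length of the segments, which is `O(log n)`. -/
theorem Plan.sum_routes_le {X : Data} {r : ℕ} {κ κ' : ℕ → ℕ × ℕ × ℝ} {ldr pos : ℕ → ℕ}
    {L : List (ℕ × ℕ)} {W : ℝ} (h : Plan X r κ κ' ldr pos L) (hW : LowerBound X W) (hW0 : 0 ≤ W)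
    (hn : 2 ≤ X.n) :
    ∑ k ∈ Finset.range X.h, walkLen X.d (X.depot k) (((allTours X ldr (fun q => (κ q).2.1)
      (fun q => (κ' q).2.1) pos (fun j => (L.map Prod.snd).getD j 0) L.length).filter
        fun t => t.1 = k).map (stopLoc X)) ≤ 9672 * √(X.n * Real.log X.n) * W := by
  obtain ⟨Z, len, sc, cp, Ds, hk, hDs, hmem, hsum⟩ := h.keys
  obtain ⟨lim, Wp, hlim, hP⟩ := h.walks
  obtain ⟨Lg, hLg, hLg', hr2, hr3⟩ := h.r_spec
  have hE : ∀ s, 0 ≤ len s + sc s := fun s => add_nonneg (hk.len_nonneg s) (hk.sc_nonneg s)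
  have h1 := DialARide.sum_routes_le (X := X) (ldr := ldr) (p := fun q => (κ q).2.1)
    (p' := fun q => (κ' q).2.1) (L := L)
    (c := fun a => 4 * ((len (κ a).1 + sc (κ a).1) + (len (κ' a).1 + sc (κ' a).1)))
    (fun a _ => by have := hE (κ a).1; have := hE (κ' a).1; linarith)
    (fun a ha hla => by
      have hkey : ∀ {p : ℕ → ℕ} {q : ℕ}, q ∈ halfOrder X.n X.m ldr p a →
          q < X.m ∧ (κ q).1 = (κ a).1 ∧ (κ' q).1 = (κ' a).1 := by
        intro p q hq
        obtain ⟨h1, h2, -⟩ := mem_halfOrder.1 hq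
        have := h.loads.key_eq q h1
        simp only [h2, Prod.mk.injEq] at this
        exact ⟨h1, this.1.symm, this.2.symm⟩
      exact hk.walkLen_le ((pairwise_halfOrder _ _ _ _ _).imp fun h => h.1)
        ((pairwise_halfOrder _ _ _ _ _).imp fun h => h.1)
        (fun q hq => ⟨(hkey hq).1, (hkey hq).2.1⟩) (fun q hq => ⟨(hkey hq).1, (hkey hq).2.2⟩)
        (mem_halfOrder.2 ⟨ha, hla, (h.pos_lt a ha).1⟩)
        (mem_halfOrder.2 ⟨ha, hla, (h.pos_lt a ha).2⟩)) h.pos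
  have h2 := depotWalks_le hW hlim hP
  have h3 := hk.sum_loads_le h.loads hW
  have hn1 : (1 : ℝ) ≤ X.n := by exact_mod_cast (by omega : 1 ≤ X.n)
  -- the sum of the scales
  have h4 : ∑ s ∈ Finset.Ioc 0 Z, (len s + sc s) ≤ 20 * ((Lg + 2) * W) := by
    refine (hsum W hW).trans ?_
    have hmin := sum_min_le (n := (X.n : ℝ)) (by linarith) hW0 Lg hDs fun D hD => by
      obtain ⟨q, hq, rfl⟩ := hmem D hD
      have h5 : (X.n : ℝ) ≤ 2 ^ Lg := by exact_mod_cast hLg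
      exact mul_le_mul h5 (hW.len_le q hq) (X.len_nonneg q) (by positivity)
    have : (Ds.map fun D => 5 * (min (3 * W) (X.n * (2 * D)) + D)).sum ≤
        (Ds.map fun D => 20 * min W (X.n * D)).sum := by
      refine List.sum_le_sum fun D hD => ?_
      obtain ⟨q, hq, rfl⟩ := hmem D hD
      have h5 := hW.len_le q hq
      have h6 := X.len_nonneg q
      have h7 : X.len q ≤ X.n * X.len q := le_mul_of_one_le_left h6 hn1
      rcases min_cases W (X.n * X.len q) with ⟨h8, -⟩ | ⟨h8, -⟩ <;> rw [h8]
      · have := min_le_left (3 * W) (X.n * (2 * X.len q))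
        linarith
      · have := min_le_right (3 * W) (X.n * (2 * X.len q))
        linarith
    refine this.trans ?_
    rw [List.sum_map_mul_left]
    linarith
  -- the numbers
  have hLg1 : 1 ≤ Lg := by
    by_contra h0
    obtain rfl : Lg = 0 := by omega
    simp at hLg
    omega
  have hLgn : 2 ^ (Lg - 1) < X.n := hLg'.resolve_left (by omega)
  have hrpos : (0 : ℝ) < r := by exact_mod_cast h.r_pos
  have hLgr : (Lg : ℝ) ≤ r := by
    have h5 : Lg ≤ X.n := by
      have := Nat.lt_two_pow_self (n := Lg - 1)
      omega
    have h6 : Lg * Lg ≤ r * r := (Nat.mul_le_mul_right Lg h5).trans hr2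
    exact_mod_cast Nat.mul_self_le_mul_self_iff.1 h6
  have hM : ((1 + 4 * X.n / r : ℕ) : ℝ) * (Lg + 2) ≤ 15 * r := by
    have h5 : ((1 + 4 * X.n / r : ℕ) : ℝ) ≤ 1 + 4 * X.n / r := by
      push_cast
      gcongr
      exact_mod_cast Nat.cast_div_le (α := ℝ) (m := 4 * X.n) (n := r)
    have h6 : (Lg : ℝ) + 2 ≤ 3 * Lg := by
      have : (1 : ℝ) ≤ Lg := by exact_mod_cast hLg1
      linarith
    have h7 : (X.n : ℝ) * Lg / r ≤ r := by
      rw [div_le_iff₀ hrpos]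
      exact_mod_cast hr2
    calc ((1 + 4 * X.n / r : ℕ) : ℝ) * (Lg + 2) ≤ (1 + 4 * X.n / r) * (3 * Lg) := by gcongr
      _ = 3 * Lg + 12 * (X.n * Lg / r) := by ring
      _ ≤ 15 * r := by linarith
  have hlog : (Lg : ℝ) ≤ 4 * Real.log X.n := by
    have hl2 := Real.log_two_gt_d9
    have h5 : ((Lg - 1 : ℕ) : ℝ) * Real.log 2 ≤ Real.log X.n := by
      rw [← Real.log_pow]
      refine Real.log_le_log (by positivity) ?_
      exact_mod_cast hLgn.le
    have h6 : Real.log 2 ≤ Real.log X.n :=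
      Real.log_le_log (by norm_num) (by exact_mod_cast hn)
    rw [Nat.cast_sub hLg1, Nat.cast_one] at h5
    have h7 : (0 : ℝ) ≤ Lg := Nat.cast_nonneg _
    nlinarith
  have hr : (r : ℝ) ≤ 4 * √(X.n * Real.log X.n) := by
    have h5 : (r : ℝ) ≤ 2 * √(X.n * Lg) := by
      have h6 : (1 : ℝ) ≤ √(X.n * Lg) := by
        rw [Real.one_le_sqrt]
        have : (1 : ℝ) ≤ Lg := by exact_mod_cast hLg1
        nlinarith
      rcases hr3 with h7 | h7
      · rw [h7]; push_cast; linarith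
      · have h8 : ((r : ℝ) - 1) ≤ √(X.n * Lg) := by
          refine Real.le_sqrt_of_sq_le ?_
          have : (((r - 1 : ℕ) : ℝ)) * ((r - 1 : ℕ) : ℝ) ≤ X.n * Lg := by exact_mod_cast h7.le
          rw [Nat.cast_sub h.r_pos, Nat.cast_one] at this
          rw [sq]
          exact this
        linarith
    have h6 : √(X.n * Lg) ≤ 2 * √(X.n * Real.log X.n) := by
      rw [Real.sqrt_le_left (by positivity), mul_pow, Real.sq_sqrt (by positivity)]
      nlinarith
    linarith
  have hr1 : (1 : ℝ) ≤ r := by exact_mod_cast h.r_pos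
  have h5 : ((1 + 4 * X.n / r : ℕ) : ℝ) * ∑ s ∈ Finset.Ioc 0 Z, (len s + sc s) ≤ 300 * r * W := by
    calc ((1 + 4 * X.n / r : ℕ) : ℝ) * ∑ s ∈ Finset.Ioc 0 Z, (len s + sc s)
        ≤ ((1 + 4 * X.n / r : ℕ) : ℝ) * (20 * ((Lg + 2) * W)) := by gcongr
      _ = 20 * (((1 + 4 * X.n / r : ℕ) : ℝ) * (Lg + 2)) * W := by ring
      _ ≤ 20 * (15 * r) * W := by gcongr
      _ = _ := by ring
  have h6 : W ≤ r * W := le_mul_of_one_le_left hW0 hr1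
  have h7 : r * W ≤ 4 * √(X.n * Real.log X.n) * W := by gcongr
  linarith

/-! ### The routes that the algorithm writes are feasible -/

theorem walkLen_map {V U : Type*} (f : V → U) (d : U → U → ℝ) (u : V) (l : List V) :
    walkLen d (f u) (l.map f) = walkLen (fun a b => d (f a) (f b)) u l := by
  induction l generalizing u with
  | nil => rfl
  | cons x l ih => simp [ih]

theorem Network.isPseudoMetric {n h : ℕ} (N : Network n h) : IsPseudoMetric N.dist :=
  ⟨N.dist_self, N.dist_comm, N.dist_triangle⟩

theorem WInstance.walkWeight_eq {n h : ℕ} {ι : Type} (I : WInstance n h ι) (u : Fin n)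
    (l : List (Stop n ι)) : I.walkWeight u l = walkLen I.dist u (l.map I.loc) := by
  induction l generalizing u with
  | nil => rfl
  | cons x l ih => simp [WInstance.walkWeight, ih]

/-- The vertex with a given number, reduced modulo `n`. -/
def vertex {n : ℕ} (hn : 0 < n) (u : ℕ) : Fin n := ⟨u % n, Nat.mod_lt _ hn⟩

theorem vertex_val {n : ℕ} (hn : 0 < n) (u : Fin n) : vertex hn u = u :=
  Fin.ext (Nat.mod_eq_of_lt u.2)

namespace Instance

variable {n h : ℕ}

theorem pos_of_vehicle (I : Instance n h) (hh : 0 < h) : 0 < n :=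
  (Nat.zero_le _).trans_lt (I.depot ⟨0, hh⟩).2

/-- The instance in terms of natural numbers; indices out of range stand for the location of the
first vehicle. -/
def data (I : Instance n h) (hh : 0 < h) : Data where
  n := n
  h := h
  m := I.requests.length
  cap := I.cap
  d u v := I.dist (vertex (I.pos_of_vehicle hh) u) (vertex (I.pos_of_vehicle hh) v)
  depot k := if hk : k < h then I.depot ⟨k, hk⟩ else I.depot ⟨0, hh⟩
  src q := if hq : q < I.requests.length then (I.requests.get ⟨q, hq⟩).1 else I.depot ⟨0, hh⟩
  tgt q := if hq : q < I.requests.length then (I.requests.get ⟨q, hq⟩).2 else I.depot ⟨0, hh⟩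
  metric := ⟨fun _ => I.dist_self _, fun _ _ => I.dist_comm _ _, fun _ _ _ => I.dist_triangle _ _ _⟩
  h_pos := hh
  cap_pos := I.cap_pos
  depot_lt k := by split_ifs <;> exact Fin.is_lt _
  src_lt q := by split_ifs <;> exact Fin.is_lt _
  tgt_lt q := by split_ifs <;> exact Fin.is_lt _

variable (I : Instance n h) (hh : 0 < h)

theorem data_d (u v : Fin n) : (I.data hh).d u v = I.dist u v := by
  simp [data, vertex_val]

theorem data_depot (k : Fin h) : (I.data hh).depot k = I.depot k := by
  simp [data]

theorem data_src (q : Fin I.requests.length) : (I.data hh).src q = I.unit.src q := by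
  simp [data, unit]

theorem data_tgt (q : Fin I.requests.length) : (I.data hh).tgt q = I.unit.tgt q := by
  simp [data, unit]

theorem input_data : Input (I.data hh) I.input where
  n := by simp [input, toArray, data]
  h := by simp [input, toArray, data]
  m := by simp [input, toArray, data]
  cap := by simp [input, toArray, data]
  depot k hk := by
    have hk : k < h := hk
    simp [input, toArray, data, hk]
  src q hq := by
    have hq : q < I.requests.length := hq
    simp [input, toArray, data, hq]
  tgt q hq := by
    have hq : q < I.requests.length := hq
    simp [input, toArray, data, hq]
  dist u hu v hv := by
    have hu : u < n := hu
    have hv : v < n := hv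
    have h1 : u * n + v < n * n := by
      calc u * n + v < u * n + n := by omega
        _ = (u + 1) * n := by ring
        _ ≤ n * n := Nat.mul_le_mul_right n hu
    have h2 : (u * n + v) / n = u := by
      rw [mul_comm, Nat.mul_add_div (by omega), Nat.div_eq_of_lt hv, add_zero]
    have h3 : (u * n + v) % n = v := by
      rw [mul_comm, Nat.mul_add_mod, Nat.mod_eq_of_lt hv]
    have h4 : (I.data hh).n = n := rfl
    rw [h4]
    simp only [input, h1, and_self, dif_pos, h2, h3]
    rw [← data_d I hh]
  zero a ha i := by
    match a, ha with
    | _ + 4, _ => rfl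

end Instance

/-- The stop of the vehicle `k` that a written triple encodes. -/
def stopOf (n m k : ℕ) (t : ℕ × ℕ × ℕ) : Option (Stop n (Fin m)) :=
  if hi : t.2.2 < m then
    if t.1 = k then some (if t.2.1 = 0 then Stop.pick ⟨t.2.2, hi⟩ else Stop.drop ⟨t.2.2, hi⟩)
    else none
  else none

theorem Emitted.output_eq {h m n : ℕ} {out : List (ℕ × ℕ × ℕ)} {τ : Memory} (hE : Emitted out τ)
    (k : Fin h) : output (m := m) n τ k = out.filterMap (stopOf n m k) := by
  have hout : out = (List.range out.length).map fun j => (τ.nat 5 j, τ.nat 6 j, τ.nat 7 j) := by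
    refine List.ext_getElem (by simp) fun j h1 h2 => ?_
    simp [hE.get j _ (List.getElem?_eq_getElem h1)]
  conv_rhs => rw [hout]
  rw [List.filterMap_map, output, hE.count]
  rfl

/-- The change of the load at a stop. -/
def stopChange (t : ℕ × ℕ × ℕ) : ℝ := if t.2.1 = 0 then 1 else -1

theorem Instance.load_filterMap {n h : ℕ} (I : Instance n h) (k : ℕ) {l : List (ℕ × ℕ × ℕ)}
    (hl : ∀ t ∈ l, t.2.2 < I.requests.length) :
    I.unit.load (l.filterMap (stopOf n I.requests.length k)) =
      ((l.filter fun t => t.1 = k).map stopChange).sum := by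
  induction l with
  | nil => simp [WInstance.load]
  | cons t l ih =>
    have ih := ih fun t ht => hl t (List.mem_cons_of_mem _ ht)
    have ht := hl t (by simp)
    simp only [WInstance.load] at ih ⊢
    by_cases h1 : t.1 = k
    · by_cases h2 : t.2.1 = 0 <;>
        simp [stopOf, ht, h1, h2, stopChange, WInstance.change, Instance.unit, ← ih]
    · simp [stopOf, ht, h1, ← ih]

theorem Instance.loc_filterMap {n h : ℕ} (I : Instance n h) (hh : 0 < h) (k : ℕ)
    {l : List (ℕ × ℕ × ℕ)} (hl : ∀ t ∈ l, t.2.2 < I.requests.length) :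
    ((l.filterMap (stopOf n I.requests.length k)).map I.unit.loc).map Fin.val =
      (l.filter fun t => t.1 = k).map (stopLoc (I.data hh)) := by
  induction l with
  | nil => simp
  | cons t l ih =>
    have ih := ih fun t ht => hl t (List.mem_cons_of_mem _ ht)
    have ht := hl t (by simp)
    by_cases h1 : t.1 = k
    · by_cases h2 : t.2.1 = 0
      · simp [stopOf, ht, h1, h2, stopLoc, WInstance.loc, ← ih, ← data_src I hh]
      · simp [stopOf, ht, h1, h2, stopLoc, WInstance.loc, ← ih, ← data_tgt I hh]
    · simp [stopOf, ht, h1, ← ih]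

theorem Instance.walkWeight_filterMap {n h : ℕ} (I : Instance n h) (hh : 0 < h) (k : Fin h)
    {l : List (ℕ × ℕ × ℕ)} (hl : ∀ t ∈ l, t.2.2 < I.requests.length) :
    I.unit.walkWeight (I.depot k) (l.filterMap (stopOf n I.requests.length k)) =
      walkLen (I.data hh).d ((I.data hh).depot k)
        ((l.filter fun t => t.1 = (k : ℕ)).map (stopLoc (I.data hh))) := by
  rw [← I.loc_filterMap hh k hl, WInstance.walkWeight_eq, I.data_depot hh,
    walkLen_map Fin.val]
  simp only [Instance.data_d]
  rfl

/-- The changes of the load in `l` add up to `0`, and no prefix of `l` exceeds the capacity. -/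
def Balanced (c : ℝ) (l : List ℝ) : Prop := l.sum = 0 ∧ ∀ p, p <+: l → p.sum ≤ c

theorem Balanced.append {c : ℝ} {l l' : List ℝ} (h : Balanced c l) (h' : Balanced c l') :
    Balanced c (l ++ l') := by
  refine ⟨by rw [List.sum_append, h.1, h'.1, add_zero], fun p hp => ?_⟩
  rcases List.prefix_or_prefix_of_prefix hp (List.prefix_append l l') with h1 | ⟨r, rfl⟩
  · exact h.2 p h1
  · rw [List.sum_append, h.1, zero_add]
    exact h'.2 r ((List.prefix_append_right_inj l).1 hp)

theorem Balanced.flatMap {ι : Type*} {c : ℝ} (hc : 0 ≤ c) {l : List ι} {f : ι → List ℝ}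
    (h : ∀ i ∈ l, Balanced c (f i)) : Balanced c (l.flatMap f) := by
  induction l with
  | nil =>
    refine ⟨rfl, fun p hp => ?_⟩
    rw [List.prefix_nil.1 hp]
    exact hc
  | cons i l ih =>
    rw [List.flatMap_cons]
    exact (h i (by simp)).append (ih fun j hj => h j (List.mem_cons_of_mem _ hj))

theorem balanced_replicate {c : ℝ} {s : ℕ} (hs : (s : ℝ) ≤ c) :
    Balanced c (List.replicate s 1 ++ List.replicate s (-1)) := by
  have hc : 0 ≤ c := (Nat.cast_nonneg _).trans hs
  refine ⟨by simp, fun p hp => ?_⟩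
  rcases List.prefix_or_prefix_of_prefix hp (List.prefix_append _ _) with h1 | ⟨r, rfl⟩
  · rw [List.prefix_replicate_iff] at h1
    rw [h1.2]
    simpa using (Nat.cast_le.2 h1.1).trans hs
  · have h1 := (List.prefix_append_right_inj _).1 hp
    rw [List.prefix_replicate_iff] at h1
    rw [List.sum_append, h1.2]
    simp
    linarith [(Nat.cast_nonneg r.length : (0 : ℝ) ≤ r.length)]

section Tours

variable {X : Data} {ldr p p' pos tag : ℕ → ℕ} {cnt : ℕ} {key : ℕ → ℕ × ℕ}

theorem mem_loadTour {n m a j : ℕ} {t : ℕ × ℕ × ℕ} (hp : ∀ q < m, p q < n)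
    (hp' : ∀ q < m, p' q < n) : t ∈ loadTour n m ldr p p' a j ↔
      t.1 = j ∧ t.2.1 ≤ 1 ∧ t.2.2 < m ∧ ldr t.2.2 = a := by
  obtain ⟨k, κ, q⟩ := t
  simp only [loadTour, halfTour_eq_map, List.mem_append, List.mem_map, mem_halfOrder,
    Prod.mk.injEq]
  constructor
  · rintro (⟨q', h, rfl, rfl, rfl⟩ | ⟨q', h, rfl, rfl, rfl⟩)
    · exact ⟨rfl, by norm_num, h.1, h.2.1⟩
    · exact ⟨rfl, by norm_num, h.1, h.2.1⟩
  · rintro ⟨rfl, h1, h2, h3⟩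
    have : κ = 0 ∨ κ = 1 := by omega
    rcases this with rfl | rfl
    · exact .inl ⟨q, ⟨h2, h3, hp q h2⟩, rfl, rfl, rfl⟩
    · exact .inr ⟨q, ⟨h2, h3, hp' q h2⟩, rfl, rfl, rfl⟩

theorem nodup_loadTour (n m a j : ℕ) : (loadTour n m ldr p p' a j).Nodup := by
  rw [loadTour, halfTour_eq_map, halfTour_eq_map, List.nodup_append]
  refine ⟨(nodup_halfOrder _ _ _ _ _).map fun x y h => by simpa using h,
    (nodup_halfOrder _ _ _ _ _).map fun x y h => by simpa using h, ?_⟩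
  rintro t ht t' ht' rfl
  obtain ⟨q, -, rfl⟩ := List.mem_map.1 ht
  obtain ⟨q', -, h⟩ := List.mem_map.1 ht'
  simp at h

variable (hp : ∀ q < X.m, p q < X.n) (hp' : ∀ q < X.m, p' q < X.n)
include hp hp'

theorem nodup_allTours : (allTours X ldr p p' pos tag cnt).Nodup := by
  have hmem : ∀ {a j : ℕ} {t}, t ∈ (if ldr a = a then if pos (X.src a) = j then
      loadTour X.n X.m ldr p p' a (tag j) else [] else []) →
      ldr t.2.2 = a ∧ pos (X.src a) = j := by
    intro a j t ht
    split_ifs at ht with h1 h2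
    · exact ⟨((mem_loadTour hp hp').1 ht).2.2.2, h2⟩
    all_goals simp at ht
  rw [allTours, List.Nodup, List.pairwise_flatMap]
  refine ⟨fun j _ => ?_, List.pairwise_lt_range.imp fun {j j'} hj x hx y hy => ?_⟩
  · rw [List.pairwise_flatMap]
    refine ⟨fun a _ => ?_, List.pairwise_lt_range.imp fun {a a'} ha x hx y hy => ?_⟩
    · split_ifs
      · exact nodup_loadTour _ _ _ _
      all_goals simp
    · rintro rfl
      have h1 := hmem hx
      have h2 := hmem hy
      omega
  · rintro rfl
    obtain ⟨a, -, ha⟩ := List.mem_flatMap.1 hx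
    obtain ⟨a', -, ha'⟩ := List.mem_flatMap.1 hy
    obtain ⟨h1, h2⟩ := hmem ha
    obtain ⟨h3, h4⟩ := hmem ha'
    subst h1 h3
    omega

variable (hl : Loads key X.cap X.m ldr)
include hl

theorem mem_allTours (hpos : ∀ q < X.m, pos (X.src q) < cnt) {t : ℕ × ℕ × ℕ} :
    t ∈ allTours X ldr p p' pos tag cnt ↔
      t.1 = tag (pos (X.src (ldr t.2.2))) ∧ t.2.1 ≤ 1 ∧ t.2.2 < X.m := by
  simp only [allTours, List.mem_flatMap, List.mem_range]
  constructor
  · rintro ⟨j, hj, a, ha, h⟩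
    split_ifs at h with h1 h2
    · obtain ⟨h3, h4, h5, rfl⟩ := (mem_loadTour hp hp').1 h
      exact ⟨by rw [h3, h2], h4, h5⟩
    all_goals simp at h
  · rintro ⟨h1, h2, h3⟩
    have hlt := (hl.le _ h3).trans_lt h3
    refine ⟨_, hpos _ hlt, _, hlt, ?_⟩
    rw [if_pos (hl.idem _ h3), if_pos rfl]
    exact (mem_loadTour hp hp').2 ⟨h1, h2, h3, rfl⟩

/-- A request is picked up before it is dropped. -/
theorem pair_sublist_allTours (hpos : ∀ q < X.m, pos (X.src q) < cnt) {q : ℕ} (hq : q < X.m) :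
    [(tag (pos (X.src (ldr q))), 0, q), (tag (pos (X.src (ldr q))), 1, q)].Sublist
      (allTours X ldr p p' pos tag cnt) := by
  have hlt := (hl.le _ hq).trans_lt hq
  have h1 : [(tag (pos (X.src (ldr q))), 0, q), (tag (pos (X.src (ldr q))), 1, q)].Sublist
      (loadTour X.n X.m ldr p p' (ldr q) (tag (pos (X.src (ldr q))))) := by
    rw [loadTour, halfTour_eq_map, halfTour_eq_map]
    rw [← List.singleton_append]
    refine List.Sublist.append (List.singleton_sublist.2 ?_) (List.singleton_sublist.2 ?_)
    · exact List.mem_map.2 ⟨q, mem_halfOrder.2 ⟨hq, rfl, hp q hq⟩, rfl⟩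
    · exact List.mem_map.2 ⟨q, mem_halfOrder.2 ⟨hq, rfl, hp' q hq⟩, rfl⟩
  refine h1.trans (List.Sublist.trans ?_ (List.sublist_flatten_of_mem (List.mem_map_of_mem
    (List.mem_range.2 (hpos _ hlt)))))
  refine List.Sublist.trans ?_ (List.sublist_flatten_of_mem (List.mem_map_of_mem
    (List.mem_range.2 hlt)))
  rw [if_pos (hl.idem _ hq), if_pos rfl]

/-- Every vehicle carries one load at a time. -/
theorem balanced_allTours (k : ℕ) : Balanced X.cap
    (((allTours X ldr p p' pos tag cnt).filter fun t => t.1 = k).map stopChange) := by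
  rw [filter_allTours, List.map_flatMap]
  refine Balanced.flatMap (Nat.cast_nonneg _) fun j _ => ?_
  rw [List.map_flatMap]
  refine Balanced.flatMap (Nat.cast_nonneg _) fun a _ => ?_
  have h1 : (loadTour X.n X.m ldr p p' a k).map stopChange =
      List.replicate ((Finset.range X.m).filter fun q => ldr q = a).card 1 ++
        List.replicate ((Finset.range X.m).filter fun q => ldr q = a).card (-1) := by
    conv_rhs => rw [← length_halfOrder hp, ← List.map_const']
                rw [length_halfOrder hp, ← length_halfOrder hp', ← List.map_const']
    simp [loadTour, halfTour_eq_map, stopChange, Function.comp_def]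
  rw [h1]
  exact balanced_replicate (by exact_mod_cast hl.card_le a)

end Tours

/-- Since no stop is written twice, each pick-up and each delivery occurs at most once in a route. -/
theorem countP_filterMap_stop {n m k : ℕ} {out : List (ℕ × ℕ × ℕ)} [DecidableEq (Stop n (Fin m))]
    (hnd : out.Nodup) (hk : ∀ t ∈ out, t.2.1 ≤ 1) (i : Fin m) :
    ((out.filterMap (stopOf n m k)).count (Stop.pick i) =
      if (k, 0, (i : ℕ)) ∈ out then 1 else 0) ∧
    ((out.filterMap (stopOf n m k)).count (Stop.drop i) =
      if (k, 1, (i : ℕ)) ∈ out then 1 else 0) := by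
  rw [List.count_filterMap, List.count_filterMap, ← hnd.count, ← hnd.count, List.count, List.count]
  constructor <;> refine List.countP_congr fun t ht => ?_
  all_goals
    obtain ⟨k', κ, q⟩ := t
    have hκ := hk _ ht
    have : κ = 0 ∨ κ = 1 := by
      simp only at hκ
      omega
    simp only [beq_iff_eq, stopOf, Prod.mk.injEq]
    split_ifs with h1 h2 h3
    · simp_all [Fin.ext_iff]
    · simp_all [Fin.ext_iff]
    · simp [h2]
    · simp only [false_iff, not_and]
      rintro - - rfl
      exact h1 i.2

open Classical in
theorem Plan.feasible {n h : ℕ} {I : Instance n h} {hh : 0 < h} {r : ℕ} {κ κ' : ℕ → ℕ × ℕ × ℝ}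
    {ldr pos : ℕ → ℕ} {L : List (ℕ × ℕ)} (hP : Plan (I.data hh) r κ κ' ldr pos L) {τ : Memory}
    (hE : Emitted (allTours (I.data hh) ldr (fun q => (κ q).2.1) (fun q => (κ' q).2.1) pos
      (fun j => (L.map Prod.snd).getD j 0) L.length) τ) :
    I.unit.Feasible (output n τ) := by
  have hp := fun q hq => (hP.pos_lt q hq).1
  have hp' := fun q hq => (hP.pos_lt q hq).2
  have hpos : ∀ q < (I.data hh).m, pos ((I.data hh).src q) < L.length := fun q hq => by
    simpa using (List.getElem?_eq_some_iff.1 (hP.pos q hq)).1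
  have hmem := fun t => mem_allTours (t := t) hp hp' hP.loads hpos
    (tag := fun j => (L.map Prod.snd).getD j 0)
  have hnd := nodup_allTours (ldr := ldr) hp hp' (tag := fun j => (L.map Prod.snd).getD j 0)
    (pos := pos) (cnt := L.length)
  have hsub := fun q (hq : q < (I.data hh).m) => pair_sublist_allTours hp hp' hP.loads hpos hq
    (tag := fun j => (L.map Prod.snd).getD j 0)
  have hbal := balanced_allTours hp hp' hP.loads (tag := fun j => (L.map Prod.snd).getD j 0)
    (pos := pos) (cnt := L.length)
  have htag : ∀ q < (I.data hh).m, (L.map Prod.snd).getD (pos ((I.data hh).src (ldr q))) 0 < h := by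
    intro q hq
    obtain ⟨lim, W, hlim, hPr⟩ := hP.walks
    have hlt := hpos _ ((hP.loads.le q hq).trans_lt hq)
    have h1 := hPr.tag_mem hlim (by simp [Data.depots]; exact hh.ne')
      (by simp [Data.depots]; exact fun k _ => (I.data hh).depot_lt k)
      (by
        intro v hv
        simp only [Data.freeSources, Finset.mem_sdiff, Finset.mem_image] at hv
        obtain ⟨⟨q, -, rfl⟩, -⟩ := hv
        exact (I.data hh).src_lt q) _ (List.getElem_mem hlt)
    simp only [Data.depots, List.map_map, List.mem_map, List.mem_range] at h1
    obtain ⟨k, hk, hk'⟩ := h1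
    simp only [List.getD_eq_getElem?_getD, List.getElem?_map, List.getElem?_eq_getElem hlt,
      Option.map_some, Option.getD_some, ← hk']
    exact hk
  generalize hout : allTours (I.data hh) ldr (fun q => (κ q).2.1) (fun q => (κ' q).2.1) pos
      (fun j => (L.map Prod.snd).getD j 0) L.length = out at hE hmem hnd hsub hbal
  have hvalid : ∀ t ∈ out, t.2.2 < I.requests.length := fun t ht => ((hmem t).1 ht).2.2
  refine ⟨fun i => ?_, fun k l hl => ?_⟩
  · refine ⟨⟨_, htag i i.2⟩, ?_, fun k' => ?_⟩
    · rw [hE.output_eq]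
      have := (hsub i i.2).filterMap (stopOf n I.requests.length
        ((L.map Prod.snd).getD (pos ((I.data hh).src (ldr i))) 0))
      simpa [stopOf] using this
    · rw [hE.output_eq]
      obtain ⟨h1, h2⟩ := countP_filterMap_stop (n := n) (k := k') hnd
        (fun t ht => ((hmem t).1 ht).2.1) i
      rw [h1, h2]
      simp only [hmem]
      have hi : (i : ℕ) < (I.data hh).m := i.2
      simp [hi, Fin.ext_iff]
  · rw [hE.output_eq, List.prefix_filterMap_iff] at hl
    obtain ⟨l', hl', rfl⟩ := hl
    rw [I.load_filterMap _ fun t ht => hvalid t (hl'.subset ht)]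
    exact (hbal k).2 _ ((hl'.filter _).map _)

theorem Plan.weight_eq {n h : ℕ} {I : Instance n h} {hh : 0 < h} {r : ℕ} {κ κ' : ℕ → ℕ × ℕ × ℝ}
    {ldr pos : ℕ → ℕ} {L : List (ℕ × ℕ)} (hP : Plan (I.data hh) r κ κ' ldr pos L) {τ : Memory}
    (hE : Emitted (allTours (I.data hh) ldr (fun q => (κ q).2.1) (fun q => (κ' q).2.1) pos
      (fun j => (L.map Prod.snd).getD j 0) L.length) τ) :
    I.unit.weight (output n τ) = ∑ k ∈ Finset.range h, walkLen (I.data hh).d ((I.data hh).depot k)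
      (((allTours (I.data hh) ldr (fun q => (κ q).2.1) (fun q => (κ' q).2.1) pos
        (fun j => (L.map Prod.snd).getD j 0) L.length).filter fun t => t.1 = k).map
          (stopLoc (I.data hh))) := by
  rw [WInstance.weight, Finset.sum_range]
  refine Finset.sum_congr rfl fun k _ => ?_
  rw [hE.output_eq]
  refine I.walkWeight_filterMap hh k fun t ht => ?_
  exact ((mem_allTours (fun q hq => (hP.pos_lt q hq).1)
    (fun q hq => (hP.pos_lt q hq).2) hP.loads (fun q hq => by
      simpa using (List.getElem?_eq_some_iff.1 (hP.pos q hq)).1)).1 ht).2.2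

/-! ### Feasible solutions: loads, and lower bounds for the weight -/

namespace WInstance

variable {n h : ℕ} {ι : Type} {I : WInstance n h ι} {S : Fin h → List (Stop n ι)}

theorem walkWeight_nonneg (I : WInstance n h ι) (u : Fin n) (l : List (Stop n ι)) :
    0 ≤ I.walkWeight u l := by
  rw [walkWeight_eq]
  exact walkLen_nonneg I.isPseudoMetric _ _

theorem weight_nonneg (I : WInstance n h ι) (S : Fin h → List (Stop n ι)) : 0 ≤ I.weight S :=
  Finset.sum_nonneg fun _ _ => I.walkWeight_nonneg _ _

theorem walkWeight_le_weight (I : WInstance n h ι) (S : Fin h → List (Stop n ι)) (k : Fin h) :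
    I.walkWeight (I.depot k) (S k) ≤ I.weight S :=
  Finset.single_le_sum (f := fun k => I.walkWeight (I.depot k) (S k))
    (fun _ _ => I.walkWeight_nonneg _ _) (Finset.mem_univ k)

open Classical in
/-- The number of copies of the item `i` on board after the stops in `l`. -/
def onBoard (l : List (Stop n ι)) (i : ι) : ℤ := l.count (.pick i) - l.count (.drop i)

open Classical in
theorem onBoard_append_singleton (l : List (Stop n ι)) (x : Stop n ι) (i : ι) :
    onBoard (l ++ [x]) i =
      onBoard l i + (if x = .pick i then 1 else 0) - (if x = .drop i then 1 else 0) := by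
  simp only [onBoard, List.count_append, List.count_singleton, beq_iff_eq]
  push_cast
  ring

theorem load_eq_sum [Fintype ι] (I : WInstance n h ι) (l : List (Stop n ι)) :
    I.load l = ∑ i, I.size i * onBoard l i := by
  classical
  induction l using List.reverseRecOn with
  | nil => simp [load, onBoard]
  | append_singleton l x ih =>
    have h1 : I.load (l ++ [x]) = I.load l + I.change x := by simp [load]
    rw [h1, ih]
    simp only [onBoard_append_singleton]
    push_cast
    simp only [mul_sub, mul_add, Finset.sum_add_distrib, Finset.sum_sub_distrib]
    cases x <;> simp [change, Finset.sum_ite_eq, sub_eq_add_neg]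

/-- Only items that have been picked up can have been dropped. -/
theorem Feasible.onBoard_nonneg (hS : I.Feasible S) {k : Fin h} {l : List (Stop n ι)}
    (hl : l <+: S k) (i : ι) : 0 ≤ onBoard l i := by
  classical
  obtain ⟨k₀, hsub, hc⟩ := hS.served i
  obtain ⟨h1, h2⟩ := hc k
  obtain ⟨r, hr⟩ := hl
  rw [← hr, List.count_append] at h1 h2
  rw [onBoard, sub_nonneg, Nat.cast_le]
  by_contra! hlt
  have hk : k = k₀ := by
    by_contra hk
    rw [if_neg hk] at h2
    omega
  subst hk
  rw [if_pos rfl] at h1 h2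
  have h3 : l.count (.pick i) = 0 := by omega
  have h4 : r.count (.drop i) = 0 := by omega
  rw [← hr] at hsub
  obtain ⟨a, b, hab, ha, hb⟩ := List.sublist_append_iff.1 hsub
  rw [List.count_eq_zero] at h3 h4
  rcases a with _ | ⟨x, a⟩
  · refine h4 (hb.subset ?_)
    rw [List.nil_append] at hab
    rw [← hab]
    simp
  · simp only [List.cons_append, List.cons.injEq] at hab
    exact h3 (ha.subset (by rw [hab.1]; simp))

theorem Feasible.mem_serving (hS : I.Feasible S) (i : ι) :
    ∃ k, I.src i ∈ (S k).map I.loc ∧ I.tgt i ∈ (S k).map I.loc := by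
  obtain ⟨k, hsub, -⟩ := hS.served i
  exact ⟨k, List.mem_map.2 ⟨.pick i, hsub.subset (by simp), rfl⟩,
    List.mem_map.2 ⟨.drop i, hsub.subset (by simp), rfl⟩⟩

theorem walkWeight_append_singleton (I : WInstance n h ι) (u : Fin n) (l : List (Stop n ι))
    (x : Stop n ι) : I.walkWeight u (l ++ [x]) =
      I.walkWeight u l + I.dist (((u :: l.map I.loc).getLast (by simp))) (I.loc x) := by
  induction l generalizing u with
  | nil => simp [walkWeight]
  | cons y l ih => simp [walkWeight, ih, add_assoc]

open Classical in
/-- The potential of a route `l` that ends at `y`: for each item on board its distance from its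
source, and for each delivered item the full distance. It grows by at most the load times the
distance travelled. -/
theorem Feasible.potential_le [Fintype ι] (hS : I.Feasible S) (hsize : ∀ i, I.size i = 1)
    {k : Fin h} {l : List (Stop n ι)} (hl : l <+: S k) :
    ∑ i, (((l.count (.drop i) : ℕ) : ℝ) * I.dist (I.src i) (I.tgt i) +
      onBoard l i * I.dist (I.src i) ((I.depot k :: l.map I.loc).getLast (by simp))) ≤
      I.cap * I.walkWeight (I.depot k) l := by
  induction l using List.reverseRecOn with
  | nil => simp [onBoard, walkWeight]
  | append_singleton l x ih =>
    have hl' := (List.prefix_append l [x]).trans hl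
    have ih := ih hl'
    have hlast : ((I.depot k :: (l ++ [x]).map I.loc).getLast (by simp)) = I.loc x := by simp
    rw [walkWeight_append_singleton, hlast]
    generalize (I.depot k :: l.map I.loc).getLast (by simp) = y at ih ⊢
    have hload := hS.capacity k l hl'
    rw [load_eq_sum] at hload
    simp only [hsize, one_mul] at hload
    have hterm : ∀ i, (((l ++ [x]).count (.drop i) : ℕ) : ℝ) * I.dist (I.src i) (I.tgt i) +
        onBoard (l ++ [x]) i * I.dist (I.src i) (I.loc x) ≤
        ((l.count (.drop i) : ℕ) : ℝ) * I.dist (I.src i) (I.tgt i) +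
          onBoard l i * I.dist (I.src i) y + onBoard l i * I.dist y (I.loc x) := by
      intro i
      have h1 : (onBoard l i : ℝ) * I.dist (I.src i) (I.loc x) ≤
          onBoard l i * (I.dist (I.src i) y + I.dist y (I.loc x)) :=
        mul_le_mul_of_nonneg_left (I.dist_triangle _ _ _)
          (by exact_mod_cast hS.onBoard_nonneg hl' i)
      rw [onBoard_append_singleton, List.count_append, List.count_singleton]
      push_cast
      rcases x with j | j | v
      · by_cases hj : j = i
        · subst hj
          simp [loc, I.dist_self] at h1 ⊢
          linarith
        · simp [hj] at h1 ⊢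
          linarith
      · by_cases hj : j = i
        · subst hj
          simp [loc] at h1 ⊢
          linarith
        · simp [hj] at h1 ⊢
          linarith
      · simp at h1 ⊢
        linarith
    refine (Finset.sum_le_sum fun i _ => hterm i).trans ?_
    rw [Finset.sum_add_distrib, ← Finset.sum_mul, mul_add]
    have := mul_le_mul_of_nonneg_right hload (I.isPseudoMetric.nonneg y (I.loc x))
    linarith

/-- A solution whose vehicles carry at most `cap` items of unit size moves all items. -/
theorem Feasible.sum_dist_le [Fintype ι] (hS : I.Feasible S) (hsize : ∀ i, I.size i = 1) :
    ∑ i, I.dist (I.src i) (I.tgt i) ≤ I.cap * I.weight S := by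
  classical
  have h1 : ∀ i, ∑ k, (((S k).count (.drop i) : ℕ) : ℝ) = 1 := by
    intro i
    obtain ⟨k₀, -, hc⟩ := hS.served i
    have : ∀ k, (((S k).count (.drop i) : ℕ) : ℝ) = if k = k₀ then 1 else 0 := fun k => by
      have := (hc k).2
      split_ifs at this ⊢ with h <;> simp_all
    simp [this]
  rw [weight, Finset.mul_sum]
  calc ∑ i, I.dist (I.src i) (I.tgt i)
      = ∑ i, ∑ k, (((S k).count (.drop i) : ℕ) : ℝ) * I.dist (I.src i) (I.tgt i) := by
        simp only [← Finset.sum_mul, h1, one_mul]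
    _ = ∑ k, ∑ i, (((S k).count (.drop i) : ℕ) : ℝ) * I.dist (I.src i) (I.tgt i) :=
        Finset.sum_comm
    _ ≤ _ := by
        refine Finset.sum_le_sum fun k _ => ?_
        refine le_trans (Finset.sum_le_sum fun i _ => ?_)
          (hS.potential_le hsize (List.prefix_refl (S k)))
        have h2 : (0 : ℝ) ≤ onBoard (S k) i := by
          exact_mod_cast hS.onBoard_nonneg (List.prefix_refl (S k)) i
        exact le_add_of_nonneg_right (mul_nonneg h2 (I.isPseudoMetric.nonneg _ _))

end WInstance

theorem walkLen_append_le_add {V : Type*} {d : V → V → ℝ} {c : ℝ} (hc : 0 ≤ c)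
    (h : ∀ x y, d x y ≤ c) (u : V) (A B : List V) :
    walkLen d u (A ++ B) ≤ walkLen d u A + c + pathLen d B := by
  induction A generalizing u with
  | nil =>
    cases B with
    | nil => simpa using hc
    | cons y B => have := h u y; simp [pathLen_cons]; linarith
  | cons a A ih =>
    have := ih a
    simp only [List.cons_append, walkLen_cons]
    linarith

theorem pathLen_flatMap_le {V ι : Type*} {d : V → V → ℝ} {c : ℝ} (hc : 0 ≤ c)
    (h : ∀ x y, d x y ≤ c) (l : List ι) (f : ι → List V) :
    pathLen d (l.flatMap f) ≤ (l.map fun i => pathLen d (f i) + c).sum := by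
  induction l with
  | nil => simp
  | cons i l ih =>
    rw [List.flatMap_cons, List.map_cons, List.sum_cons]
    rcases hf : f i with _ | ⟨x, A⟩
    · simp only [List.nil_append, pathLen_nil]
      linarith
    · have := walkLen_append_le_add hc h x A (l.flatMap f)
      simp only [List.cons_append, pathLen_cons]
      linarith

/-- Every feasible solution yields lower bounds for its weight. -/
theorem WInstance.Feasible.lowerBound {n h : ℕ} {I : Instance n h} (hh : 0 < h)
    {S : Fin h → List (Stop n (Fin I.requests.length))} (hS : I.unit.Feasible S) :
    LowerBound (I.data hh) (I.unit.weight S) := by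
  set X := I.data hh with hX
  have hm : X.m = I.requests.length := rfl
  have hd := X.metric
  set F : Fin h → List ℕ := fun k => ((S k).map I.unit.loc).map Fin.val with hF
  have hlen : ∀ q : Fin I.requests.length, X.len q = I.unit.dist (I.unit.src q) (I.unit.tgt q) := by
    intro q
    rw [Data.len, hX, I.data_src, I.data_tgt, I.data_d]
    rfl
  have hwalk : ∀ k : Fin h,
      walkLen X.d (X.depot k) (F k) = I.unit.walkWeight (I.depot k) (S k) := by
    intro k
    rw [hX, I.data_depot, hF, walkLen_map Fin.val, WInstance.walkWeight_eq]
    simp only [Instance.data_d]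
    rfl
  have hserve : ∀ q < X.m, ∃ k, X.src q ∈ F k ∧ X.tgt q ∈ F k := by
    intro q hq
    obtain ⟨k, h1, h2⟩ := hS.mem_serving ⟨q, hq⟩
    refine ⟨k, ?_, ?_⟩
    · rw [hX, I.data_src hh ⟨q, hq⟩]
      exact List.mem_map_of_mem h1
    · rw [hX, I.data_tgt hh ⟨q, hq⟩]
      exact List.mem_map_of_mem h2
  have hle : ∀ q < X.m, ∀ k, X.src q ∈ F k → X.tgt q ∈ F k →
      X.len q ≤ I.unit.walkWeight (I.depot k) (S k) := fun q _ k h1 h2 => by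
    rw [← hwalk]
    exact (dist_le_pathLen hd h1 h2).trans (pathLen_le_walkLen hd _ _)
  refine ⟨?_, fun q hq => ?_, fun D C hC _ hD => ?_, fun k => if hk : k < h then F ⟨k, hk⟩ else [],
    fun q hq => ?_, ?_⟩
  · rw [Finset.sum_range]
    exact (Finset.sum_le_sum fun q _ => (hlen q).le).trans (hS.sum_dist_le fun _ => rfl)
  · obtain ⟨k, h1, h2⟩ := hserve q hq
    exact (hle q hq k h1 h2).trans (I.unit.walkWeight_le_weight S k)
  · have : Nonempty (Fin h) := ⟨⟨0, hh⟩⟩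
    choose! k hk using hserve
    have hD' : ∀ q ∈ C, max D 0 ≤ X.len q := fun q hq => max_le (hD q hq) (X.len_nonneg q)
    -- the vehicles that serve a request in `C`, one after the other
    set K := C.image k with hK
    refine ⟨K.toList.flatMap F, fun q hq => ?_, ?_⟩
    · have hq' := hk q (Finset.mem_range.1 (hC hq))
      have hqK : k q ∈ K.toList := Finset.mem_toList.2 (Finset.mem_image_of_mem k hq)
      exact ⟨List.mem_flatMap.2 ⟨_, hqK, hq'.1⟩, List.mem_flatMap.2 ⟨_, hqK, hq'.2⟩⟩
    · have h1 : pathLen (fun a b => min (X.d a b) (2 * D)) (K.toList.flatMap F) ≤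
          pathLen (fun a b => min (X.d a b) (2 * max D 0)) (K.toList.flatMap F) :=
        pathLen_mono (fun u v => min_le_min_left _
          (mul_le_mul_of_nonneg_left (le_max_left D 0) zero_le_two)) _
      refine h1.trans ((pathLen_flatMap_le (c := 2 * max D 0) (by positivity)
        (fun _ _ => min_le_right _ _) _ _).trans ?_)
      rw [Finset.sum_map_toList]
      calc ∑ k ∈ K, (pathLen (fun a b => min (X.d a b) (2 * max D 0)) (F k) + 2 * max D 0)
          ≤ ∑ k ∈ K, 3 * I.unit.walkWeight (I.depot k) (S k) := by
            refine Finset.sum_le_sum fun j hj => ?_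
            obtain ⟨q, hq, rfl⟩ := Finset.mem_image.1 hj
            have hqm := Finset.mem_range.1 (hC hq)
            have h2 := hle q hqm _ (hk q hqm).1 (hk q hqm).2
            have h3 := (pathLen_mono (d' := X.d) (fun u v => min_le_left (X.d u v)
              (2 * max D 0)) (F (k q))).trans (pathLen_le_walkLen hd (X.depot (k q)) _)
            rw [hwalk] at h3
            have h4 := hD' q hq
            linarith
        _ ≤ ∑ k, 3 * I.unit.walkWeight (I.depot k) (S k) :=
            Finset.sum_le_univ_sum_of_nonneg fun k =>
              mul_nonneg (by norm_num) (I.unit.walkWeight_nonneg _ _)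
        _ = 3 * I.unit.weight S := by rw [← Finset.mul_sum]; rfl
  · obtain ⟨k, h1, -⟩ := hserve q hq
    exact ⟨k, k.2, by simpa using h1⟩
  · have : X.h = h := rfl
    rw [this, Finset.sum_range]
    refine le_of_eq (Finset.sum_congr rfl fun k _ => ?_)
    simp only [Fin.is_lt, dif_pos, Fin.eta]
    exact hwalk k

/-! ### Solutions for a part of the items -/

/-- The item that is represented by `i`, if it belongs to the set `A`. -/
def represented {ι κ : Type} (f : κ → ι) (A : Set κ) (i : ι) : Option κ :=
  open Classical in (Function.partialInv f i).filter (fun p => p ∈ A)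

theorem represented_eq_some {ι κ : Type} {f : κ → ι} (hf : f.Injective) {A : Set κ} {i : ι}
    {p : κ} : represented f A i = some p ↔ f p = i ∧ p ∈ A := by
  simp [represented, Option.filter_eq_some_iff, hf.isPartialInv p i]

/-- The stop for the item that is represented by the item of the given stop. -/
def restrictStop {n : ℕ} {ι κ : Type} (f : κ → ι) (A : Set κ) : Stop n ι → Option (Stop n κ)
  | .pick i => (represented f A i).map .pick
  | .drop i => (represented f A i).map .drop
  | .pass _ => none

section Restrict

variable {n h : ℕ} {ι κ : Type} {f : κ → ι} (hf : f.Injective) {A : Set κ}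
include hf

theorem restrictStop_eq_pick {x : Stop n ι} {p : κ} :
    restrictStop f A x = some (.pick p) ↔ x = .pick (f p) ∧ p ∈ A := by
  cases x <;> simp [restrictStop, represented_eq_some hf, eq_comm]

theorem restrictStop_eq_drop {x : Stop n ι} {p : κ} :
    restrictStop f A x = some (.drop p) ↔ x = .drop (f p) ∧ p ∈ A := by
  cases x <;> simp [restrictStop, represented_eq_some hf, eq_comm]

open Classical in
theorem count_pick_restrict (l : List (Stop n ι)) (p : κ) :
    (l.filterMap (restrictStop f A)).count (.pick p) =
      if p ∈ A then l.count (.pick (f p)) else 0 := by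
  rw [List.count_filterMap]
  refine (List.countP_congr (q := fun x => decide (x = .pick (f p) ∧ p ∈ A)) fun x _ => ?_).trans ?_
  · rw [beq_iff_eq, restrictStop_eq_pick hf, decide_eq_true_eq]
  · split_ifs with h
    · exact List.countP_congr fun x _ => by simp [h]
    · simp [h]

open Classical in
theorem count_drop_restrict (l : List (Stop n ι)) (p : κ) :
    (l.filterMap (restrictStop f A)).count (.drop p) =
      if p ∈ A then l.count (.drop (f p)) else 0 := by
  rw [List.count_filterMap]
  refine (List.countP_congr (q := fun x => decide (x = .drop (f p) ∧ p ∈ A)) fun x _ => ?_).trans ?_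
  · rw [beq_iff_eq, restrictStop_eq_drop hf, decide_eq_true_eq]
  · split_ifs with h
    · exact List.countP_congr fun x _ => by simp [h]
    · simp [h]

theorem onBoard_restrict (l : List (Stop n ι)) (p : κ) [Decidable (p ∈ A)] :
    WInstance.onBoard (l.filterMap (restrictStop f A)) p =
      if p ∈ A then WInstance.onBoard l (f p) else 0 := by
  classical
  rw [WInstance.onBoard, count_pick_restrict hf, count_drop_restrict hf, WInstance.onBoard]
  split_ifs <;> simp

theorem pair_sublist_restrict {l : List (Stop n ι)} {p : κ} (hp : p ∈ A)
    (h : [Stop.pick (f p), Stop.drop (f p)].Sublist l) :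
    [Stop.pick p, Stop.drop p].Sublist (l.filterMap (restrictStop f A)) := by
  have := h.filterMap (restrictStop f A)
  rwa [List.filterMap_cons_some ((restrictStop_eq_pick hf).2 ⟨rfl, hp⟩),
    List.filterMap_cons_some ((restrictStop_eq_drop hf).2 ⟨rfl, hp⟩), List.filterMap_nil] at this

theorem map_loc_restrict_sublist {I : WInstance n h ι} {J : WInstance n h κ}
    (hsrc : ∀ p, J.src p = I.src (f p)) (htgt : ∀ p, J.tgt p = I.tgt (f p))
    (l : List (Stop n ι)) :
    ((l.filterMap (restrictStop f A)).map J.loc).Sublist (l.map I.loc) := by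
  induction l with
  | nil => simp
  | cons x l ih =>
    rcases hx : restrictStop f A x with _ | y
    · rw [List.filterMap_cons_none hx, List.map_cons]
      exact ih.cons _
    · rw [List.filterMap_cons_some hx, List.map_cons, List.map_cons]
      have : J.loc y = I.loc x := by
        cases y with
        | pick p => rw [((restrictStop_eq_pick hf).1 hx).1]; exact hsrc p
        | drop p => rw [((restrictStop_eq_drop hf).1 hx).1]; exact htgt p
        | pass v => cases x <;> simp [restrictStop] at hx
      rw [this]
      exact ih.cons_cons _

end Restrict

/-- Removing requests does not increase the optimum. -/
theorem Instance.opt_le_of_sublist {n h : ℕ} {I J : Instance n h}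
    (hN : J.toNetwork = I.toNetwork) (hcap : J.cap = I.cap) (hJ : J.requests.Sublist I.requests) :
    J.unit.opt ≤ I.unit.opt := by
  classical
  obtain ⟨f, hf⟩ := List.sublist_iff_exists_fin_orderEmbedding_get_eq.1 hJ
  have hinj : Function.Injective f := f.injective
  refine le_iInf₂ fun S hS => ?_
  refine (iInf₂_le (fun k => (S k).filterMap (restrictStop f Set.univ)) ?_).trans
    (ENNReal.ofReal_le_ofReal ?_)
  · refine ⟨fun j => ?_, fun k l hl => ?_⟩
    · obtain ⟨k, hk, hc⟩ := hS.served (f j)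
      refine ⟨k, pair_sublist_restrict hinj (Set.mem_univ j) hk, fun k' => ?_⟩
      rw [count_pick_restrict hinj, count_drop_restrict hinj, if_pos (Set.mem_univ j),
        if_pos (Set.mem_univ j)]
      exact hc k'
    · obtain ⟨l', hl', rfl⟩ := List.prefix_filterMap_iff.1 hl
      have h1 := hS.capacity k l' hl'
      rw [WInstance.load_eq_sum] at h1 ⊢
      simp only [Instance.unit, one_mul, onBoard_restrict hinj, Set.mem_univ, if_true] at h1 ⊢
      rw [hcap]
      refine le_trans ?_ h1
      rw [← Finset.sum_image (s := Finset.univ) (g := f)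
        (f := fun i => (WInstance.onBoard l' i : ℝ)) hinj.injOn]
      refine Finset.sum_le_univ_sum_of_nonneg fun i => ?_
      exact_mod_cast hS.onBoard_nonneg hl' i
  · refine Finset.sum_le_sum fun k _ => ?_
    rw [WInstance.walkWeight_eq, WInstance.walkWeight_eq]
    have h1 : J.unit.dist = I.unit.dist := congrArg Network.dist hN
    have h2 : J.unit.depot = I.unit.depot := congrArg Network.depot hN
    rw [h1, h2]
    exact walkLen_sublist I.unit.isPseudoMetric (map_loc_restrict_sublist hinj
      (fun j => congrArg Prod.fst (hf j)) (fun j => congrArg Prod.snd (hf j)) _) _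

/-! ### The guarantee of the algorithm -/

theorem mul_opt_ge {n h : ℕ} {ι : Type} {I : WInstance n h ι} {c : ENNReal} {w : ENNReal}
    (hc0 : c ≠ 0) (hc : c ≠ ⊤)
    (hw : ∀ S, I.Feasible S → w ≤ c * ENNReal.ofReal (I.weight S)) : w ≤ c * I.opt := by
  rw [WInstance.opt, ENNReal.mul_iInf_of_ne hc0 hc]
  refine le_iInf fun S => ?_
  rw [ENNReal.mul_iInf_of_ne hc0 hc]
  exact le_iInf fun hS => hw S hS

/-- On one vertex all distances vanish, and so does the factor `√(n * log n)`. -/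
theorem algorithm_guarantee {n h : ℕ} (I : Instance n h) (hh : 0 < h) :
    ∃ τ, Exec (n + h + I.requests.length) algorithm I.input τ ∧
      I.unit.Feasible (output n τ) ∧
      ENNReal.ofReal (I.unit.weight (output n τ)) ≤
        ENNReal.ofReal (9672 * √(n * Real.log n)) * I.unit.opt := by
  obtain ⟨τ, r, κ, κ', ldr, pos, L, e, hP, hE⟩ := algorithm_spec (I.input_data hh)
  refine ⟨τ, e, hP.feasible hE, ?_⟩
  rcases (show 1 ≤ n from I.pos_of_vehicle hh).eq_or_lt with rfl | hn
  · have : I.unit.weight (output 1 τ) = 0 := by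
      have h0 : I.unit.dist = fun _ _ => 0 := by
        funext a b
        rw [Subsingleton.elim a b, I.unit.dist_self]
      refine Finset.sum_eq_zero fun k _ => ?_
      rw [WInstance.walkWeight_eq, h0]
      generalize List.map _ _ = l
      generalize I.unit.depot k = u
      induction l generalizing u with
      | nil => rfl
      | cons x l ih => simp [ih]
    simp [this]
  · have hn1 : (1 : ℝ) < n := by exact_mod_cast hn
    have hpos : 0 < √(n * Real.log n) := Real.sqrt_pos.2 (mul_pos (by linarith) (Real.log_pos hn1))
    refine mul_opt_ge (ENNReal.ofReal_pos.2 (by positivity)).ne' ENNReal.ofReal_ne_top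
      fun S hS => ?_
    rw [← ENNReal.ofReal_mul (by positivity)]
    refine ENNReal.ofReal_le_ofReal ?_
    rw [hP.weight_eq hE]
    exact hP.sum_routes_le (hS.lowerBound hh) (I.unit.weight_nonneg S) hn

/-! ### Random representatives and colours -/

theorem exp_le_one_add_two_mul {x : ℝ} (h0 : 0 ≤ x) (h1 : x ≤ 1) : Real.exp x ≤ 1 + 2 * x := by
  have h := Real.abs_exp_sub_one_sub_id_le (x := x) (by rwa [abs_of_nonneg h0])
  have := (abs_le.1 h).2
  nlinarith

/-- The exponential moment of the size of one item, which counts with probability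
`(T ∩ B).card / (13 * T.card)`. -/
theorem sum_exp_le {ι : Type} [DecidableEq ι] {T B : Finset ι} {θ s : ℝ} (hs0 : 0 ≤ s)
    (hθ : 0 ≤ θ) (hs1 : θ * s ≤ 1) (hs2 : s ≤ 2 * T.card) (c : Fin 13) :
    ∑ x ∈ Finset.univ ×ˢ T, Real.exp (θ * if x.1 = c ∧ x.2 ∈ B then s else 0) ≤
      (Finset.univ ×ˢ T : Finset (Fin 13 × ι)).card * Real.exp (4 * θ / 13 * (T ∩ B).card) := by
  have h1 : ∀ x ∈ (Finset.univ ×ˢ T : Finset (Fin 13 × ι)),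
      Real.exp (θ * if x.1 = c ∧ x.2 ∈ B then s else 0) ≤
        1 + 2 * (θ * s) * if x.1 = c ∧ x.2 ∈ B then 1 else 0 := by
    intro x _
    split_ifs
    · simpa using exp_le_one_add_two_mul (mul_nonneg hθ hs0) hs1
    · simp
  refine (Finset.sum_le_sum h1).trans ?_
  have h2 : ∑ x ∈ (Finset.univ ×ˢ T : Finset (Fin 13 × ι)),
      (if x.1 = c ∧ x.2 ∈ B then (1 : ℝ) else 0) = (T ∩ B).card := by
    rw [Finset.sum_product]
    simp only [ite_and]
    rw [Finset.sum_comm]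
    simp [Finset.sum_ite_mem]
  rw [Finset.sum_add_distrib, ← Finset.mul_sum, h2, Finset.sum_const, nsmul_eq_mul, mul_one,
    Finset.card_product, Finset.card_univ, Fintype.card_fin]
  have h3 := Real.add_one_le_exp (4 * θ / 13 * ((T ∩ B).card : ℝ))
  have h4 : 2 * (θ * s) * ((T ∩ B).card : ℝ) ≤ 2 * (θ * (2 * T.card)) * (T ∩ B).card := by gcongr
  push_cast
  calc 13 * (T.card : ℝ) + 2 * (θ * s) * ((T ∩ B).card : ℝ)
      ≤ 13 * T.card * (4 * θ / 13 * ((T ∩ B).card : ℝ) + 1) := by linarith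
    _ ≤ _ := by gcongr

/-- The exponential moment of the items that share the colour of the item `p` and are on board with
it, if the representative and the colour of `p` are given by `x`. -/
theorem sum_exp_load_le {ι κ : Type} [Fintype κ] [DecidableEq κ] [DecidableEq ι]
    {T : κ → Finset ι} (hdisj : Pairwise fun p q => Disjoint (T p) (T q))
    {s : κ → ℝ} {θ lam : ℝ} (hθ : 0 ≤ θ) (hs0 : ∀ p, 0 ≤ s p) (hs1 : ∀ p, θ * s p ≤ 1)
    (hs2 : ∀ p, s p ≤ 2 * (T p).card) {B : ι → Finset ι} (hB : ∀ i, ((B i).card : ℝ) ≤ lam)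
    {Ω : κ → Finset (Fin 13 × ι)} (hΩ : ∀ p, Ω p = Finset.univ ×ˢ T p)
    (hΩ0 : ∀ p, ((Ω p).card : ℝ) ≠ 0) {p : κ} {x : Fin 13 × ι} (hx : x ∈ Ω p) :
    ∑ ω ∈ Fintype.piFinset Ω, (if ω p = x then
      Real.exp (θ * ∑ q, if (ω q).1 = x.1 ∧ (ω q).2 ∈ B x.2 then s q else 0) else 0) ≤
      (∏ q, ((Ω q).card : ℝ)) * Real.exp (1 + 4 * θ / 13 * lam) / (Ω p).card := by
  set g : κ → Fin 13 × ι → ℝ := fun q y => if q = p ∧ y ≠ x then 0 else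
    Real.exp (θ * if y.1 = x.1 ∧ y.2 ∈ B x.2 then s q else 0) with hg
  have h1 : ∀ ω : κ → Fin 13 × ι, (if ω p = x then
      Real.exp (θ * ∑ q, if (ω q).1 = x.1 ∧ (ω q).2 ∈ B x.2 then s q else 0) else 0) =
      ∏ q, g q (ω q) := by
    intro ω
    by_cases h : ω p = x
    · rw [if_pos h, Finset.mul_sum, Real.exp_sum]
      refine Finset.prod_congr rfl fun q _ => ?_
      refine (if_neg ?_).symm
      rintro ⟨rfl, h'⟩
      exact h' h
    · rw [if_neg h]
      have h3 : g p (ω p) = 0 := if_pos ⟨rfl, h⟩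
      exact (Finset.prod_eq_zero (f := fun q => g q (ω q)) (Finset.mem_univ p) h3).symm
  have h2 : ∀ q, ∑ y ∈ Ω q, g q y ≤ (if q = p then Real.exp 1 else (Ω q).card) *
      Real.exp (4 * θ / 13 * (T q ∩ B x.2).card) := by
    intro q
    split_ifs with hq
    · subst hq
      have h3 : ∑ y ∈ Ω q, g q y ≤ Real.exp 1 := by
        rw [Finset.sum_eq_single_of_mem x hx fun y _ hy => if_pos ⟨rfl, hy⟩]
        refine (if_neg fun h => h.2 rfl).trans_le ?_
        refine Real.exp_le_exp.2 ?_
        split_ifs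
        · exact hs1 q
        · simp
      refine h3.trans (le_mul_of_one_le_right (Real.exp_pos _).le (Real.one_le_exp ?_))
      exact mul_nonneg (by linarith) (Nat.cast_nonneg _)
    · refine le_trans (le_of_eq (Finset.sum_congr rfl fun y _ => if_neg fun h => hq h.1)) ?_
      rw [hΩ]
      exact sum_exp_le (hs0 q) hθ (hs1 q) (hs2 q) x.1
  simp only [h1]
  rw [← Finset.prod_univ_sum]
  refine (Finset.prod_le_prod (fun q _ => Finset.sum_nonneg fun y _ => ?_)
    fun q _ => h2 q).trans ?_
  · simp only [hg]
    split_ifs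
    · exact le_rfl
    all_goals exact (Real.exp_pos _).le
  rw [Finset.prod_mul_distrib, ← Real.exp_sum, ← Finset.mul_sum]
  have h3 : (∏ q, if q = p then Real.exp 1 else ((Ω q).card : ℝ)) =
      (∏ q, ((Ω q).card : ℝ)) * Real.exp 1 / (Ω p).card := by
    rw [eq_div_iff (hΩ0 p), ← Finset.mul_prod_erase _ _ (Finset.mem_univ p),
      ← Finset.mul_prod_erase (a := p) Finset.univ (fun q => ((Ω q).card : ℝ)) (Finset.mem_univ p),
      if_pos rfl, Finset.prod_congr rfl fun q hq => if_neg (Finset.ne_of_mem_erase hq)]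
    ring
  have h4 : ∑ q, ((T q ∩ B x.2).card : ℝ) ≤ lam := by
    refine le_trans ?_ (hB x.2)
    rw [← Nat.cast_sum, Nat.cast_le, ← Finset.card_biUnion fun p _ q _ hpq =>
      (hdisj hpq).mono Finset.inter_subset_left Finset.inter_subset_left]
    exact Finset.card_le_card (Finset.biUnion_subset.2 fun q _ => Finset.inter_subset_right)
  have hprod : 0 ≤ ∏ q, ((Ω q).card : ℝ) := Finset.prod_nonneg fun q _ => Nat.cast_nonneg _
  rw [h3, Real.exp_add, div_mul_eq_mul_div, mul_assoc]
  refine div_le_div_of_nonneg_right (mul_le_mul_of_nonneg_left (mul_le_mul_of_nonneg_left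
    (Real.exp_le_exp.2 (mul_le_mul_of_nonneg_left h4 (by linarith))) (Real.exp_pos _).le) hprod)
    (Nat.cast_nonneg _)

/-- If every item `p` is represented by a random element `f p` of `T p` and gets a random colour,
then the items of the colour of `p` with representatives in `B (f p)` are unlikely to exceed the
capacity. -/
theorem exists_representatives {ι κ : Type} [Fintype κ] [DecidableEq κ] [DecidableEq ι]
    {T : κ → Finset ι} (hT : ∀ p, (T p).Nonempty) (hdisj : Pairwise fun p q => Disjoint (T p) (T q))
    {s : κ → ℝ} {θ lam cap : ℝ} (hθ : 0 ≤ θ) (hs0 : ∀ p, 0 ≤ s p) (hs1 : ∀ p, θ * s p ≤ 1)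
    (hs2 : ∀ p, s p ≤ 2 * (T p).card) {B : ι → Finset ι} (hB : ∀ i, ((B i).card : ℝ) ≤ lam)
    (hsmall : Fintype.card κ * Real.exp (1 + 4 * θ / 13 * lam - θ * cap) < 1) :
    ∃ (col : κ → Fin 13) (f : κ → ι), (∀ p, f p ∈ T p) ∧
      ∀ p, (∑ q, if col q = col p ∧ f q ∈ B (f p) then s q else 0) ≤ cap := by
  obtain ⟨Ω, hΩ⟩ : ∃ Ω : κ → Finset (Fin 13 × ι), ∀ p, Ω p = Finset.univ ×ˢ T p :=
    ⟨_, fun _ => rfl⟩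
  have hΩ0 : ∀ p, (0 : ℝ) < (Ω p).card := fun p => by
    have := hT p
    rw [hΩ]
    exact_mod_cast Finset.card_pos.2
      ((Finset.univ_nonempty (α := Fin 13)).product this)
  set load : (κ → Fin 13 × ι) → Fin 13 × ι → ℝ := fun ω x =>
    ∑ q, if (ω q).1 = x.1 ∧ (ω q).2 ∈ B x.2 then s q else 0 with hload
  have hone := fun p x hx =>
    sum_exp_load_le hdisj hθ hs0 hs1 hs2 hB hΩ (fun p => (hΩ0 p).ne') (p := p) (x := x) hx
  -- the sum over all items
  have hsum : ∑ ω ∈ Fintype.piFinset Ω, ∑ p, Real.exp (θ * (load ω (ω p) - cap)) <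
      ∑ ω ∈ Fintype.piFinset Ω, 1 := by
    have hprod : 0 < ∏ q, ((Ω q).card : ℝ) := Finset.prod_pos fun q _ => hΩ0 q
    rw [Finset.sum_comm, Finset.sum_const, Fintype.card_piFinset, nsmul_eq_mul, mul_one]
    calc ∑ p, ∑ ω ∈ Fintype.piFinset Ω, Real.exp (θ * (load ω (ω p) - cap))
        = ∑ p, ∑ x ∈ Ω p, (∑ ω ∈ Fintype.piFinset Ω,
            if ω p = x then Real.exp (θ * load ω x) else 0) * Real.exp (-(θ * cap)) := by
          refine Finset.sum_congr rfl fun p _ => ?_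
          rw [← Finset.sum_mul, Finset.sum_comm, Finset.sum_mul]
          refine Finset.sum_congr rfl fun ω hω => ?_
          rw [Finset.sum_ite_eq, if_pos (Fintype.mem_piFinset.1 hω p), ← Real.exp_add]
          congr 1
          ring
      _ ≤ ∑ p, ∑ x ∈ Ω p, ((∏ q, ((Ω q).card : ℝ)) * Real.exp (1 + 4 * θ / 13 * lam) /
            (Ω p).card) * Real.exp (-(θ * cap)) := by
          exact Finset.sum_le_sum fun p _ => Finset.sum_le_sum fun x hx =>
            mul_le_mul_of_nonneg_right (hone p x hx) (Real.exp_pos _).le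
      _ = (∏ q, ((Ω q).card : ℝ)) *
            (Fintype.card κ * Real.exp (1 + 4 * θ / 13 * lam - θ * cap)) := by
          have : ∀ p, ∑ x ∈ Ω p, ((∏ q, ((Ω q).card : ℝ)) * Real.exp (1 + 4 * θ / 13 * lam) /
            (Ω p).card) * Real.exp (-(θ * cap)) = (∏ q, ((Ω q).card : ℝ)) *
              Real.exp (1 + 4 * θ / 13 * lam - θ * cap) := by
            intro p
            rw [Finset.sum_const, nsmul_eq_mul, sub_eq_add_neg, Real.exp_add _ (-(θ * cap))]
            rw [← mul_assoc, mul_div_cancel₀ _ (hΩ0 p).ne', mul_assoc]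
          simp only [this, Finset.sum_const, nsmul_eq_mul, Finset.card_univ]
          ring
      _ < ((∏ q, (Ω q).card : ℕ) : ℝ) := by
          rw [Nat.cast_prod]
          exact mul_lt_of_lt_one_right hprod hsmall
  obtain ⟨ω, hω, hlt⟩ := Finset.exists_lt_of_sum_lt hsum
  refine ⟨fun p => (ω p).1, fun p => (ω p).2, fun p => ?_, fun p => ?_⟩
  · have h1 := Fintype.mem_piFinset.1 hω p
    rw [hΩ] at h1
    exact (Finset.mem_product.1 h1).2
  · have h1 : Real.exp (θ * (load ω (ω p) - cap)) < 1 :=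
      (Finset.single_le_sum (f := fun p => Real.exp (θ * (load ω (ω p) - cap)))
        (fun _ _ => (Real.exp_pos _).le) (Finset.mem_univ p)).trans_lt hlt
    rw [Real.exp_lt_one_iff] at h1
    by_contra! h2
    exact absurd h1 (not_lt.2 (mul_nonneg hθ (sub_nonneg.2 h2.le)))

/-! ### Solutions of the rescaled instance -/

namespace WInstance

variable {n h : ℕ} {ι κ : Type} {I : WInstance n h ι} {S : Fin h → List (Stop n ι)}

open Classical in
theorem Feasible.onBoard_le_one (hS : I.Feasible S) {k : Fin h} {l : List (Stop n ι)}
    (hl : l <+: S k) (i : ι) : onBoard l i ≤ 1 := by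
  obtain ⟨k₀, -, hc⟩ := hS.served i
  have h1 := (hc k).1
  have h2 := hl.sublist.count_le (.pick i)
  have h3 : l.count (.pick i) ≤ 1 := by split_ifs at h1 <;> omega
  rw [onBoard]
  omega

theorem Feasible.onBoard_eq_zero (hS : I.Feasible S) (k : Fin h) (i : ι) : onBoard (S k) i = 0 := by
  classical
  obtain ⟨k₀, -, hc⟩ := hS.served i
  obtain ⟨h1, h2⟩ := hc k
  rw [onBoard]
  omega

/-- An item is picked up at a unique moment. -/
theorem Feasible.prefix_unique (hS : I.Feasible S) {i : ι} {k k' : Fin h} {l l' : List (Stop n ι)}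
    (hl : l ++ [.pick i] <+: S k) (hl' : l' ++ [.pick i] <+: S k') : l = l' := by
  classical
  obtain ⟨k₀, -, hc⟩ := hS.served i
  have hone : ∀ {k l}, l ++ [.pick i] <+: S k → k = k₀ ∧ l.count (.pick i) = 0 := by
    intro k l hl
    have h1 := hl.sublist.count_le (.pick i)
    rw [(hc k).1, List.count_append, List.count_singleton_self] at h1
    split_ifs at h1 with h2
    · exact ⟨h2, by omega⟩
    · omega
  obtain ⟨hk, h1⟩ := hone hl
  obtain ⟨hk', h2⟩ := hone hl'
  rw [hk] at hl
  rw [hk'] at hl'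
  have hshort : ∀ {l l' : List (Stop n ι)}, l ++ [.pick i] <+: S k₀ → l' ++ [.pick i] <+: S k₀ →
      l'.count (.pick i) = 0 → l'.length ≤ l.length := by
    intro l l' hl hl' h0
    by_contra! hlt
    have h3 := List.prefix_of_prefix_length_le hl ((List.prefix_append _ _).trans hl')
      (by simpa using hlt)
    rw [List.count_eq_zero] at h0
    exact h0 (h3.subset (by simp))
  have hlen : l.length = l'.length := le_antisymm (hshort hl' hl h1) (hshort hl hl' h2)
  have h3 := (List.prefix_of_prefix_length_le hl hl' (by simp [hlen])).eq_of_length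
    (by simp [hlen])
  exact List.append_cancel_right h3

/-- The items on board just after the item `i` has been picked up. -/
theorem Feasible.exists_onBoard_sets [Fintype ι] [DecidableEq ι] (hS : I.Feasible S)
    (hsize : ∀ i, I.size i = 1) (hcap : 0 ≤ I.cap) :
    ∃ B : ι → Finset ι, (∀ i, ((B i).card : ℝ) ≤ I.cap) ∧
      ∀ i k l, l ++ [.pick i] <+: S k → ∀ j, (onBoard (l ++ [.pick i]) j : ℝ) =
        if j ∈ B i then 1 else 0 := by
  have hex : ∀ i, ∃ B : Finset ι, (B.card : ℝ) ≤ I.cap ∧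
      ∀ k l, l ++ [.pick i] <+: S k → ∀ j, (onBoard (l ++ [.pick i]) j : ℝ) =
        if j ∈ B then 1 else 0 := by
    intro i
    by_cases h : ∃ k l, l ++ [Stop.pick i] <+: S k
    swap
    · exact ⟨∅, by simpa using hcap, fun k l hl => absurd ⟨k, l, hl⟩ h⟩
    obtain ⟨k, l, hl⟩ := h
    generalize hl₀ : l ++ [Stop.pick i] = l₀ at hl
    have h01 : ∀ j, (onBoard l₀ j : ℝ) =
        if j ∈ Finset.univ.filter (fun j => onBoard l₀ j = 1) then 1 else 0 := by
      intro j
      have h1 := hS.onBoard_nonneg hl j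
      have h2 := hS.onBoard_le_one hl j
      simp only [Finset.mem_filter_univ]
      split_ifs with h
      · rw [h, Int.cast_one]
      · rw [show onBoard l₀ j = 0 by omega, Int.cast_zero]
    refine ⟨Finset.univ.filter fun j => onBoard l₀ j = 1, ?_, fun k' l' hl' j => ?_⟩
    · have h1 := hS.capacity k _ hl
      rw [load_eq_sum] at h1
      refine le_trans (le_of_eq ?_) h1
      rw [Finset.card_filter, Nat.cast_sum]
      refine Finset.sum_congr rfl fun j _ => ?_
      rw [hsize, one_mul, h01 j]
      simp only [Finset.mem_filter_univ, Nat.cast_ite, Nat.cast_one, Nat.cast_zero]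
    · rw [hS.prefix_unique hl' (hl₀ ▸ hl), hl₀, h01]
  choose B hB using hex
  exact ⟨B, fun i => (hB i).1, fun i => (hB i).2⟩

/-- The route of one vehicle of the rescaled instance: it repeats the given route once for each
colour, serving only the items of that colour, and returns to its initial location in between. -/
def colourRoute (f : κ → ι) (col : κ → Fin 13) (v : Fin n) (l : List (Stop n ι)) :
    List (Stop n κ) :=
  (List.finRange 13).flatMap fun c =>
    l.filterMap (restrictStop f {p | col p = c}) ++ [.pass v]

theorem walkLen_closed_le {V : Type*} {d : V → V → ℝ} (hd : IsPseudoMetric d) (u : V)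
    (l : List V) : walkLen d u (l ++ [u]) ≤ 2 * walkLen d u l := by
  have h : ∀ x, walkLen d x (l ++ [u]) ≤ walkLen d x l + (d u x + walkLen d x l) := by
    induction l with
    | nil => intro x; simp [hd.symm]
    | cons y l ih =>
      intro x
      have h1 := ih y
      have h2 := hd.tri u x y
      simp only [List.cons_append, walkLen_cons]
      linarith
  have := h u
  rw [hd.self] at this
  linarith

variable {J : WInstance n h κ} {f : κ → ι} {col : κ → Fin 13}

theorem walkWeight_colourRoute_le (hf : f.Injective) (hN : J.toNetwork = I.toNetwork)
    (hsrc : ∀ p, J.src p = I.src (f p)) (htgt : ∀ p, J.tgt p = I.tgt (f p)) (v : Fin n)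
    (l : List (Stop n ι)) : J.walkWeight v (colourRoute f col v l) ≤ 26 * I.walkWeight v l := by
  have hd := I.isPseudoMetric
  have hN : J.dist = I.dist := congrArg Network.dist hN
  rw [walkWeight_eq, walkWeight_eq, hN, colourRoute, List.map_flatMap]
  have h1 := walkLen_sublist hd (List.sublist_append_left ((List.finRange 13).flatMap fun c =>
    (l.filterMap (restrictStop f {p | col p = c}) ++ [Stop.pass v]).map J.loc) [v]) v
  refine h1.trans ((walkLen_flatMap_closed_le hd _ _ _).trans ?_)
  have h2 : ∀ c, walkLen I.dist v ((l.filterMap (restrictStop f {p | col p = c}) ++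
      [Stop.pass v]).map J.loc ++ [v]) ≤ 2 * walkLen I.dist v (l.map I.loc) := by
    intro c
    rw [List.map_append, List.append_assoc]
    have h3 : walkLen I.dist v ((l.filterMap (restrictStop f {p | col p = c})).map J.loc ++
        ([Stop.pass v].map J.loc ++ [v])) = walkLen I.dist v
          ((l.filterMap (restrictStop f {p | col p = c})).map J.loc ++ [v]) := by
      have : [Stop.pass v].map J.loc ++ [v] = v :: [v] := rfl
      rw [this, walkLen_append_cons]
      simp [hd.self]
    rw [h3]
    refine (walkLen_closed_le hd v _).trans ?_
    have := walkLen_sublist hd (map_loc_restrict_sublist (A := {p | col p = c}) hf hsrc htgt l) v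
    linarith
  refine (List.sum_le_sum fun c _ => h2 c).trans (le_of_eq ?_)
  simp
  ring

open Classical in
theorem count_colourRoute (hf : f.Injective) (v : Fin n) (l : List (Stop n ι)) (p : κ) :
    (colourRoute f col v l).count (.pick p) = l.count (.pick (f p)) ∧
      (colourRoute f col v l).count (.drop p) = l.count (.drop (f p)) := by
  simp only [colourRoute, List.count_flatMap, Function.comp_def, List.count_append,
    count_pick_restrict hf, count_drop_restrict hf, Set.mem_ofPred_eq]
  constructor <;>
  · simp only [List.count_singleton, beq_iff_eq, reduceCtorEq, if_false, add_zero,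
      ← Fin.sum_univ_def]
    exact (Finset.sum_eq_single (col p) (fun c _ hc => if_neg fun h => hc h.symm) (by simp)).trans
      (if_pos rfl)

open Classical in
/-- The routes are feasible if the capacity suffices whenever a representative is picked up: between
two such moments the load does not grow. -/
theorem Feasible.colourRoute [Fintype κ] (hS : I.Feasible S) (hf : f.Injective)
    (hcap : 0 ≤ J.cap) (hsize : ∀ p, 0 ≤ J.size p)
    (hgood : ∀ p k l, l ++ [.pick (f p)] <+: S k →
      (∑ q, if col q = col p then J.size q * onBoard (l ++ [.pick (f p)]) (f q) else 0) ≤ J.cap) :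
    J.Feasible fun k => colourRoute f col (J.depot k) (S k) := by
  have hload : ∀ (c : Fin 13) (l : List (Stop n ι)),
      J.load (l.filterMap (restrictStop f {p | col p = c})) =
        ∑ q, if col q = c then J.size q * onBoard l (f q) else 0 := by
    intro c l
    rw [load_eq_sum]
    refine Finset.sum_congr rfl fun q _ => ?_
    rw [onBoard_restrict hf]
    by_cases h : col q = c <;> simp [h]
  have hle : ∀ (c : Fin 13) k l, l <+: S k →
      (∑ q, if col q = c then J.size q * onBoard l (f q) else 0) ≤ J.cap := by
    intro c k l hl
    induction l using List.reverseRecOn with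
    | nil => simpa [onBoard] using hcap
    | append_singleton l x ih =>
      by_cases hx : ∃ p, x = .pick (f p) ∧ col p = c
      · obtain ⟨p, rfl, rfl⟩ := hx
        exact hgood p k l hl
      · refine le_trans (Finset.sum_le_sum fun q _ => ?_) (ih ((List.prefix_append _ _).trans hl))
        split_ifs with hq
        · refine mul_le_mul_of_nonneg_left ?_ (hsize q)
          have hxq : x ≠ .pick (f q) := fun h => hx ⟨q, h, hq⟩
          rw [onBoard_append_singleton, if_neg hxq]
          push_cast
          split_ifs <;> simp
        · exact le_rfl
  refine ⟨fun p => ?_, fun k l hl => ?_⟩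
  · obtain ⟨k, hk, hc⟩ := hS.served (f p)
    refine ⟨k, ?_, fun k' => ?_⟩
    · have h1 : (((S k).filterMap (restrictStop f {q | col q = col p})) ++
          [Stop.pass (J.depot k)]).Sublist (WInstance.colourRoute f col (J.depot k) (S k)) :=
        List.sublist_flatten_of_mem (List.mem_map_of_mem
          (f := fun c => (S k).filterMap (restrictStop f {q | col q = c}) ++
            [Stop.pass (J.depot k)]) (List.mem_finRange (col p)))
      exact ((pair_sublist_restrict hf (A := {q | col q = col p}) rfl hk).trans
        (List.sublist_append_left _ _)).trans h1
    · rw [(count_colourRoute hf _ _ p).1, (count_colourRoute hf _ _ p).2]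
      exact hc k'
  · have hbal : Balanced J.cap ((WInstance.colourRoute f col (J.depot k) (S k)).map
        J.change) := by
      rw [WInstance.colourRoute, List.map_flatMap]
      refine Balanced.flatMap hcap fun c _ => ?_
      rw [List.map_append]
      refine Balanced.append ⟨?_, fun r hr => ?_⟩ ⟨by simp [change], fun r hr => ?_⟩
      · have h1 := hload c (S k)
        simp only [hS.onBoard_eq_zero, Int.cast_zero, mul_zero, ite_self,
          Finset.sum_const_zero] at h1
        exact h1
      · obtain ⟨r', hr', rfl⟩ := List.prefix_map_iff.1 hr
        obtain ⟨l', hl', rfl⟩ := List.prefix_filterMap_iff.1 hr'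
        exact (hload c l').trans_le (hle c k l' hl')
      · rcases r with _ | ⟨y, r⟩
        · simpa using hcap
        · simp [change] at hr
          simp [hr, hcap]
    exact hbal.2 _ (hl.map J.change)

end WInstance

theorem card_filter_get_eq {α : Type*} [DecidableEq α] [BEq α] [LawfulBEq α] (l : List α)
    (a : α) :
    (Finset.univ.filter fun i : Fin l.length => l.get i = a).card = l.count a := by
  convert Fin.card_filter_univ_eq_vector_get_eq_count a ⟨l, rfl⟩
  · rfl
  · rfl

/-- The rescaled instance is compared with `I_u`, provided that the union bound over the request types
succeeds. -/
theorem Instance.rescaled_opt_le {n h : ℕ} {α β : ℝ} (hα : 0 < α) (hβ : 0 < β)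
    (hsmall : (n : ℝ) * n * Real.exp (1 + 2 * β / 13 - β / 2 * (1 - 1 / α)) < 1)
    (I : Instance n h) :
    (I.rescaled α β).opt ≤ 27 * (I.normal α β).unit.opt := by
  classical
  refine mul_opt_ge (by norm_num) (by norm_num) fun S hS => ?_
  set J := I.rescaled α β with hJ
  set U := (I.normal α β).unit with hU
  have hlam : (0 : ℝ) < I.cap := by exact_mod_cast I.cap_pos
  have hγ : 0 < (I.cap : ℝ) / α := by positivity
  have hnormal : ∀ p : {p // p ∈ (I.normal α β).requests}, I.IsNormal α β p.1 := fun p =>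
    of_decide_eq_true (List.mem_filter.1 p.2).2
  set T : {p // p ∈ (I.normal α β).requests} → Finset (Fin (I.normal α β).requests.length) :=
    fun p => Finset.univ.filter fun i => (I.normal α β).requests.get i = p.1 with hT
  have hcard : ∀ p, (T p).card = I.requests.count p.1 := by
    intro p
    rw [hT, card_filter_get_eq]
    exact List.count_filter (p := fun p => decide (I.IsNormal α β p)) (l := I.requests)
      (decide_eq_true (hnormal p))
  have hsize : ∀ p, J.size p ≤ 2 * (T p).card := by
    intro p
    rw [hcard]
    have h1 := Int.ceil_lt_add_one ((I.requests.count p.1 : ℝ) / ((I.cap : ℝ) / α))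
    have h2 : J.size p ≤ ((I.requests.count p.1 : ℝ) / ((I.cap : ℝ) / α) + 1) *
        ((I.cap : ℝ) / α) := mul_le_mul_of_nonneg_right h1.le hγ.le
    rw [add_mul, div_mul_cancel₀ _ hγ.ne', one_mul] at h2
    have := (hnormal p).1
    linarith
  have hsize0 : ∀ p, 0 ≤ J.size p := fun p =>
    mul_nonneg (by exact_mod_cast Int.ceil_nonneg (by positivity)) hγ.le
  have hcap : (I.cap : ℝ) * (1 - 1 / α) ≤ J.cap := by
    have h1 := Int.sub_one_lt_floor α
    have h2 : (α - 1) * ((I.cap : ℝ) / α) ≤ J.cap := mul_le_mul_of_nonneg_right h1.le hγ.le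
    refine le_trans (le_of_eq ?_) h2
    field_simp
  have hcap0 : 0 ≤ J.cap := mul_nonneg (by exact_mod_cast Int.floor_nonneg.2 hα.le) hγ.le
  obtain ⟨B, hB, hboard⟩ := hS.exists_onBoard_sets (fun _ => rfl) hlam.le
  have hdisj : Pairwise fun p q => Disjoint (T p) (T q) := by
    intro p q hpq
    rw [Finset.disjoint_left]
    intro i hp hq
    exact hpq (Subtype.ext ((Finset.mem_filter.1 hp).2.symm.trans (Finset.mem_filter.1 hq).2))
  obtain ⟨col, f, hf, hgood⟩ := exists_representatives (T := T) (s := J.size)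
    (θ := β / (2 * I.cap)) (lam := I.cap) (cap := J.cap) (B := B)
    (fun p => by
      rw [← Finset.card_pos, hcard, List.count_pos_iff]
      exact List.mem_of_mem_filter p.2)
    hdisj (by positivity) hsize0
    (fun p => by
      have h1 := hsize p
      have h2 := (hnormal p).2
      rw [hcard] at h1
      rw [le_div_iff₀ hβ] at h2
      rw [div_mul_eq_mul_div, div_le_one (by positivity)]
      calc β * J.size p ≤ β * (2 * (I.requests.count p.1 : ℝ)) := by gcongr
        _ ≤ _ := by linarith)
    hsize hB (by
      refine lt_of_le_of_lt (mul_le_mul ?_ (Real.exp_le_exp.2 ?_) (Real.exp_pos _).le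
        (by positivity)) hsmall
      · have h1 := Fintype.card_subtype_le fun p => p ∈ (I.normal α β).requests
        rw [Fintype.card_prod, Fintype.card_fin] at h1
        exact_mod_cast le_trans (le_of_eq (Fintype.card_congr (Equiv.refl _))) h1
      · have h1 : β / (2 * I.cap) * (I.cap * (1 - 1 / α)) ≤ β / (2 * I.cap) * J.cap := by gcongr
        have h2 : β / (2 * I.cap) * (I.cap * (1 - 1 / α)) = β / 2 * (1 - 1 / α) := by
          field_simp
        have h3 : 4 * (β / (2 * (I.cap : ℝ))) / 13 * I.cap = 2 * β / 13 := by
          field_simp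
          norm_num
        rw [h3]
        linarith)
  have hfp : ∀ p, (I.normal α β).requests.get (f p) = p.1 := fun p => (Finset.mem_filter.1 (hf p)).2
  have hinj : Function.Injective f := fun p q hpq =>
    Subtype.ext (by rw [← hfp p, ← hfp q, hpq])
  refine (iInf₂_le (fun k => WInstance.colourRoute f col (J.depot k) (S k))
    (hS.colourRoute hinj hcap0 hsize0 fun p k l hl => ?_)).trans ?_
  · refine le_trans (le_of_eq (Finset.sum_congr rfl fun q _ => ?_)) (hgood p)
    rw [hboard _ _ _ hl]
    by_cases h1 : col q = col p <;> by_cases h2 : f q ∈ B (f p) <;> simp [h1, h2]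
  · rw [show (27 : ENNReal) = ENNReal.ofReal 27 by norm_num, ← ENNReal.ofReal_mul (by norm_num)]
    refine ENNReal.ofReal_le_ofReal ?_
    have h1 : J.weight (fun k => WInstance.colourRoute f col (J.depot k) (S k)) ≤
        26 * U.weight S := by
      rw [WInstance.weight, WInstance.weight, Finset.mul_sum]
      exact Finset.sum_le_sum fun k _ => WInstance.walkWeight_colourRoute_le (I := U) hinj rfl
        (fun p => (congrArg Prod.fst (hfp p)).symm) (fun p => (congrArg Prod.snd (hfp p)).symm) _ _
    have h2 := U.weight_nonneg S
    linarith

open Asymptotics Filter in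
/-- The failure probability tends to `0`. -/
theorem eventually_small {α β : ℕ → ℝ} (hα_pos : ∀ n, 0 < α n) (hβ_pos : ∀ n, 0 < β n)
    (hα : IsTheta atTop α fun n : ℕ => (n : ℝ) / Real.log n)
    (hβ : IsTheta atTop β fun n : ℕ => Real.sqrt (n * Real.log n)) :
    ∀ᶠ n : ℕ in atTop,
      (n : ℝ) * n * Real.exp (1 + 2 * β n / 13 - β n / 2 * (1 - 1 / α n)) < 1 := by
  obtain ⟨a, ha, hαa⟩ := hα.2.exists_pos
  obtain ⟨b, hb, hβb⟩ := hβ.2.exists_pos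
  have hlog : ∀ c : ℝ, 0 < c → ∀ᶠ n : ℕ in atTop, Real.log n ≤ c * n := by
    intro c hc
    have := (Real.isLittleO_log_id_atTop.comp_tendsto tendsto_natCast_atTop_atTop).def hc
    filter_upwards [this] with n hn
    simpa using (le_abs_self _).trans (by simpa using hn)
  have hlarge : ∀ᶠ n : ℕ in atTop, 1 < Real.log n :=
    (Real.tendsto_log_atTop.comp tendsto_natCast_atTop_atTop).eventually_gt_atTop 1
  filter_upwards [hαa.bound, hβb.bound, hlog (1 / (4 * a)) (by positivity),
    hlog (1 / (15 * b) ^ 2) (by positivity), hlarge, eventually_gt_atTop 0] with n h1 h2 h3 h4 h5 h6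
  have hn : (0 : ℝ) < n := by exact_mod_cast h6
  rw [Real.norm_of_nonneg (by positivity), Real.norm_of_nonneg (hα_pos n).le,
    div_le_iff₀ (by linarith)] at h1
  rw [Real.norm_of_nonneg (by positivity), Real.norm_of_nonneg (hβ_pos n).le] at h2
  -- `α` is at least `4`
  have hα4 : 4 ≤ α n := by
    have h7 : (n : ℝ) ≤ a * α n * (1 / (4 * a) * n) :=
      h1.trans (mul_le_mul_of_nonneg_left h3 (mul_nonneg ha.le (hα_pos n).le))
    have h8 : a * α n * (1 / (4 * a) * n) = α n / 4 * n := by field_simp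
    rw [h8] at h7
    have := le_of_mul_le_mul_right (by linarith : 1 * (n : ℝ) ≤ α n / 4 * n) hn
    linarith
  -- `β` is at least a large multiple of the logarithm
  have hβl : 15 * Real.log n ≤ β n := by
    have h7 : 15 * b * Real.log n ≤ Real.sqrt (n * Real.log n) := by
      refine Real.le_sqrt_of_sq_le ?_
      have h8 : (15 * b) ^ 2 * Real.log n ≤ n := by
        rw [div_mul_eq_mul_div, one_mul, le_div_iff₀ (by positivity)] at h4
        linarith
      calc (15 * b * Real.log n) ^ 2 = (15 * b) ^ 2 * Real.log n * Real.log n := by ring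
        _ ≤ n * Real.log n := by gcongr
    have h8 := h7.trans h2
    have : b * (15 * Real.log n) ≤ b * β n := by linarith
    exact le_of_mul_le_mul_left this hb
  have h7 : 1 / α n ≤ 1 / 4 := one_div_le_one_div_of_le (by norm_num) hα4
  have h8 : β n / 2 * (3 / 4) ≤ β n / 2 * (1 - 1 / α n) :=
    mul_le_mul_of_nonneg_left (by linarith) (by linarith [hβ_pos n])
  have h9 : (n : ℝ) * n = Real.exp (Real.log n + Real.log n) := by
    rw [Real.exp_add, Real.exp_log hn]
  rw [h9, ← Real.exp_add, Real.exp_lt_one_iff]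
  linarith

end DialARide

end

theorem mainTheorem7 (α β : ℕ → ℝ) (hα_pos : ∀ n, 0 < α n) (hβ_pos : ∀ n, 0 < β n)
    (hα : Asymptotics.IsTheta Filter.atTop α fun n : ℕ => (n : ℝ) / Real.log n)
    (hβ : Asymptotics.IsTheta Filter.atTop β fun n : ℕ => Real.sqrt (n * Real.log n)) :
    (∃ (P : DialARide.Program) (p : Polynomial ℕ) (C : ℝ), 0 < C ∧
      ∀ (n h : ℕ) (I : DialARide.Instance n h), 0 < h →
        ∃ (t : ℕ) (τ : DialARide.Memory),
          DialARide.Run P (I.normal (α n) (β n)).input t τ ∧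
          t ≤ p.eval (n + h + (I.normal (α n) (β n)).requests.length) ∧
          (I.normal (α n) (β n)).unit.Feasible (DialARide.output n τ) ∧
          ENNReal.ofReal ((I.normal (α n) (β n)).unit.weight (DialARide.output n τ)) ≤
            ENNReal.ofReal (C * Real.sqrt (n * Real.log n)) * (I.normal (α n) (β n)).unit.opt ∧
          (I.normal (α n) (β n)).unit.opt ≤ I.unit.opt) ∧
    (∀ᶠ n : ℕ in Filter.atTop, ∀ (h : ℕ) (I : DialARide.Instance n h),
      (I.rescaled (α n) (β n)).opt ≤ 27 * (I.normal (α n) (β n)).unit.opt) := by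
  refine ⟨?_, ?_⟩
  · obtain ⟨p, hp⟩ := DialARide.Program.exists_polynomial_time DialARide.algorithm
    refine ⟨DialARide.algorithm, p, 9672, by norm_num, fun n h I hh => ?_⟩
    obtain ⟨τ, ⟨t, hrun, ht⟩, hfeas, hw⟩ :=
      DialARide.algorithm_guarantee (I.normal (α n) (β n)) hh
    exact ⟨t, τ, hrun, by rwa [hp], hfeas, hw,
      DialARide.Instance.opt_le_of_sublist rfl rfl List.filter_sublist⟩
  · filter_upwards [DialARide.eventually_small hα_pos hβ_pos hα hβ] with n hn h I
    exact I.rescaled_opt_le (hα_pos n) (hβ_pos n) hn
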